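/- **Setting.** Let $\phi_1=1$, $\phi_{2m}(t)=\sqrt2\cos(2\pi mt)$, $\phi_{2m+1}(t)=\sqrt2\sin(2\pi mt)$ ($m\ge1$) be the trigonometric orthonormal basis of $L^2[0,1]$, and for $\alpha,Q>0$ let $$E_\alpha(Q)=\Big\{f\in L^2[0,1]:\ \sum_{j\ge1}j^{2\alpha}\theta_j^2\le Q^2,\ \theta_j=\int_0^1 f\phi_j\Big\}.$$ For a function $f$ on $[0,1]$ let $P_f$ be the distribution on $[0,1]$ with Lebesgue density $p_f=e^f/\int_0^1e^{f}$, let $P_f^n$ be the law of $n$ independent observations $X_1,\dots,X_n$ from $P_f$, and let $H(P_f,P_g)=\big(\int_0^1(\sqrt{p_f}-\sqrt{p_g})^2\big)^{1/2}$. *Prior.* Let $l_k=\lfloor e^k\rfloor$ and $B_k=\{l_k,\dots,l_{k+1}-1\}$ for $k\ge0$. Let $g_k$ $(k\ge0)$ be probability densities on $(0,\infty)$ for which there are constants $c_1,c_2,c_3>0$ such that, for all $k$, $$g_k(t)\ge \exp(-c_1e^k)\ \text{ for } t\in[e^{-k^2},e^{-k}],\qquad \int_0^\infty t\,g_k(t)\,dt\le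 4e^{-c_2k^2},\qquad \int_{e^{-k^2}}^\infty g_k(t)\,dt\le \exp(-c_3e^k).$$ Under the block prior, the scales $A_k\sim g_k$ are independent, and given $(A_k)$ the coordinates $\theta_j$ are independent with $\theta_j\sim N(0,A_k)$ for $j\in B_k$. Since $\theta_1$ does not affect $p_f$, it is set to $0$; let $\bar\Pi$ be the resulting law of $\theta=(\theta_j)_{j\ge1}$. For $B>0$ let $D=\{\theta:\sum_j|\theta_j|<B\}$, and let $\Pi(A)=\bar\Pi(A\cap D)/\bar\Pi(D)$ be the modified block prior, regarded as a prior on $f=\sum_j\theta_j\phi_j$. Its posterior is $$\Pi(A\mid X_1,\dots,X_n)=\frac{\int_A\prod_{i=1}^n\frac{p_f(X_i)}{p_{f_0}(X_i)}\,d\Pi(f)}{\int\prod_{i=1}^n\frac{p_f(X_i)}{p_{f_0}(X_i)}\,d\Pi(f)}.$$ **Theorem.** Let $\alpha^*>1/2$ and $\gamma=\big(\sum_{j\ge1}j^{-2\alpha^*}\big)^{1/2}$. Let $\alpha\ge\alpha^*$, $Q>0$ and $B\ge3\gamma Q$. Then $\Pi$ is a well-defined probability measure (that is, $\bar\Pi(D)>0$),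 $P_{f_0}$ is a well-defined probability measure for every $f_0\in E_\alpha(Q)$, and there is a constant $M>0$ such that $$\sup_{f_0\in E_\alpha(Q)}P_{f_0}^n\,\Pi\Big(H(P_f,P_{f_0})>M n^{-\frac{\alpha}{2\alpha+1}}\,\Big|\,X_1,\dots,X_n\Big)\longrightarrow0\qquad(n\to\infty),$$ where $P_{f_0}^n$ applied to the posterior probability denotes its expectation under $X_1,\dots,X_n\sim P_{f_0}^n$. -/

import Mathlib

open MeasureTheory ProbabilityTheory Filter Topology
open scoped ENNReal NNReal

noncomputable section

namespace BlockPrior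

/-- Lebesgue measure on the unit interval, as a measure on the real line. -/
abbrev unitVolume : Measure ℝ := volume.restrict (Set.Icc 0 1)

/-! ### The trigonometric basis and Sobolev balls -/

/-- The trigonometric orthonormal basis of `L²[0,1]`, indexed from one: `φ₁ = 1`,
`φ₂ₘ(t) = √2 cos (2π m t)` and `φ₂ₘ₊₁(t) = √2 sin (2π m t)` for `m ≥ 1`. -/
def trigBasis (j : ℕ+) (t : ℝ) : ℝ :=
  if j = 1 then 1
  else if Even (j : ℕ) then √2 * Real.cos (2 * Real.pi * (((j : ℕ) / 2 : ℕ) : ℝ) * t)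
  else √2 * Real.sin (2 * Real.pi * (((j : ℕ) / 2 : ℕ) : ℝ) * t)

/-- The `j`-th Fourier coefficient `∫₀¹ f φⱼ`. -/
def fourierCoefficient (f : ℝ → ℝ) (j : ℕ+) : ℝ :=
  ∫ t, f t * trigBasis j t ∂unitVolume

/-- The Sobolev ball `E_α(Q)` of square integrable functions on `[0,1]` (only their values on
`[0,1]` matter) with `∑ⱼ j^{2α} θⱼ² ≤ Q²`, where `θⱼ` is the `j`-th Fourier coefficient. The sum is
taken in `[0,∞]`. -/
def sobolevBall (α Q : ℝ) : Set (ℝ → ℝ) :=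
  {f | MemLp f 2 unitVolume ∧
    ∑' j : ℕ+, ENNReal.ofReal (((j : ℕ) : ℝ) ^ (2 * α) * fourierCoefficient f j ^ 2)
      ≤ ENNReal.ofReal (Q ^ 2)}

/-- The function `f = ∑ⱼ θⱼ φⱼ` with coefficient sequence `θ`. It is only used for absolutely
summable `θ`, where the series converges absolutely at every point. -/
def fourierSeries (θ : ℕ+ → ℝ) (t : ℝ) : ℝ := ∑' j : ℕ+, θ j * trigBasis j t

/-- The constant `γ = (∑ⱼ j^{-2α*})^{1/2}`. -/
def gammaConst (αs : ℝ) : ℝ := √(∑' j : ℕ+, ((j : ℕ) : ℝ) ^ (-2 * αs))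

/-! ### The density model -/

/-- The density `p_f = e^f / ∫₀¹ e^f` on `[0,1]`. -/
def expDensity (f : ℝ → ℝ) (t : ℝ) : ℝ := Real.exp (f t) / ∫ s, Real.exp (f s) ∂unitVolume

/-- The distribution `P_f` on `[0,1]` with Lebesgue density `p_f`. -/
def expMeasure (f : ℝ → ℝ) : Measure ℝ :=
  unitVolume.withDensity fun t => ENNReal.ofReal (expDensity f t)

/-- The law `P_f^n` of `n` independent observations from `P_f`. -/
def sampleLaw (f : ℝ → ℝ) (n : ℕ) : Measure (Fin n → ℝ) := Measure.pi fun _ => expMeasure f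

/-- The Hellinger distance `H(P_f, P_g) = (∫₀¹ (√p_f - √p_g)²)^{1/2}`. -/
def hellinger (f g : ℝ → ℝ) : ℝ :=
  √(∫ t, (√(expDensity f t) - √(expDensity g t)) ^ 2 ∂unitVolume)

/-! ### The block prior -/

/-- The first index `l_k = [e^k]` of the `k`-th block `B_k = {l_k, …, l_{k+1} - 1}`. -/
def blockStart (k : ℕ) : ℕ := ⌊Real.exp k⌋₊

open Classical in
/-- The number `k` of the block `B_k` that contains `j`, that is, the largest `k` with
`l_k ≤ j`. -/
def blockIndex (j : ℕ+) : ℕ := Nat.findGreatest (fun k => blockStart k ≤ j) j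

theorem lt_blockStart (k : ℕ) : k < blockStart k := by
  unfold blockStart
  have h := Real.add_one_le_exp (k : ℝ)
  exact Nat.lt_of_succ_le (Nat.le_floor (by push_cast; linarith))

theorem blockIndex_spec (j : ℕ+) :
    blockStart (blockIndex j) ≤ j ∧ (j : ℕ) < blockStart (blockIndex j + 1) := by
  classical
  constructor
  · have h0 : blockStart 0 ≤ (j : ℕ) := by
      have := j.pos
      simp only [blockStart, Nat.cast_zero, Real.exp_zero, Nat.floor_one]
      omega
    simpa [blockIndex] using
      Nat.findGreatest_spec (P := fun k => blockStart k ≤ (j : ℕ)) (Nat.zero_le _) h0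
  · by_contra! hc
    have hle : blockIndex j + 1 ≤ (j : ℕ) := (lt_blockStart _).le.trans hc
    have h1 : blockIndex j + 1 ≤ blockIndex j := by
      conv_rhs => unfold blockIndex
      convert Nat.le_findGreatest (P := fun k => blockStart k ≤ (j : ℕ)) hle hc
    omega

/-- The class of mixing densities: `g k` is a probability density on `(0,∞)` for every `k ≥ 0`,
and the three quantitative conditions hold with constants that do not depend on `k`. -/
structure IsMixing (g : ℕ → ℝ → ℝ) : Prop where
  measurable : ∀ k, Measurable (g k)
  nonneg : ∀ k, ∀ t, 0 < t → 0 ≤ g k t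
  lintegral_eq_one : ∀ k, ∫⁻ t in Set.Ioi 0, ENNReal.ofReal (g k t) = 1
  lower_bound : ∃ c₁ > 0, ∀ k : ℕ, ∀ t ∈ Set.Icc (Real.exp (-(k : ℝ) ^ 2)) (Real.exp (-(k : ℝ))),
    Real.exp (-c₁ * Real.exp k) ≤ g k t
  mean_bound : ∃ c₂ > 0, ∀ k : ℕ,
    ∫⁻ t in Set.Ioi 0, ENNReal.ofReal (t * g k t) ≤
      ENNReal.ofReal (4 * Real.exp (-c₂ * (k : ℝ) ^ 2))
  tail_bound : ∃ c₃ > 0, ∀ k : ℕ,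
    ∫⁻ t in Set.Ioi (Real.exp (-(k : ℝ) ^ 2)), ENNReal.ofReal (g k t) ≤
      ENNReal.ofReal (Real.exp (-c₃ * Real.exp k))

/-- The joint law of the independent scales `A_k ∼ g_k`. -/
def scaleLaw (g : ℕ → ℝ → ℝ) : Measure (ℕ → ℝ) :=
  Measure.infinitePi fun k =>
    (volume.restrict (Set.Ioi 0)).withDensity fun t => ENNReal.ofReal (g k t)

/-- The law of `θ` given the scales `A`: the coordinates are independent, and those in the block
`B_k` are `N(0, A_k)`. -/
def gaussianGivenScales (A : ℕ → ℝ) : Measure (ℕ+ → ℝ) :=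
  Measure.infinitePi fun j => gaussianReal 0 (A (blockIndex j)).toNNReal

/-- The conditional law of `θ` depends measurably on the scales. -/
theorem measurable_gaussianGivenScales : Measurable gaussianGivenScales := by
  let F : (ℕ → ℝ) × (ℕ+ → ℝ) → (ℕ+ → ℝ) := fun p j =>
    √((p.1 (blockIndex j)).toNNReal : ℝ) * p.2 j
  have hF : Measurable F := by fun_prop
  have heq : gaussianGivenScales = fun A =>
      ((Measure.infinitePi fun _ : ℕ+ => gaussianReal 0 1).map (Prod.mk A)).map F := by
    funext A
    rw [Measure.map_map hF measurable_prodMk_left]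
    have := Measure.infinitePi_map_pi (fun _ : ℕ+ => gaussianReal 0 1)
      (f := fun j x => √((A (blockIndex j)).toNNReal : ℝ) * x) (fun j => by fun_prop)
    refine Eq.trans ?_ this.symm
    unfold gaussianGivenScales
    congr 1
    funext j
    rw [gaussianReal_map_const_mul]
    congr 1
    · simp
    · ext; simp
  rw [heq]
  exact (Measure.measurable_map F hF).comp Measurable.map_prodMk_left

/-- The block prior: the mixture over the scales of the conditional Gaussian laws. -/
def blockPrior (g : ℕ → ℝ → ℝ) : Measure (ℕ+ → ℝ) :=
  (scaleLaw g).bind gaussianGivenScales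

/-- The block prior for density estimation, where the coefficient of the constant function
`φ₁ = 1` is set to zero because it does not affect `p_f`. -/
def centredBlockPrior (g : ℕ → ℝ → ℝ) : Measure (ℕ+ → ℝ) :=
  (blockPrior g).map fun θ => Function.update θ 1 0

/-- The constraint set `D = {θ : ∑ⱼ |θⱼ| < B}`. The sum is taken in `[0,∞]`. -/
def constraintSet (B : ℝ) : Set (ℕ+ → ℝ) :=
  {θ | ∑' j : ℕ+, ENNReal.ofReal |θ j| < ENNReal.ofReal B}

/-- The modified block prior: the block prior conditioned on the constraint set. -/
def modifiedBlockPrior (g : ℕ → ℝ → ℝ) (B : ℝ) : Measure (ℕ+ → ℝ) :=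
  (centredBlockPrior g)[|constraintSet B]

/-! ### The posterior -/

/-- The likelihood ratio `∏ᵢ p_f(xᵢ) / p_{f₀}(xᵢ)` for `f = ∑ⱼ θⱼ φⱼ`. -/
def likelihoodRatio (f₀ : ℝ → ℝ) {n : ℕ} (x : Fin n → ℝ) (θ : ℕ+ → ℝ) : ℝ≥0∞ :=
  ENNReal.ofReal (∏ i, expDensity (fourierSeries θ) (x i) / expDensity f₀ (x i))

/-- The posterior probability of `S` given the observations `x`, for the prior `Pr` and the
truth `f₀`. -/
def posterior (Pr : Measure (ℕ+ → ℝ)) (f₀ : ℝ → ℝ) {n : ℕ} (x : Fin n → ℝ)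
    (S : Set (ℕ+ → ℝ)) : ℝ≥0∞ :=
  (∫⁻ θ in S, likelihoodRatio f₀ x θ ∂Pr) / ∫⁻ θ, likelihoodRatio f₀ x θ ∂Pr

end BlockPrior

end

namespace BlockPrior

/-! ### The trigonometric basis -/

/-! Choose `K` with `e^{(2α+1)K} ≤ n ≤ e^{(2α+1)(K+1)}`. Then the squared rate is of order
`e^{-2αK}`, and `e^K` is both the number of coordinates that matter and the order of `n` times the
squared rate. Every bound below has the form `exp(± C e^K)`, and the theorem follows once the
constants are ordered correctly.

On the constraint set all log densities are bounded by a fixed constant. The Hellinger distance, the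
`χ²` type divergence and the `L²` distance of the exponents are therefore comparable there, and by
Parseval the last one is the `ℓ²` distance of the coefficients. Setting `θ 1 = 0` removes the
additive constant that the density does not see, which makes the comparison two-sided.

Three facts are combined. (1) Prior mass, `IsMixing.exists_priorNhd_ge`: with probability at least
`exp(-C e^K)` each scale `A_k` with `k ≤ K` is of order `e^{-(2α+1)k}`, and then the first `e^K` or
so coordinates lie within `e^{-(α+1/2)K}` of the truth at a Gaussian cost of order `e^K` in the
exponent; the later coordinates are negligible by the mean bound. (2) Sieve,
`IsMixing.exists_compl_tailBall_le`: the tail bound on the scales makes all coordinates beyond block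
`K + m` tiny, outside a set of prior mass `exp(-C e^K)` with `C` as large as desired. (3)
Separation, `exists_affinity_bounds` and `exists_shell_cover`: on the sieve, dyadic shells around
the truth have nets of size `exp(C e^K)`, and the square root of the likelihood ratio at a net point
separates the truth from a whole `L²` ball around that point.

`lintegral_posterior_le` assembles the three without test functions or high-probability events: the
denominator is controlled through the expected inverse likelihood ratio, and each net cell through a
weight `T` and its inverse. `IsMixing.exists_contraction` fixes the constants, and the theorem
follows because a function in the Sobolev ball has, almost everywhere, the density of a centred
absolutely convergent series. -/

instance : IsProbabilityMeasure unitVolume := ⟨by simp⟩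

theorem integral_unitVolume (f : ℝ → ℝ) : ∫ t, f t ∂unitVolume = ∫ t in (0 : ℝ)..1, f t := by
  rw [intervalIntegral.integral_of_le zero_le_one, integral_Icc_eq_integral_Ioc]

theorem integral_cos_two_pi (a : ℤ) :
    ∫ t, Real.cos (2 * Real.pi * a * t) ∂unitVolume = if a = 0 then 1 else 0 := by
  rw [integral_unitVolume]
  split_ifs with h
  · simp [h]
  · have hne : 2 * Real.pi * (a : ℝ) ≠ 0 := by
      have := Real.pi_ne_zero
      have : (a : ℝ) ≠ 0 := by exact_mod_cast h
      positivity
    rw [intervalIntegral.integral_comp_mul_left (fun x => Real.cos x) hne, integral_cos]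
    have : Real.sin (2 * Real.pi * a * 1) = 0 := by
      rw [Real.sin_eq_zero_iff]; exact ⟨2 * a, by push_cast; ring⟩
    rw [this]; simp

theorem integral_sin_two_pi (a : ℤ) :
    ∫ t, Real.sin (2 * Real.pi * a * t) ∂unitVolume = 0 := by
  rw [integral_unitVolume]
  rcases eq_or_ne a 0 with h | h
  · simp [h]
  · have hne : 2 * Real.pi * (a : ℝ) ≠ 0 := by
      have := Real.pi_ne_zero
      have : (a : ℝ) ≠ 0 := by exact_mod_cast h
      positivity
    rw [intervalIntegral.integral_comp_mul_left (fun x => Real.sin x) hne, integral_sin]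
    have : Real.cos (2 * Real.pi * a * 1) = 1 := by
      rw [Real.cos_eq_one_iff]; exact ⟨a, by ring⟩
    rw [this]; simp

theorem integrable_unitVolume {f : ℝ → ℝ} (hf : Continuous f) : Integrable f unitVolume :=
  hf.continuousOn.integrableOn_compact isCompact_Icc

theorem integral_cos_mul_cos (a b : ℕ) :
    ∫ t, Real.cos (2 * Real.pi * a * t) * Real.cos (2 * Real.pi * b * t) ∂unitVolume =
      ((if (a : ℤ) - b = 0 then 1 else 0) + if (a : ℤ) + b = 0 then 1 else 0) / 2 := by
  rw [← integral_cos_two_pi, ← integral_cos_two_pi, ← integral_add, ← integral_div]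
  · congr 1; ext t; push_cast
    have e1 : 2 * Real.pi * ((a : ℝ) - b) * t = 2 * Real.pi * a * t - 2 * Real.pi * b * t := by ring
    have e2 : 2 * Real.pi * ((a : ℝ) + b) * t = 2 * Real.pi * a * t + 2 * Real.pi * b * t := by ring
    rw [e1, e2, Real.cos_sub, Real.cos_add]; ring
  all_goals exact integrable_unitVolume (by fun_prop)

theorem integral_sin_mul_sin (a b : ℕ) :
    ∫ t, Real.sin (2 * Real.pi * a * t) * Real.sin (2 * Real.pi * b * t) ∂unitVolume =
      ((if (a : ℤ) - b = 0 then 1 else 0) - if (a : ℤ) + b = 0 then 1 else 0) / 2 := by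
  rw [← integral_cos_two_pi, ← integral_cos_two_pi, ← integral_sub, ← integral_div]
  · congr 1; ext t; push_cast
    have e1 : 2 * Real.pi * ((a : ℝ) - b) * t = 2 * Real.pi * a * t - 2 * Real.pi * b * t := by ring
    have e2 : 2 * Real.pi * ((a : ℝ) + b) * t = 2 * Real.pi * a * t + 2 * Real.pi * b * t := by ring
    rw [e1, e2, Real.cos_sub, Real.cos_add]; ring
  all_goals exact integrable_unitVolume (by fun_prop)

theorem integral_sin_mul_cos (a b : ℕ) :
    ∫ t, Real.sin (2 * Real.pi * a * t) * Real.cos (2 * Real.pi * b * t) ∂unitVolume = 0 := by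
  have h : ∫ t, Real.sin (2 * Real.pi * a * t) * Real.cos (2 * Real.pi * b * t) ∂unitVolume =
      (∫ t, Real.sin (2 * Real.pi * ((a + b : ℤ) : ℝ) * t) ∂unitVolume +
        ∫ t, Real.sin (2 * Real.pi * ((a - b : ℤ) : ℝ) * t) ∂unitVolume) / 2 := by
    rw [← integral_add, ← integral_div]
    · congr 1; ext t; push_cast
      have e1 : 2 * Real.pi * ((a : ℝ) - b) * t = 2 * Real.pi * a * t - 2 * Real.pi * b * t := by
        ring
      have e2 : 2 * Real.pi * ((a : ℝ) + b) * t = 2 * Real.pi * a * t + 2 * Real.pi * b * t := by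
        ring
      rw [e1, e2, Real.sin_sub, Real.sin_add]; ring
    all_goals exact integrable_unitVolume (by fun_prop)
  rw [h, integral_sin_two_pi, integral_sin_two_pi]; simp

theorem trigBasis_one : trigBasis 1 = fun _ => 1 := by ext; simp [trigBasis]

theorem trigBasis_even {j : ℕ+} (h : Even (j : ℕ)) :
    trigBasis j = fun t => √2 * Real.cos (2 * Real.pi * (((j : ℕ) / 2 : ℕ) : ℝ) * t) := by
  have : j ≠ 1 := by rintro rfl; simp at h
  ext; simp [trigBasis, this, h]

theorem trigBasis_odd {j : ℕ+} (h1 : j ≠ 1) (h : ¬ Even (j : ℕ)) :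
    trigBasis j = fun t => √2 * Real.sin (2 * Real.pi * (((j : ℕ) / 2 : ℕ) : ℝ) * t) := by
  ext; simp [trigBasis, h1, h]

theorem continuous_trigBasis (j : ℕ+) : Continuous (trigBasis j) := by
  by_cases h1 : j = 1
  · subst h1; rw [trigBasis_one]; fun_prop
  by_cases h : Even (j : ℕ)
  · rw [trigBasis_even h]; fun_prop
  · rw [trigBasis_odd h1 h]; fun_prop

theorem abs_trigBasis_le (j : ℕ+) (t : ℝ) : |trigBasis j t| ≤ √2 := by
  have h2 : (1 : ℝ) ≤ √2 := by rw [Real.one_le_sqrt]; norm_num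
  unfold trigBasis
  split_ifs
  · simp
  · rw [abs_mul, abs_of_nonneg (by positivity : 0 ≤ √2)]
    exact mul_le_of_le_one_right (by positivity) (Real.abs_cos_le_one _)
  · rw [abs_mul, abs_of_nonneg (by positivity : 0 ≤ √2)]
    exact mul_le_of_le_one_right (by positivity) (Real.abs_sin_le_one _)

/-- Product-to-sum formulas reduce everything to integrals of one cosine or sine. Both frequencies
are at least one away from the constant, so the sum frequency never vanishes; the difference
vanishes exactly when the halved indices agree, and the halved index together with the parity
determines the index. -/
theorem integral_trigBasis_mul (i j : ℕ+) :
    ∫ t, trigBasis i t * trigBasis j t ∂unitVolume = if i = j then 1 else 0 := by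
  have sq2 : √2 * √2 = (2 : ℝ) := Real.mul_self_sqrt (by norm_num)
  have half_pos : ∀ {k : ℕ+}, k ≠ 1 → 0 < (k : ℕ) / 2 := fun {k} h => by
    have : (k : ℕ) ≠ 1 := by simpa using h
    have := k.pos
    omega
  have hinj : ∀ {i j : ℕ+}, (i : ℕ) = j ↔ i = j := PNat.coe_inj
  have hcos1 (a : ℕ) (ha : 0 < a) : ∫ t, Real.cos (2 * Real.pi * a * t) ∂unitVolume = 0 := by
    have := integral_cos_two_pi a
    rw [if_neg (by omega)] at this
    exact_mod_cast this
  have hsin1 (a : ℕ) : ∫ t, Real.sin (2 * Real.pi * a * t) ∂unitVolume = 0 := by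
    exact_mod_cast integral_sin_two_pi a
  have scale (f h : ℝ → ℝ) : ∫ t, √2 * f t * (√2 * h t) ∂unitVolume
      = 2 * ∫ t, f t * h t ∂unitVolume := by
    rw [← integral_const_mul]; congr 1; ext t; linear_combination (f t * h t) * sq2
  by_cases hi : i = 1
  · subst hi
    rw [trigBasis_one]
    by_cases hj : j = 1
    · subst hj; simp [trigBasis_one]
    rw [if_neg (Ne.symm hj)]
    by_cases h : Even (j : ℕ)
    · rw [trigBasis_even h]; simp only [one_mul, integral_const_mul]
      rw [hcos1 _ (half_pos hj), mul_zero]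
    · rw [trigBasis_odd hj h]; simp only [one_mul, integral_const_mul]
      rw [hsin1, mul_zero]
  have hi0 := half_pos hi
  by_cases hj : j = 1
  · subst hj
    rw [trigBasis_one, if_neg hi]
    by_cases h : Even (i : ℕ)
    · rw [trigBasis_even h]; simp only [mul_one, integral_const_mul]
      rw [hcos1 _ hi0, mul_zero]
    · rw [trigBasis_odd hi h]; simp only [mul_one, integral_const_mul]
      rw [hsin1, mul_zero]
  have hj0 := half_pos hj
  by_cases hie : Even (i : ℕ) <;> by_cases hje : Even (j : ℕ)
  · rw [trigBasis_even hie, trigBasis_even hje, scale, integral_cos_mul_cos]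
    rw [if_neg (by omega : ¬ (((i : ℕ) / 2 : ℕ) : ℤ) + ((j : ℕ) / 2 : ℕ) = 0)]
    have : (((i : ℕ) / 2 : ℕ) : ℤ) - ((j : ℕ) / 2 : ℕ) = 0 ↔ i = j := by
      rw [← hinj]; rw [Nat.even_iff] at hie hje; omega
    simp only [this]; split_ifs <;> norm_num
  · rw [trigBasis_even hie, trigBasis_odd hj hje, scale]
    rw [if_neg (by rintro rfl; exact hje hie)]
    simp_rw [mul_comm (Real.cos _)]
    rw [integral_sin_mul_cos, mul_zero]
  · rw [trigBasis_odd hi hie, trigBasis_even hje, scale, integral_sin_mul_cos]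
    rw [if_neg (by rintro rfl; exact hie hje), mul_zero]
  · rw [trigBasis_odd hi hie, trigBasis_odd hj hje, scale, integral_sin_mul_sin]
    rw [if_neg (by omega : ¬ (((i : ℕ) / 2 : ℕ) : ℤ) + ((j : ℕ) / 2 : ℕ) = 0)]
    have : (((i : ℕ) / 2 : ℕ) : ℤ) - ((j : ℕ) / 2 : ℕ) = 0 ↔ i = j := by
      rw [← hinj]; rw [Nat.even_iff] at hie hje; omega
    simp only [this]; split_ifs <;> norm_num

/-! ### Absolutely convergent Fourier series -/

theorem summable_fourierSeries {θ : ℕ+ → ℝ} (hθ : Summable fun j => |θ j|) (t : ℝ) :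
    Summable fun j => θ j * trigBasis j t := by
  refine Summable.of_norm_bounded (hθ.mul_right √2) fun j => ?_
  rw [Real.norm_eq_abs, abs_mul]
  exact mul_le_mul_of_nonneg_left (abs_trigBasis_le j t) (abs_nonneg _)

theorem continuous_fourierSeries {θ : ℕ+ → ℝ} (hθ : Summable fun j => |θ j|) :
    Continuous (fourierSeries θ) := by
  refine continuous_tsum (fun j => continuous_const.mul (continuous_trigBasis j))
    (hθ.mul_right √2) fun j t => ?_
  rw [Real.norm_eq_abs, abs_mul]
  exact mul_le_mul_of_nonneg_left (abs_trigBasis_le j t) (abs_nonneg _)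

theorem abs_fourierSeries_le {θ : ℕ+ → ℝ} (hθ : Summable fun j => |θ j|) (t : ℝ) :
    |fourierSeries θ t| ≤ √2 * ∑' j, |θ j| := by
  rw [← tsum_mul_left]
  rw [fourierSeries, ← Real.norm_eq_abs]
  refine tsum_of_norm_bounded (hθ.mul_left √2).hasSum fun j => ?_
  rw [Real.norm_eq_abs, abs_mul, mul_comm]
  exact mul_le_mul_of_nonneg_right (abs_trigBasis_le j t) (abs_nonneg _)

/-- Absolute summability allows integration term by term. Testing against a basis function recovers
the coefficients, and testing against the series itself gives Parseval. -/
theorem hasSum_integral_mul_fourierSeries {θ : ℕ+ → ℝ} (hθ : Summable fun j => |θ j|)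
    {h : ℝ → ℝ} (hh : Integrable h unitVolume) :
    HasSum (fun j => θ j * ∫ t, h t * trigBasis j t ∂unitVolume)
      (∫ t, h t * fourierSeries θ t ∂unitVolume) := by
  have hb (j : ℕ+) : Integrable (fun t => h t * trigBasis j t) unitVolume :=
    hh.mul_bdd (c := √2) (continuous_trigBasis j).aestronglyMeasurable
      (Eventually.of_forall fun t => abs_trigBasis_le j t)
  have key := hasSum_integral_of_summable_integral_norm (μ := unitVolume)
    (F := fun j t => θ j * (h t * trigBasis j t)) (fun j => (hb j).const_mul _) ?_
  · simp_rw [integral_const_mul] at key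
    have e : ∫ t, h t * fourierSeries θ t ∂unitVolume =
        ∫ t, ∑' j, θ j * (h t * trigBasis j t) ∂unitVolume := by
      congr 1; ext t
      rw [fourierSeries, ← tsum_mul_left]
      congr 1; ext j; ring
    rw [e]; exact key
  · refine Summable.of_nonneg_of_le (fun j => integral_nonneg fun _ => norm_nonneg _) (fun j => ?_)
      (hθ.mul_right (√2 * ∫ t, ‖h t‖ ∂unitVolume))
    rw [← integral_const_mul, ← integral_const_mul]
    refine integral_mono_of_nonneg (Eventually.of_forall fun _ => norm_nonneg _)
      ((hh.norm.const_mul _).const_mul _) (Eventually.of_forall fun t => ?_)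
    simp only [norm_mul, Real.norm_eq_abs]
    have := abs_trigBasis_le j t
    nlinarith [mul_le_mul_of_nonneg_left this (mul_nonneg (abs_nonneg (θ j)) (abs_nonneg (h t)))]

theorem fourierCoefficient_fourierSeries {θ : ℕ+ → ℝ} (hθ : Summable fun j => |θ j|) (i : ℕ+) :
    fourierCoefficient (fourierSeries θ) i = θ i := by
  have h := hasSum_integral_mul_fourierSeries hθ
    (integrable_unitVolume (continuous_trigBasis i))
  simp only [integral_trigBasis_mul, mul_ite, mul_one, mul_zero] at h
  have h' := hasSum_ite_eq i (θ i)
  rw [fourierCoefficient]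
  simp_rw [mul_comm (fourierSeries θ _)]
  refine h.unique ?_
  convert h' using 2 with j
  by_cases hj : i = j
  · simp [hj]
  · simp [hj, Ne.symm hj]

theorem hasSum_sq_fourierSeries {θ : ℕ+ → ℝ} (hθ : Summable fun j => |θ j|) :
    HasSum (fun j => θ j ^ 2) (∫ t, fourierSeries θ t ^ 2 ∂unitVolume) := by
  have h := hasSum_integral_mul_fourierSeries hθ
    (integrable_unitVolume (continuous_fourierSeries hθ))
  simp_rw [← pow_two] at h
  convert h using 2 with j
  rw [pow_two]; congr 1
  exact (fourierCoefficient_fourierSeries hθ j).symm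

theorem fourierSeries_sub {θ η : ℕ+ → ℝ} (hθ : Summable fun j => |θ j|)
    (hη : Summable fun j => |η j|) (t : ℝ) :
    fourierSeries (fun j => θ j - η j) t = fourierSeries θ t - fourierSeries η t := by
  rw [fourierSeries, fourierSeries, fourierSeries,
    ← (summable_fourierSeries hθ t).tsum_sub (summable_fourierSeries hη t)]
  congr 1; ext j; ring

theorem summable_abs_sub {θ η : ℕ+ → ℝ} (hθ : Summable fun j => |θ j|)
    (hη : Summable fun j => |η j|) : Summable fun j => |θ j - η j| :=
  Summable.of_nonneg_of_le (fun _ => abs_nonneg _) (fun _ => abs_sub _ _) (hθ.add hη)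

/-! ### Completeness of the trigonometric basis -/

/-- Completeness is inherited from Parseval for complex exponentials: vanishing cosine and sine
coefficients make every complex coefficient vanish, hence the `L²` norm as well. -/
theorem ae_eq_zero_of_fourierCoefficient_eq_zero {f : ℝ → ℝ} (hf : MemLp f 2 unitVolume)
    (h0 : ∀ j, fourierCoefficient f j = 0) : f =ᵐ[unitVolume] 0 := by
  have hr : unitVolume = volume.restrict (Set.Ioc (0 : ℝ) 1) :=
    (Measure.restrict_congr_set Ioc_ae_eq_Icc).symm
  have hfc : MemLp (fun t => (f t : ℂ)) 2 (volume.restrict (Set.Ioc (0 : ℝ) 1)) := by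
    rw [← hr]; exact hf.ofReal
  have hfi : Integrable f unitVolume := hf.integrable (by norm_num)
  have hs := hasSum_sq_fourierCoeffOn zero_lt_one hfc
  have hsq : (0 : ℝ) < √2 := by positivity
  have hcos (m : ℕ) : ∫ t, f t * Real.cos (2 * Real.pi * m * t) ∂unitVolume = 0 := by
    rcases Nat.eq_zero_or_pos m with rfl | hm
    · simpa [fourierCoefficient, trigBasis_one] using h0 1
    · obtain ⟨j, hj⟩ : ∃ j : ℕ+, (j : ℕ) = 2 * m := ⟨⟨2 * m, by omega⟩, rfl⟩
      have := h0 j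
      unfold fourierCoefficient at this
      rw [trigBasis_even (by rw [hj]; simp)] at this
      simp only [hj, Nat.mul_div_cancel_left _ zero_lt_two] at this
      simp_rw [mul_left_comm _ √2] at this
      rw [integral_const_mul] at this
      simpa [hsq.ne'] using this
  have hsin (m : ℕ) : ∫ t, f t * Real.sin (2 * Real.pi * m * t) ∂unitVolume = 0 := by
    rcases Nat.eq_zero_or_pos m with rfl | hm
    · simp
    · obtain ⟨j, hj⟩ : ∃ j : ℕ+, (j : ℕ) = 2 * m + 1 := ⟨⟨2 * m + 1, by omega⟩, rfl⟩
      have := h0 j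
      unfold fourierCoefficient at this
      rw [trigBasis_odd (by rintro rfl; simp at hj; omega) (by rw [hj]; simp)] at this
      have e : (2 * m + 1) / 2 = m := by omega
      simp only [hj, e] at this
      simp_rw [mul_left_comm _ √2] at this
      rw [integral_const_mul] at this
      simpa [hsq.ne'] using this
  have hcosZ (a : ℤ) : ∫ t, f t * Real.cos (2 * Real.pi * a * t) ∂unitVolume = 0 := by
    obtain ⟨m, rfl | rfl⟩ := a.eq_nat_or_neg
    · exact_mod_cast hcos m
    · simpa using hcos m
  have hsinZ (a : ℤ) : ∫ t, f t * Real.sin (2 * Real.pi * a * t) ∂unitVolume = 0 := by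
    obtain ⟨m, rfl | rfl⟩ := a.eq_nat_or_neg
    · exact_mod_cast hsin m
    · simpa [integral_neg] using hsin m
  have hz (a : ℤ) : fourierCoeffOn zero_lt_one (fun t => (f t : ℂ)) a = 0 := by
    rw [fourierCoeffOn_eq_integral, intervalIntegral.integral_of_le zero_le_one, ← hr]
    have hpt : (fun t : ℝ => fourier (-a) (t : AddCircle ((1 : ℝ) - 0)) • (f t : ℂ)) = fun t =>
        ((f t * Real.cos (2 * Real.pi * a * t) : ℝ) : ℂ) -
          ((f t * Real.sin (2 * Real.pi * a * t) : ℝ) : ℂ) * Complex.I := by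
      ext t
      rw [fourier_coe_apply, smul_eq_mul]
      have : 2 * (Real.pi : ℂ) * Complex.I * ((-a : ℤ) : ℂ) * (t : ℂ) / (((1 : ℝ) - 0 : ℝ) : ℂ)
          = ((-(2 * Real.pi * a * t) : ℝ) : ℂ) * Complex.I := by
        push_cast; simp only [sub_zero, div_one]; ring
      rw [this, Complex.exp_mul_I, ← Complex.ofReal_cos, ← Complex.ofReal_sin, Real.cos_neg,
        Real.sin_neg]
      push_cast; ring
    have hi1 : Integrable (fun t => f t * Real.cos (2 * Real.pi * a * t)) unitVolume :=
      hfi.mul_bdd (c := 1) (Continuous.aestronglyMeasurable (by fun_prop))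
        (Eventually.of_forall fun t => Real.abs_cos_le_one _)
    have hi2 : Integrable (fun t => f t * Real.sin (2 * Real.pi * a * t)) unitVolume :=
      hfi.mul_bdd (c := 1) (Continuous.aestronglyMeasurable (by fun_prop))
        (Eventually.of_forall fun t => Real.abs_sin_le_one _)
    rw [hpt, integral_sub hi1.ofReal (hi2.ofReal.mul_const _), integral_mul_const,
      integral_complex_ofReal, integral_complex_ofReal, hcosZ, hsinZ]
    simp
  simp_rw [hz] at hs
  have h1 : ∫ t in (0 : ℝ)..1, ‖(f t : ℂ)‖ ^ 2 = 0 := by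
    have := hs.unique (a₂ := 0) (by simp)
    simpa using this
  have h2 : ∫ t, f t ^ 2 ∂unitVolume = 0 := by
    rw [integral_unitVolume]; simpa using h1
  rw [integral_eq_zero_iff_of_nonneg (fun _ => sq_nonneg _) hf.integrable_sq] at h2
  filter_upwards [h2] with t ht
  simpa using ht

/-- A square integrable function with absolutely summable coefficients is its Fourier series. -/
theorem ae_eq_fourierSeries {f : ℝ → ℝ} (hf : MemLp f 2 unitVolume)
    (hs : Summable fun j => |fourierCoefficient f j|) :
    f =ᵐ[unitVolume] fourierSeries (fourierCoefficient f) := by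
  have hc := continuous_fourierSeries hs
  have hm : MemLp (fourierSeries (fourierCoefficient f)) 2 unitVolume :=
    MemLp.of_bound hc.aestronglyMeasurable _
      (Eventually.of_forall fun t => abs_fourierSeries_le hs t)
  -- The difference of the function and its series is square integrable and has no nonzero
  -- coefficient.
  have := ae_eq_zero_of_fourierCoefficient_eq_zero (hf.sub hm) fun j => ?_
  · filter_upwards [this] with t ht
    simpa [sub_eq_zero] using ht
  · have hi {h : ℝ → ℝ} (hh : MemLp h 2 unitVolume) :
        Integrable (fun t => h t * trigBasis j t) unitVolume :=
      (hh.integrable (by norm_num)).mul_bdd (c := √2) (continuous_trigBasis j).aestronglyMeasurable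
        (Eventually.of_forall fun t => abs_trigBasis_le j t)
    have e : fourierCoefficient (f - fourierSeries (fourierCoefficient f)) j =
        fourierCoefficient f j - fourierCoefficient (fourierSeries (fourierCoefficient f)) j := by
      rw [fourierCoefficient, fourierCoefficient, fourierCoefficient,
        ← integral_sub (hi hf) (hi hm)]
      simp only [Pi.sub_apply, sub_mul]
    rw [e, fourierCoefficient_fourierSeries hs j, sub_self]

/-! ### Sobolev sequences -/

theorem summable_rpow_pnat {s : ℝ} (hs : 1 < s) :
    Summable fun j : ℕ+ => ((j : ℕ) : ℝ) ^ (-s) :=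
  (Real.summable_nat_rpow.2 (by linarith)).comp_injective PNat.coe_injective

theorem gammaConst_pos {αs : ℝ} (h : 1 / 2 < αs) : 0 < gammaConst αs := by
  unfold gammaConst
  refine Real.sqrt_pos.2 ?_
  have hs : Summable fun j : ℕ+ => ((j : ℕ) : ℝ) ^ (-2 * αs) := by
    simpa [neg_mul] using summable_rpow_pnat (s := 2 * αs) (by linarith)
  exact hs.tsum_pos (fun j => by positivity) 1 (by simp)

/-- Coefficient sequences with `∑ⱼ j^{2α} θⱼ² ≤ Q²`. -/
structure IsSobolevSeq (α Q : ℝ) (θ : ℕ+ → ℝ) : Prop where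
  summable : Summable fun j : ℕ+ => ((j : ℕ) : ℝ) ^ (2 * α) * θ j ^ 2
  tsum_le : ∑' j : ℕ+, ((j : ℕ) : ℝ) ^ (2 * α) * θ j ^ 2 ≤ Q ^ 2

/-- Cauchy–Schwarz for `j^{-αs}` against `j^{αs} |θ j|`. Since `j ≥ 1`, the weights `j^{2αs}` are
dominated by `j^{2α}`, so the constant depends on `αs` and not on `α`. -/
theorem IsSobolevSeq.summable_abs_and_le {α Q αs : ℝ} {θ : ℕ+ → ℝ} (h : IsSobolevSeq α Q θ)
    (hαs : 1 / 2 < αs) (hα : αs ≤ α) (hQ : 0 ≤ Q) :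
    (Summable fun j => |θ j|) ∧ ∑' j, |θ j| ≤ gammaConst αs * Q := by
  have hs : Summable fun j : ℕ+ => (((j : ℕ) : ℝ) ^ (-αs)) ^ (2 : ℝ) := by
    convert summable_rpow_pnat (s := 2 * αs) (by linarith) using 2 with j
    rw [← Real.rpow_mul (by positivity)]; congr 1; ring
  have hle (j : ℕ+) : (((j : ℕ) : ℝ) ^ αs * |θ j|) ^ (2 : ℝ) ≤
      ((j : ℕ) : ℝ) ^ (2 * α) * θ j ^ 2 := by
    have h1 : (1 : ℝ) ≤ (j : ℕ) := by exact_mod_cast j.pos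
    rw [Real.rpow_two, mul_pow, sq_abs, ← Real.rpow_natCast, ← Real.rpow_mul (by positivity)]
    refine mul_le_mul_of_nonneg_right (Real.rpow_le_rpow_of_exponent_le h1 ?_) (sq_nonneg _)
    push_cast; linarith
  have hs2 : Summable fun j : ℕ+ => (((j : ℕ) : ℝ) ^ αs * |θ j|) ^ (2 : ℝ) :=
    h.summable.of_nonneg_of_le (fun j => by positivity) hle
  have e (j : ℕ+) : ((j : ℕ) : ℝ) ^ (-αs) * (((j : ℕ) : ℝ) ^ αs * |θ j|) = |θ j| := by
    have h1 : (0 : ℝ) < (j : ℕ) := by exact_mod_cast j.pos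
    rw [← mul_assoc, ← Real.rpow_add h1]; simp
  have key := Real.summable_and_inner_le_Lp_mul_Lq_tsum_of_nonneg Real.HolderConjugate.two_two
    (fun j : ℕ+ => (by positivity : 0 ≤ ((j : ℕ) : ℝ) ^ (-αs)))
    (fun j : ℕ+ => (by positivity : 0 ≤ ((j : ℕ) : ℝ) ^ αs * |θ j|)) hs hs2
  simp_rw [e] at key
  refine ⟨key.1, key.2.trans ?_⟩
  rw [← Real.sqrt_eq_rpow, ← Real.sqrt_eq_rpow]
  refine mul_le_mul ?_ ?_ (Real.sqrt_nonneg _) (Real.sqrt_nonneg _)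
  · refine Real.sqrt_le_sqrt (le_of_eq ?_)
    congr 1; ext j
    rw [← Real.rpow_mul (by positivity)]; congr 1; ring
  · rw [Real.sqrt_le_left hQ]
    exact (hs2.tsum_le_tsum hle h.summable).trans h.tsum_le

theorem isSobolevSeq_fourierCoefficient {α Q : ℝ} {f : ℝ → ℝ} (hf : f ∈ sobolevBall α Q) :
    IsSobolevSeq α Q (fourierCoefficient f) := by
  have h := hf.2
  have hnn (j : ℕ+) : 0 ≤ ((j : ℕ) : ℝ) ^ (2 * α) * fourierCoefficient f j ^ 2 := by positivity
  have hs : Summable fun j : ℕ+ => ((j : ℕ) : ℝ) ^ (2 * α) * fourierCoefficient f j ^ 2 := by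
    have := ENNReal.summable_toReal (ne_top_of_le_ne_top ENNReal.ofReal_ne_top h)
    simpa only [ENNReal.toReal_ofReal (hnn _)] using this
  refine ⟨hs, ?_⟩
  rw [← ENNReal.ofReal_tsum_of_nonneg hnn hs] at h
  exact (ENNReal.ofReal_le_ofReal_iff (sq_nonneg _)).1 h

theorem IsSobolevSeq.update {α Q : ℝ} {θ : ℕ+ → ℝ} (h : IsSobolevSeq α Q θ) :
    IsSobolevSeq α Q (Function.update θ 1 0) := by
  have hle (j : ℕ+) : ((j : ℕ) : ℝ) ^ (2 * α) * Function.update θ 1 0 j ^ 2 ≤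
      ((j : ℕ) : ℝ) ^ (2 * α) * θ j ^ 2 := by
    by_cases hj : j = 1
    · subst hj; simp; positivity
    · simp [hj]
  have hs := h.summable.of_nonneg_of_le (fun j => by positivity) hle
  exact ⟨hs, (hs.tsum_le_tsum hle h.summable).trans h.tsum_le⟩

end BlockPrior

namespace BlockPrior

/-! ### Exponential densities with bounded exponents -/

/-- Both sides come from `1 + x ≤ e^x`, after factoring out the smaller or the larger exponential.
This is the source of every comparison between densities, their square roots and their logarithms.
-/
theorem exp_sub_exp_sq_bounds {S a b : ℝ} (ha : |a| ≤ S) (hb : |b| ≤ S) :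
    Real.exp (-S) ^ 2 * (a - b) ^ 2 ≤ (Real.exp a - Real.exp b) ^ 2 ∧
      (Real.exp a - Real.exp b) ^ 2 ≤ Real.exp S ^ 2 * (a - b) ^ 2 := by
  wlog hab : b ≤ a generalizing a b
  · have := this hb ha (le_of_not_ge hab)
    rw [← neg_sub a b, ← neg_sub (Real.exp a), neg_sq, neg_sq] at this
    exact this
  have h1 : Real.exp (-S) * (a - b) ≤ Real.exp a - Real.exp b := by
    have e : Real.exp a - Real.exp b = Real.exp b * (Real.exp (a - b) - 1) := by
      rw [mul_sub, ← Real.exp_add]; ring_nf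
    rw [e]
    refine mul_le_mul (Real.exp_le_exp.2 (abs_le.1 hb).1) ?_ (by linarith) (Real.exp_pos _).le
    linarith [Real.add_one_le_exp (a - b)]
  have h2 : Real.exp a - Real.exp b ≤ Real.exp S * (a - b) := by
    have e : Real.exp a - Real.exp b = Real.exp a * (1 - Real.exp (b - a)) := by
      rw [mul_sub, ← Real.exp_add]; ring_nf
    rw [e]
    have h3 : Real.exp b ≤ Real.exp a := Real.exp_le_exp.2 hab
    refine (mul_le_mul_of_nonneg_left (?_ : _ ≤ a - b) (Real.exp_pos _).le).trans
      (mul_le_mul_of_nonneg_right (Real.exp_le_exp.2 (abs_le.1 ha).2) (by linarith))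
    linarith [Real.add_one_le_exp (b - a)]
  have h0 : 0 ≤ Real.exp (-S) * (a - b) := mul_nonneg (Real.exp_pos _).le (by linarith)
  rw [← mul_pow, ← mul_pow]
  exact ⟨pow_le_pow_left₀ h0 h1 2, pow_le_pow_left₀ (h0.trans h1) h2 2⟩

/-- Measurable functions bounded by `R`. -/
structure IsBddBy (R : ℝ) (f : ℝ → ℝ) : Prop where
  measurable : Measurable f
  abs_apply_le : ∀ t, |f t| ≤ R

theorem IsBddBy.integrable {R : ℝ} {f : ℝ → ℝ} (hf : IsBddBy R f) : Integrable f unitVolume :=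
  Integrable.of_bound hf.measurable.aestronglyMeasurable R (Eventually.of_forall hf.abs_apply_le)

theorem IsBddBy.sub {R S : ℝ} {f g : ℝ → ℝ} (hf : IsBddBy R f) (hg : IsBddBy S g) :
    IsBddBy (R + S) fun t => f t - g t :=
  ⟨hf.measurable.sub hg.measurable,
    fun t => (abs_sub _ _).trans (add_le_add (hf.abs_apply_le t) (hg.abs_apply_le t))⟩

theorem IsBddBy.sq {R : ℝ} {f : ℝ → ℝ} (hf : IsBddBy R f) : IsBddBy (R ^ 2) fun t => f t ^ 2 :=
  ⟨hf.measurable.pow_const 2, fun t => by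
    rw [abs_pow]; exact pow_le_pow_left₀ (abs_nonneg _) (hf.abs_apply_le t) 2⟩

theorem IsBddBy.exp {R : ℝ} {f : ℝ → ℝ} (hf : IsBddBy R f) :
    IsBddBy (Real.exp R) fun t => Real.exp (f t) :=
  ⟨hf.measurable.exp, fun t => by
    rw [abs_of_pos (Real.exp_pos _)]; exact Real.exp_le_exp.2 (abs_le.1 (hf.abs_apply_le t)).2⟩

/-- The normalising integral `∫₀¹ e^f`. -/
noncomputable def partition (f : ℝ → ℝ) : ℝ := ∫ s, Real.exp (f s) ∂unitVolume

/-- The logarithm of the density `p_f`. -/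
noncomputable def logDensity (f : ℝ → ℝ) (t : ℝ) : ℝ := f t - Real.log (partition f)

/-! ### Comparison of partition functions, log densities, `L²` and Hellinger distances. -/

section Bounds

variable {R : ℝ} {f g : ℝ → ℝ}

theorem IsBddBy.exp_neg_le_partition (hf : IsBddBy R f) : Real.exp (-R) ≤ partition f := by
  have := integral_mono (μ := unitVolume) (integrable_const (Real.exp (-R))) hf.exp.integrable
    fun t => Real.exp_le_exp.2 (abs_le.1 (hf.abs_apply_le t)).1
  simpa [partition] using this

theorem IsBddBy.partition_le (hf : IsBddBy R f) : partition f ≤ Real.exp R := by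
  have := integral_mono (μ := unitVolume) hf.exp.integrable (integrable_const (Real.exp R))
    fun t => Real.exp_le_exp.2 (abs_le.1 (hf.abs_apply_le t)).2
  simpa [partition] using this

theorem IsBddBy.partition_pos (hf : IsBddBy R f) : 0 < partition f :=
  (Real.exp_pos _).trans_le hf.exp_neg_le_partition

theorem IsBddBy.expDensity_eq (hf : IsBddBy R f) (t : ℝ) :
    expDensity f t = Real.exp (logDensity f t) := by
  rw [logDensity, Real.exp_sub, Real.exp_log hf.partition_pos]; rfl

theorem IsBddBy.logDensity (hf : IsBddBy R f) : IsBddBy (2 * R) (logDensity f) := by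
  refine ⟨hf.measurable.sub_const _, fun t => ?_⟩
  have h1 : Real.log (partition f) ≤ R := (Real.log_le_iff_le_exp hf.partition_pos).2 hf.partition_le
  have h2 : -R ≤ Real.log (partition f) :=
    (Real.le_log_iff_exp_le hf.partition_pos).2 hf.exp_neg_le_partition
  have h3 := abs_le.1 (hf.abs_apply_le t)
  rw [BlockPrior.logDensity, abs_le]
  constructor <;> linarith [h3.1, h3.2]

theorem IsBddBy.expDensity_pos (hf : IsBddBy R f) (t : ℝ) : 0 < expDensity f t := by
  rw [hf.expDensity_eq]; exact Real.exp_pos _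

theorem IsBddBy.integral_expDensity (hf : IsBddBy R f) :
    ∫ t, expDensity f t ∂unitVolume = 1 := by
  simp only [expDensity]
  rw [integral_div]
  exact div_self hf.partition_pos.ne'

theorem IsBddBy.expDensity (hf : IsBddBy R f) : IsBddBy (Real.exp (2 * R)) (expDensity f) := by
  have : BlockPrior.expDensity f = fun t => Real.exp (BlockPrior.logDensity f t) := by
    ext t; exact hf.expDensity_eq t
  rw [this]; exact hf.logDensity.exp

theorem IsBddBy.sqrt_expDensity (hf : IsBddBy R f) (t : ℝ) :
    √(BlockPrior.expDensity f t) = Real.exp (BlockPrior.logDensity f t / 2) := by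
  rw [hf.expDensity_eq, Real.exp_half]

theorem sq_integral_le {h : ℝ → ℝ} (hh : IsBddBy R h) :
    (∫ t, h t ∂unitVolume) ^ 2 ≤ ∫ t, h t ^ 2 ∂unitVolume := by
  set m := ∫ t, h t ∂unitVolume with hm
  have h0 : 0 ≤ ∫ t, (h t ^ 2 - (2 * m) * h t + m ^ 2) ∂unitVolume :=
    integral_nonneg fun t => by
      have : h t ^ 2 - (2 * m) * h t + m ^ 2 = (h t - m) ^ 2 := by ring
      simp only [this]; exact sq_nonneg _
  have i1 : Integrable (fun t => h t ^ 2 - 2 * m * h t) unitVolume :=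
    hh.sq.integrable.sub (hh.integrable.const_mul _)
  rw [integral_add i1 (integrable_const _), integral_sub hh.sq.integrable (hh.integrable.const_mul _), integral_const_mul, ← hm] at h0
  simp at h0
  nlinarith

/-- The squared `L²` distance on `[0,1]`. -/
noncomputable def sqDist (f g : ℝ → ℝ) : ℝ := ∫ t, (f t - g t) ^ 2 ∂unitVolume

theorem sqDist_nonneg (f g : ℝ → ℝ) : 0 ≤ sqDist f g := integral_nonneg fun _ => sq_nonneg _

theorem sqDist_comm (f g : ℝ → ℝ) : sqDist f g = sqDist g f := by
  unfold sqDist; congr 1; ext t; ring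

theorem sub_log_partition_le (hf : IsBddBy R f) (hg : IsBddBy R g) :
    Real.log (partition f) - Real.log (partition g) ≤
      Real.exp R * Real.exp R * ∫ t, |f t - g t| ∂unitVolume := by
  have hZ : partition f - partition g ≤ Real.exp R * ∫ t, |f t - g t| ∂unitVolume := by
    rw [partition, partition, ← integral_sub hf.exp.integrable hg.exp.integrable,
      ← integral_const_mul]
    refine integral_mono (hf.exp.sub hg.exp).integrable
      (((hf.sub hg).integrable.abs).const_mul _) fun t => ?_
    have := (exp_sub_exp_sq_bounds (hf.abs_apply_le t) (hg.abs_apply_le t)).2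
    rw [← mul_pow] at this
    have := abs_le_of_sq_le_sq' (by rwa [← sq_abs (Real.exp R * (f t - g t)), abs_mul,
      abs_of_pos (Real.exp_pos _)] at this) (by positivity)
    exact this.2
  have hf0 := hf.partition_pos
  have hg0 := hg.partition_pos
  rw [← Real.log_div hf0.ne' hg0.ne']
  have h1 := Real.log_le_sub_one_of_pos (div_pos hf0 hg0)
  have h2 : partition f / partition g - 1 = (partition f - partition g) / partition g := by
    field_simp
  have h3 : (partition f - partition g) / partition g ≤
      (Real.exp R * ∫ t, |f t - g t| ∂unitVolume) / partition g := by gcongr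
  have h4 : (Real.exp R * ∫ t, |f t - g t| ∂unitVolume) / partition g ≤
      (Real.exp R * ∫ t, |f t - g t| ∂unitVolume) / Real.exp (-R) := by
    refine div_le_div_of_nonneg_left ?_ (Real.exp_pos _) hg.exp_neg_le_partition
    exact mul_nonneg (Real.exp_pos _).le (integral_nonneg fun _ => abs_nonneg _)
  rw [Real.exp_neg, div_inv_eq_mul] at h4
  linarith

/-- The log densities differ from the exponents by the logarithms of the partition functions, and
the difference `d` of these is controlled by the `L¹` distance, hence by the `L²` distance. -/
theorem sqDist_logDensity_le (hf : IsBddBy R f) (hg : IsBddBy R g) :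
    sqDist (logDensity f) (logDensity g) ≤ (2 + 2 * Real.exp R ^ 4) * sqDist f g := by
  set d := Real.log (partition f) - Real.log (partition g) with hd
  have hI := sq_integral_le (h := fun t => |f t - g t|) (R := R + R)
    ⟨(hf.sub hg).measurable.abs, fun t => by simpa using (hf.sub hg).abs_apply_le t⟩
  have habs : |d| ≤ Real.exp R * Real.exp R * ∫ t, |f t - g t| ∂unitVolume := by
    rw [abs_le']
    refine ⟨sub_log_partition_le hf hg, ?_⟩
    rw [hd, neg_sub]
    simp_rw [abs_sub_comm (f _)]
    exact sub_log_partition_le hg hf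
  have hd2 : d ^ 2 ≤ Real.exp R ^ 4 * sqDist f g := by
    rw [← sq_abs]
    refine (pow_le_pow_left₀ (abs_nonneg _) habs 2).trans ?_
    rw [mul_pow]
    simp only [sq_abs] at hI
    have : (Real.exp R * Real.exp R) ^ 2 = Real.exp R ^ 4 := by ring
    rw [this]
    exact mul_le_mul_of_nonneg_left hI (by positivity)
  have hle : sqDist (logDensity f) (logDensity g) ≤
      ∫ t, (2 * (f t - g t) ^ 2 + 2 * d ^ 2) ∂unitVolume := by
    refine integral_mono (hf.logDensity.sub hg.logDensity).sq.integrable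
      (((hf.sub hg).sq.integrable.const_mul _).add (integrable_const _)) fun t => ?_
    have e : logDensity f t - logDensity g t = (f t - g t) - d := by
      rw [logDensity, logDensity]; ring
    simp only [e]
    nlinarith [sq_nonneg ((f t - g t) + d)]
  rw [integral_add ((hf.sub hg).sq.integrable.const_mul _) (integrable_const _),
    integral_const_mul] at hle
  simp only [integral_const, probReal_univ, smul_eq_mul, one_mul] at hle
  change _ ≤ 2 * sqDist f g + _ at hle
  linarith

/-- When `f - g` has mean zero it is orthogonal to the constant `d`, so passing to log densities
adds exactly `d²`. This is where centring is needed: without it, two exponents that differ by a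
constant would have the same density. -/
theorem sqDist_le_sqDist_logDensity (hf : IsBddBy R f) (hg : IsBddBy R g)
    (h0 : ∫ t, (f t - g t) ∂unitVolume = 0) :
    sqDist f g ≤ sqDist (logDensity f) (logDensity g) := by
  set d := Real.log (partition f) - Real.log (partition g) with hd
  have e : sqDist (logDensity f) (logDensity g) =
      ∫ t, ((f t - g t) ^ 2 - 2 * d * (f t - g t) + d ^ 2) ∂unitVolume := by
    unfold sqDist; congr 1; ext t
    rw [logDensity, logDensity, hd]; ring
  have i1 : Integrable (fun t => (f t - g t) ^ 2 - 2 * d * (f t - g t)) unitVolume :=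
    (hf.sub hg).sq.integrable.sub ((hf.sub hg).integrable.const_mul _)
  rw [e, integral_add i1 (integrable_const _), integral_sub (hf.sub hg).sq.integrable
    ((hf.sub hg).integrable.const_mul _), integral_const_mul, h0]
  simp only [integral_const, probReal_univ, smul_eq_mul, one_mul, mul_zero, sub_zero]
  have := sq_nonneg d
  simp only [sqDist]; linarith

theorem IsBddBy.half {S : ℝ} (hf : IsBddBy S f) : IsBddBy S fun t => f t / 2 :=
  ⟨hf.measurable.div_const 2, fun t => by
    rw [abs_div, abs_two]; linarith [hf.abs_apply_le t, abs_nonneg (f t)]⟩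

theorem IsBddBy.sqrtDensity (hf : IsBddBy R f) :
    IsBddBy (Real.exp (2 * R)) fun t => √(BlockPrior.expDensity f t) := by
  simp_rw [hf.sqrt_expDensity]; exact hf.logDensity.half.exp

theorem hellinger_sq (f g : ℝ → ℝ) : hellinger f g ^ 2 =
    ∫ t, (√(expDensity f t) - √(expDensity g t)) ^ 2 ∂unitVolume :=
  Real.sq_sqrt (integral_nonneg fun _ => sq_nonneg _)

theorem hellinger_sq_bounds (hf : IsBddBy R f) (hg : IsBddBy R g) :
    Real.exp (-(2 * R)) ^ 2 / 4 * sqDist (logDensity f) (logDensity g) ≤ hellinger f g ^ 2 ∧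
      hellinger f g ^ 2 ≤ Real.exp (2 * R) ^ 2 / 4 * sqDist (logDensity f) (logDensity g) := by
  have key (t : ℝ) := exp_sub_exp_sq_bounds (hf.logDensity.half.abs_apply_le t)
    (hg.logDensity.half.abs_apply_le t)
  have hU := (hf.logDensity.sub hg.logDensity).sq.integrable
  have hH := (hf.sqrtDensity.sub hg.sqrtDensity).sq.integrable
  rw [hellinger_sq, sqDist, ← integral_const_mul, ← integral_const_mul]
  constructor
  · refine integral_mono (hU.const_mul _) hH fun t => ?_
    have := (key t).1
    simp only [hf.sqrt_expDensity, hg.sqrt_expDensity]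
    refine le_trans (le_of_eq ?_) this
    ring
  · refine integral_mono hH (hU.const_mul _) fun t => ?_
    have := (key t).2
    simp only [hf.sqrt_expDensity, hg.sqrt_expDensity]
    refine le_trans this (le_of_eq ?_)
    ring

/-- Expand the square in the Hellinger distance and use that both densities integrate to one. -/
theorem integral_sqrt_mul_sqrt (hf : IsBddBy R f) (hg : IsBddBy R g) :
    ∫ t, √(expDensity f t) * √(expDensity g t) ∂unitVolume = 1 - hellinger f g ^ 2 / 2 := by
  have hH := (hf.sqrtDensity.sub hg.sqrtDensity).sq.integrable
  have e : (fun t => √(expDensity f t) * √(expDensity g t)) = fun t =>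
      (expDensity f t + expDensity g t) / 2 - (√(expDensity f t) - √(expDensity g t)) ^ 2 / 2 := by
    ext t
    have h1 := Real.sq_sqrt (hf.expDensity_pos t).le
    have h2 := Real.sq_sqrt (hg.expDensity_pos t).le
    linear_combination h1 / 2 + h2 / 2
  have i1 : Integrable (fun t => (expDensity f t + expDensity g t) / 2) unitVolume :=
    (hf.expDensity.integrable.add hg.expDensity.integrable).div_const 2
  rw [e, integral_sub i1
    (hH.div_const 2), integral_div, integral_div, integral_add hf.expDensity.integrable
    hg.expDensity.integrable, hf.integral_expDensity, hg.integral_expDensity, hellinger_sq]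
  norm_num

theorem sqDist_expDensity_le (hf : IsBddBy R f) (hg : IsBddBy R g) :
    sqDist (expDensity f) (expDensity g) ≤
      Real.exp (2 * R) ^ 2 * sqDist (logDensity f) (logDensity g) := by
  rw [sqDist, sqDist, ← integral_const_mul]
  refine integral_mono (hf.expDensity.sub hg.expDensity).sq.integrable
    ((hf.logDensity.sub hg.logDensity).sq.integrable.const_mul _) fun t => ?_
  simp only [hf.expDensity_eq, hg.expDensity_eq]
  exact (exp_sub_exp_sq_bounds (hf.logDensity.abs_apply_le t) (hg.logDensity.abs_apply_le t)).2

theorem inv_expDensity_le (hf : IsBddBy R f) (t : ℝ) :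
    (expDensity f t)⁻¹ ≤ Real.exp (2 * R) := by
  rw [hf.expDensity_eq, ← Real.exp_neg]
  exact Real.exp_le_exp.2 (by linarith [(abs_le.1 (hf.logDensity.abs_apply_le t)).1])

theorem inv_expDensity_isBddBy (hf : IsBddBy R f) :
    IsBddBy (Real.exp (2 * R)) fun t => (expDensity f t)⁻¹ :=
  ⟨hf.expDensity.measurable.inv, fun t => by
    rw [abs_of_pos (inv_pos.2 (hf.expDensity_pos t))]; exact inv_expDensity_le hf t⟩

theorem IsBddBy.mul {S : ℝ} (hf : IsBddBy R f) (hg : IsBddBy S g) :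
    IsBddBy (R * S) fun t => f t * g t :=
  ⟨hf.measurable.mul hg.measurable, fun t => by
    rw [abs_mul]
    exact mul_le_mul (hf.abs_apply_le t) (hg.abs_apply_le t) (abs_nonneg _)
      ((abs_nonneg _).trans (hf.abs_apply_le t))⟩

end Bounds

/-- The `χ²`-type bound `∫ p_f² / p_g ≤ 1 + C ‖f - g‖²`. -/
theorem exists_integral_sq_div_le (R : ℝ) : ∃ C > 0, ∀ f g, IsBddBy R f → IsBddBy R g →
    ∫ t, expDensity f t ^ 2 / expDensity g t ∂unitVolume ≤ 1 + C * sqDist f g := by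
  refine ⟨Real.exp (2 * R) * (Real.exp (2 * R) ^ 2 * (2 + 2 * Real.exp R ^ 4)), by positivity,
    fun f g hf hg => ?_⟩
  have hle : ∫ t, expDensity f t ^ 2 / expDensity g t ∂unitVolume ≤
      ∫ t, (2 * expDensity f t - expDensity g t +
        Real.exp (2 * R) * (expDensity f t - expDensity g t) ^ 2) ∂unitVolume := by
    refine integral_mono ?_ (((hf.expDensity.integrable.const_mul 2).sub
      hg.expDensity.integrable).add ((hf.expDensity.sub hg.expDensity).sq.integrable.const_mul _))
      fun t => ?_
    · simp_rw [div_eq_mul_inv]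
      exact (hf.expDensity.sq.mul (inv_expDensity_isBddBy hg)).integrable
    · have hp := hg.expDensity_pos t
      -- Second-order expansion around `p_g`: the linear part integrates to one, so only the
      -- quadratic remainder contributes an error.
      have e : expDensity f t ^ 2 / expDensity g t = 2 * expDensity f t - expDensity g t +
          (expDensity g t)⁻¹ * (expDensity f t - expDensity g t) ^ 2 := by
        field_simp; ring
      rw [e]
      have := mul_le_mul_of_nonneg_right (inv_expDensity_le hg t)
        (sq_nonneg (expDensity f t - expDensity g t))
      simp only
      linarith
  have i1 : Integrable (fun t => 2 * expDensity f t - expDensity g t) unitVolume :=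
    (hf.expDensity.integrable.const_mul 2).sub hg.expDensity.integrable
  rw [integral_add i1 ((hf.expDensity.sub hg.expDensity).sq.integrable.const_mul _),
    integral_sub (hf.expDensity.integrable.const_mul 2) hg.expDensity.integrable,
    integral_const_mul, integral_const_mul, hf.integral_expDensity, hg.integral_expDensity] at hle
  have h1 := sqDist_expDensity_le hf hg
  have h2 := sqDist_logDensity_le hf hg
  have h3 := mul_le_mul_of_nonneg_left
    (h1.trans (mul_le_mul_of_nonneg_left h2 (by positivity))) (Real.exp_pos (2 * R)).le
  simp only [sqDist] at h3 ⊢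
  linarith

theorem exists_hellinger_sq_le (R : ℝ) : ∃ C > 0, ∀ f g, IsBddBy R f → IsBddBy R g →
    hellinger f g ^ 2 ≤ C * sqDist f g := by
  refine ⟨Real.exp (2 * R) ^ 2 / 4 * (2 + 2 * Real.exp R ^ 4), by positivity,
    fun f g hf hg => (hellinger_sq_bounds hf hg).2.trans ?_⟩
  rw [mul_assoc]
  exact mul_le_mul_of_nonneg_left (sqDist_logDensity_le hf hg) (by positivity)

/-- Bounds for the Hellinger affinity of `p₀` and `p₁` and its version under a nearby density. -/
theorem exists_affinity_bounds (R : ℝ) : ∃ c > 0, ∃ δ > 0, ∀ f₀ f₁, IsBddBy R f₀ → IsBddBy R f₁ →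
    ∫ t, (f₁ t - f₀ t) ∂unitVolume = 0 →
    ∫ t, √(expDensity f₀ t) * √(expDensity f₁ t) ∂unitVolume ≤ 1 - c * sqDist f₁ f₀ ∧
    ∀ f, IsBddBy R f → sqDist f f₁ ≤ δ * sqDist f₁ f₀ →
      ∫ t, expDensity f t * (√(expDensity f₀ t) / √(expDensity f₁ t)) ∂unitVolume ≤
        1 - c * sqDist f₁ f₀ := by
  set E := Real.exp (2 * R) with hE
  have hE0 : 0 < E := Real.exp_pos _
  set F := Real.exp (-(2 * R)) with hF
  have hF0 : 0 < F := Real.exp_pos _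
  set C := 2 + 2 * Real.exp R ^ 4 with hC
  have hC0 : 0 < C := by positivity
  -- With `H` the Hellinger distance of `f₁` and `f₀`, the affinity is `1 - H²/2`. The radius `δ`
  -- makes the density error `2E‖p_f - p_{f₁}‖²` at most `H²/8`; a further `H²/8` is lost in the
  -- cross term. What remains is `1 - H²/4`, and `H² ≥ (F²/4) sqDist f₁ f₀` gives the constant
  -- `F²/16`.
  refine ⟨F ^ 2 / 16, by positivity, F ^ 2 / 4 / (16 * E * E ^ 2 * C), by positivity,
    fun f₀ f₁ h₀ h₁ hm => ?_⟩
  have hH := (hellinger_sq_bounds h₁ h₀).1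
  have hD := sqDist_le_sqDist_logDensity h₁ h₀ hm
  have hH' : F ^ 2 / 4 * sqDist f₁ f₀ ≤ hellinger f₁ f₀ ^ 2 :=
    (mul_le_mul_of_nonneg_left hD (by positivity)).trans hH
  have hcomm : hellinger f₀ f₁ ^ 2 = hellinger f₁ f₀ ^ 2 := by
    rw [hellinger_sq, hellinger_sq]; congr 1; ext t; ring
  have haff := integral_sqrt_mul_sqrt h₀ h₁
  rw [hcomm] at haff
  have hD0 := sqDist_nonneg f₁ f₀
  refine ⟨by rw [haff]; nlinarith [mul_nonneg (sq_nonneg F) hD0], fun f hf hclose => ?_⟩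
  have hle : ∫ t, expDensity f t * (√(expDensity f₀ t) / √(expDensity f₁ t)) ∂unitVolume ≤
      ∫ t, (√(expDensity f₀ t) * √(expDensity f₁ t) + (expDensity f t - expDensity f₁ t) +
        (2 * E * (expDensity f t - expDensity f₁ t) ^ 2 +
          (√(expDensity f₁ t) - √(expDensity f₀ t)) ^ 2 / 8)) ∂unitVolume := by
    have i1 := (h₀.sqrtDensity.mul h₁.sqrtDensity).integrable
    have i2 := (hf.expDensity.sub h₁.expDensity).integrable
    have i3 := (hf.expDensity.sub h₁.expDensity).sq.integrable.const_mul (2 * E)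
    have i4 := (h₁.sqrtDensity.sub h₀.sqrtDensity).sq.integrable.div_const 8
    refine integral_mono ?_ ((i1.add i2).add (i3.add i4)) fun t => ?_
    · have e : (fun t => expDensity f t * (√(expDensity f₀ t) / √(expDensity f₁ t))) = fun t =>
          expDensity f t * (√(expDensity f₀ t) * (√(expDensity f₁ t) * (expDensity f₁ t)⁻¹)) := by
        ext t
        have hp := h₁.expDensity_pos t
        have hs := Real.sqrt_pos.2 hp
        have := Real.sq_sqrt hp.le
        rw [div_eq_mul_inv]; congr 2
        field_simp
        exact this.symm
      rw [e]
      exact (hf.expDensity.mul (h₀.sqrtDensity.mul (h₁.sqrtDensity.mul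
        (inv_expDensity_isBddBy h₁)))).integrable
    · have hp := h₁.expDensity_pos t
      have hs := Real.sqrt_pos.2 hp
      have hsq := Real.sq_sqrt hp.le
      set a := √(expDensity f₀ t)
      set b := √(expDensity f₁ t)
      set x := expDensity f t - expDensity f₁ t with hx
      have hinv : (expDensity f₁ t)⁻¹ ≤ E := inv_expDensity_le h₁ t
      -- The first term is the affinity integrand and the second integrates to zero. The third is of
      -- second order and is split by the weighted inequality of arithmetic and geometric means,
      -- with `1 / b² ≤ E`.
      have e : expDensity f t * (a / b) = a * b + x + x * ((a - b) / b) := by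
        rw [hx, ← hsq]; field_simp; ring
      have hy : x * ((a - b) / b) ≤ 2 * E * x ^ 2 + (b - a) ^ 2 / 8 := by
        have h2 : 1 ≤ E * b ^ 2 := by
          rw [hsq]
          rwa [inv_le_iff_one_le_mul₀ hp] at hinv
        rw [mul_div_assoc', div_le_iff₀ hs]
        have hb1 : 0 ≤ b := hs.le
        have h3 : x * (a - b) ≤ 2 * E * b * x ^ 2 + (b - a) ^ 2 / 8 * b := by
          have h4 : 0 ≤ (4 * (E * b) * x - (a - b) / 1 * (E * b ^ 2)) ^ 2 := sq_nonneg _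
          have hEb : 0 < E * b := by positivity
          by_contra! hcon
          nlinarith [sq_nonneg (4 * E * b * x - (a - b) * 1), mul_pos hE0 hs,
            mul_lt_mul_of_pos_left hcon (mul_pos hE0 hs),
            mul_nonneg (sub_nonneg.2 h2) (sq_nonneg (a - b))]
        linarith
      simp only [e]; linarith
  have i1 := (h₀.sqrtDensity.mul h₁.sqrtDensity).integrable
  have i2 := (hf.expDensity.sub h₁.expDensity).integrable
  have i3 := (hf.expDensity.sub h₁.expDensity).sq.integrable.const_mul (2 * E)
  have i4 := (h₁.sqrtDensity.sub h₀.sqrtDensity).sq.integrable.div_const 8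
  have i12 : Integrable (fun t => √(expDensity f₀ t) * √(expDensity f₁ t) +
      (expDensity f t - expDensity f₁ t)) unitVolume := i1.add i2
  have i34 : Integrable (fun t => 2 * E * (expDensity f t - expDensity f₁ t) ^ 2 +
      (√(expDensity f₁ t) - √(expDensity f₀ t)) ^ 2 / 8) unitVolume := i3.add i4
  rw [integral_add i12 i34, integral_add i1 i2, integral_add i3 i4,
    integral_sub hf.expDensity.integrable h₁.expDensity.integrable, hf.integral_expDensity,
    h₁.integral_expDensity, integral_const_mul, integral_div, ← hellinger_sq, haff] at hle
  have hUD : 2 * E * sqDist (expDensity f) (expDensity f₁) ≤ hellinger f₁ f₀ ^ 2 / 8 := by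
    have h1 := (sqDist_expDensity_le hf h₁).trans
      (mul_le_mul_of_nonneg_left (sqDist_logDensity_le hf h₁) (by positivity))
    have h2 : sqDist (expDensity f) (expDensity f₁) ≤
        E ^ 2 * (C * (F ^ 2 / 4 / (16 * E * E ^ 2 * C) * sqDist f₁ f₀)) :=
      h1.trans (mul_le_mul_of_nonneg_left (mul_le_mul_of_nonneg_left hclose hC0.le) (by positivity))
    have e : 2 * E * (E ^ 2 * (C * (F ^ 2 / 4 / (16 * E * E ^ 2 * C) * sqDist f₁ f₀))) =
        F ^ 2 / 4 * sqDist f₁ f₀ / 8 := by field_simp; ring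
    have := mul_le_mul_of_nonneg_left h2 (by positivity : 0 ≤ 2 * E)
    rw [e] at this
    linarith
  simp only [sqDist] at hUD hH' ⊢
  linarith

/-! ### Fourier series as log densities -/

theorem isBddBy_fourierSeries {θ : ℕ+ → ℝ} (hθ : Summable fun j => |θ j|) {B : ℝ}
    (hB : ∑' j, |θ j| ≤ B) : IsBddBy (√2 * B) (fourierSeries θ) :=
  ⟨(continuous_fourierSeries hθ).measurable, fun t =>
    (abs_fourierSeries_le hθ t).trans (mul_le_mul_of_nonneg_left hB (Real.sqrt_nonneg _))⟩

theorem sqDist_fourierSeries {θ η : ℕ+ → ℝ} (hθ : Summable fun j => |θ j|)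
    (hη : Summable fun j => |η j|) :
    HasSum (fun j => (θ j - η j) ^ 2) (sqDist (fourierSeries θ) (fourierSeries η)) := by
  have := hasSum_sq_fourierSeries (summable_abs_sub hθ hη)
  simp only [fourierSeries_sub hθ hη] at this
  exact this

theorem integral_fourierSeries_sub {θ η : ℕ+ → ℝ} (hθ : Summable fun j => |θ j|)
    (hη : Summable fun j => |η j|) (h1 : θ 1 = η 1) :
    ∫ t, (fourierSeries θ t - fourierSeries η t) ∂unitVolume = 0 := by
  have := fourierCoefficient_fourierSeries (summable_abs_sub hθ hη) 1
  rw [h1, sub_self, fourierCoefficient, trigBasis_one] at this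
  simpa [fourierSeries_sub hθ hη] using this

/-- The first basis function is constant, so its coefficient multiplies numerator and normalising
integral by the same factor. -/
theorem expDensity_fourierSeries_update {θ : ℕ+ → ℝ} (hθ : Summable fun j => |θ j|) :
    expDensity (fourierSeries (Function.update θ 1 0)) = expDensity (fourierSeries θ) := by
  have hsub (t : ℝ) : fourierSeries θ t =
      fourierSeries (Function.update θ 1 0) t + θ 1 := by
    have h1 := (summable_fourierSeries hθ t).hasSum.update 1 0
    have e : (fun j => Function.update θ 1 0 j * trigBasis j t) =
        Function.update (fun j => θ j * trigBasis j t) 1 0 := by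
      ext j
      by_cases hj : j = 1
      · subst hj; simp
      · simp [hj]
    rw [fourierSeries, fourierSeries, e, h1.tsum_eq, trigBasis_one]; ring
  ext t
  simp only [expDensity, hsub, Real.exp_add, integral_mul_const]
  rw [mul_div_mul_right _ _ (Real.exp_pos _).ne']

end BlockPrior

namespace BlockPrior

/-! ### The blocks -/

theorem blockStart_le_exp (k : ℕ) : (blockStart k : ℝ) ≤ Real.exp k :=
  Nat.floor_le (Real.exp_pos _).le

theorem exp_lt_two_mul_blockStart (k : ℕ) : Real.exp k < 2 * blockStart k := by
  have h1 : Real.exp k < blockStart k + 1 := Nat.lt_floor_add_one _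
  have h2 : 1 ≤ blockStart k := Nat.one_le_of_lt (lt_blockStart k)
  have h3 : (1 : ℝ) ≤ blockStart k := by exact_mod_cast h2
  linarith

theorem exp_blockIndex_lt (j : ℕ+) : Real.exp (blockIndex j) < 2 * (j : ℕ) := by
  have h1 : (blockStart (blockIndex j) : ℝ) ≤ (j : ℕ) := by
    exact_mod_cast (blockIndex_spec j).1
  linarith [exp_lt_two_mul_blockStart (blockIndex j)]

theorem lt_exp_blockIndex_add_one (j : ℕ+) : ((j : ℕ) : ℝ) < Real.exp (blockIndex j + 1) := by
  have h1 : ((j : ℕ) : ℝ) < blockStart (blockIndex j + 1) := by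
    exact_mod_cast (blockIndex_spec j).2
  have := blockStart_le_exp (blockIndex j + 1)
  push_cast at this
  linarith

theorem blockIndex_one : blockIndex 1 = 0 := by
  have h := (blockIndex_spec 1).1
  have := lt_blockStart (blockIndex 1)
  simp at h; omega

theorem blockStart_mono : Monotone blockStart := fun _ _ h =>
  Nat.floor_mono (Real.exp_le_exp.2 (by exact_mod_cast h))

/-- The indices in the blocks `B₀, …, B_K`. -/
noncomputable def headIndices (K : ℕ) : Finset ℕ+ :=
  (Finset.Icc 1 (blockStart (K + 1)).toPNat').filter
    fun j => blockIndex j ≤ K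

theorem mem_headIndices {K : ℕ} {j : ℕ+} : j ∈ headIndices K ↔ blockIndex j ≤ K := by
  simp only [headIndices, Finset.mem_filter, Finset.mem_Icc, one_le, true_and,
    and_iff_right_iff_imp]
  intro h
  rw [← PNat.coe_le_coe, Nat.toPNat'_coe, if_pos ((Nat.zero_le _).trans_lt (lt_blockStart _))]
  exact (blockIndex_spec j).2.le.trans (blockStart_mono (by omega))

theorem not_mem_headIndices {K : ℕ} {j : ℕ+} : j ∉ headIndices K ↔ K < blockIndex j := by
  rw [mem_headIndices, not_le]

theorem card_headIndices_le (K : ℕ) : ((headIndices K).card : ℝ) ≤ Real.exp (K + 1) := by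
  have h1 : (headIndices K).card ≤ blockStart (K + 1) := by
    refine (Finset.card_filter_le _ _).trans ?_
    rw [PNat.card_Icc, Nat.toPNat'_coe, if_pos ((Nat.zero_le _).trans_lt (lt_blockStart _))]; simp
  have h2 : ((headIndices K).card : ℝ) ≤ blockStart (K + 1) := by exact_mod_cast h1
  have := blockStart_le_exp (K + 1)
  push_cast at this
  linarith

theorem tendsto_headIndices : Tendsto headIndices atTop atTop := by
  refine tendsto_atTop_finset_of_monotone (fun K L h j hj => ?_)
    fun j => ⟨blockIndex j, mem_headIndices.2 le_rfl⟩
  rw [mem_headIndices] at *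
  omega

theorem sum_exp_le (K : ℕ) :
    ∑ k ∈ Finset.range K, Real.exp (k + 1) ≤ Real.exp (K + 1) := by
  induction K with
  | zero => simp; positivity
  | succ K ih =>
    rw [Finset.sum_range_succ]
    push_cast
    have h2 : (2 : ℝ) ≤ Real.exp 1 := by linarith [Real.add_one_le_exp (1 : ℝ)]
    rw [Real.exp_add ((K : ℝ) + 1) 1]
    nlinarith [Real.exp_pos ((K : ℝ) + 1)]

/-- Write `K - k` as the number of `i < K` with `k ≤ i` and exchange the sums: the sizes of the
heads form a geometric series. Blocks far below `K` contain too few indices for the factor `K - k`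
to produce a logarithm. -/
theorem sum_headIndices_sub_le (K : ℕ) :
    ∑ j ∈ headIndices K, ((K : ℝ) - blockIndex j) ≤ Real.exp (K + 1) := by
  have h1 (j : ℕ+) (hj : j ∈ headIndices K) : ((K : ℝ) - blockIndex j) =
      ∑ i ∈ Finset.range K, if blockIndex j ≤ i then (1 : ℝ) else 0 := by
    have hj' := mem_headIndices.1 hj
    rw [Finset.sum_ite, Finset.sum_const, Finset.sum_const_zero, add_zero]
    have : (Finset.range K).filter (fun i => blockIndex j ≤ i) = Finset.Ico (blockIndex j) K := by
      ext i; simp [and_comm]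
    rw [this, Nat.card_Ico, nsmul_eq_mul, mul_one, Nat.cast_sub hj']
  rw [Finset.sum_congr rfl h1, Finset.sum_comm]
  refine (Finset.sum_le_sum fun i hi => ?_).trans (sum_exp_le K)
  rw [Finset.sum_ite, Finset.sum_const, Finset.sum_const_zero, add_zero, nsmul_eq_mul, mul_one]
  refine le_trans ?_ (card_headIndices_le i)
  exact_mod_cast Finset.card_le_card fun j hj => mem_headIndices.2 (Finset.mem_filter.1 hj).2

/-- An index in block `k` is smaller than `e^{k+1}`, so a comparison with `j^{-2}` costs only a
factor `e^{2(k+1)}`. The quadratic exponent absorbs this and any other linear exponent, by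
completing the square. -/
theorem summable_exp_blockIndex (a : ℝ) {c : ℝ} (hc : 0 < c) :
    Summable fun j : ℕ+ => Real.exp (a * blockIndex j - c * (blockIndex j : ℝ) ^ 2) := by
  have hs := (summable_rpow_pnat (s := 2) (by norm_num)).mul_left
    (Real.exp ((a + 2) ^ 2 / (4 * c) + 2))
  refine hs.of_nonneg_of_le (fun _ => (Real.exp_pos _).le) fun j => ?_
  have hj : (0 : ℝ) < (j : ℕ) := by exact_mod_cast j.pos
  have h1 := lt_exp_blockIndex_add_one j
  set k : ℝ := (blockIndex j : ℝ)
  have h2 : Real.exp (-(2 * (k + 1))) ≤ ((j : ℕ) : ℝ) ^ (-(2 : ℝ)) := by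
    rw [Real.rpow_neg hj.le, Real.exp_neg]
    refine inv_anti₀ (by positivity) ?_
    rw [two_mul, Real.exp_add, Real.rpow_two, pow_two]
    exact mul_le_mul h1.le h1.le hj.le (Real.exp_pos _).le
  refine le_trans ?_ (mul_le_mul_of_nonneg_left h2 (Real.exp_pos _).le)
  rw [← Real.exp_add]
  refine Real.exp_le_exp.2 ?_
  have h3 : (a + 2) * k - c * k ^ 2 ≤ (a + 2) ^ 2 / (4 * c) := by
    rw [le_div_iff₀ (by positivity)]
    nlinarith [sq_nonneg (2 * c * k - (a + 2))]
  linarith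

theorem sq_div_two_le_exp (k : ℕ) : (k : ℝ) ^ 2 / 2 ≤ Real.exp k := by
  have := Real.quadratic_le_exp_of_nonneg (x := (k : ℝ)) (by positivity)
  have h : (0 : ℝ) ≤ k := by positivity
  linarith

theorem summable_exp_exp_blockIndex {c : ℝ} (hc : 0 < c) :
    Summable fun j : ℕ+ => Real.exp (-c * Real.exp (blockIndex j)) := by
  refine (summable_exp_blockIndex 0 (half_pos hc)).of_nonneg_of_le (fun _ => (Real.exp_pos _).le)
    fun j => Real.exp_le_exp.2 ?_
  nlinarith [sq_div_two_le_exp (blockIndex j)]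

theorem tendsto_tsum_tail {u : ℕ+ → ℝ} (hu : Summable u) (h0 : ∀ j, 0 ≤ u j) :
    Tendsto (fun K => ∑' j : {j // j ∉ headIndices K}, ENNReal.ofReal (u j)) atTop (𝓝 0) := by
  refine (ENNReal.tendsto_tsum_compl_atTop_zero (f := fun j => ENNReal.ofReal (u j)) ?_).comp tendsto_headIndices
  rw [← ENNReal.ofReal_tsum_of_nonneg h0 hu]
  exact ENNReal.ofReal_ne_top

/-! ### Infinite product measures -/

section Product

variable {ι : Type*}

/-- A box in finitely many coordinates is independent of any event generated by the others. It
separates head and tail twice: for the scales, and for the coefficients given the scales. -/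
theorem infinitePi_pi_inter (μ : ι → Measure ℝ) [∀ i, IsProbabilityMeasure (μ i)] (s : Finset ι)
    {t : ι → Set ℝ} (ht : ∀ i, MeasurableSet (t i)) {E : Set (ι → ℝ)}
    (hE : MeasurableSet[⨆ i ∈ (s : Set ι)ᶜ, MeasurableSpace.comap (fun x : ι → ℝ => x i)
      inferInstance] E) :
    Measure.infinitePi μ ((s : Set ι).pi t ∩ E) =
      (∏ i ∈ s, μ i (t i)) * Measure.infinitePi μ E := by
  have hind : iIndepFun (fun i (x : ι → ℝ) => x i) (Measure.infinitePi μ) :=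
    iIndepFun_infinitePi (X := fun _ x => x) fun _ => measurable_id
  have h := indep_iSup_of_disjoint (fun i => (measurable_pi_apply i).comap_le) hind
    (disjoint_compl_right (a := (s : Set ι)))
  rw [(Indep_iff _ _ _).1 h _ _ ?_ hE, Measure.infinitePi_pi μ fun i _ => ht i]
  rw [Set.pi_def]
  refine MeasurableSet.biInter s.countable_toSet fun i hi => ?_
  exact le_iSup₂ (f := fun i (_ : i ∈ (s : Set ι)) =>
    MeasurableSpace.comap (fun x : ι → ℝ => x i) inferInstance) i hi _ ⟨t i, ht i, rfl⟩

/-- Measurability for the σ-algebra of the coordinates in `S` alone, as the independence of head and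
tail requires. -/
theorem measurable_tsum_of_mem {J : Type*} [Countable J] {S : Set ι} (κ : J → ι)
    (hκ : ∀ j, κ j ∈ S) {w : J → ℝ → ℝ≥0∞} (hw : ∀ j, Measurable (w j)) :
    Measurable[⨆ i ∈ S, MeasurableSpace.comap (fun x : ι → ℝ => x i) inferInstance]
      fun x : ι → ℝ => ∑' j, w j (x (κ j)) := by
  refine @Measurable.tsum _ _ _ (_) _ _ _ _ _ _ _ _ _ _ _ _ fun j => ?_
  refine (hw j).comp ?_
  refine Measurable.mono (comap_measurable fun x : ι → ℝ => x (κ j)) ?_ le_rfl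
  exact le_iSup₂ (f := fun i (_ : i ∈ S) =>
    MeasurableSpace.comap (fun x : ι → ℝ => x i) inferInstance) (κ j) (hκ j)

end Product

/-! ### Centred Gaussian measures -/

/-- The law is the image of one fixed standard Gaussian under a scaling that is jointly measurable
in the variance and the point. -/
theorem measurable_gaussianReal_toNNReal : Measurable fun a : ℝ => gaussianReal 0 a.toNNReal := by
  have heq : (fun a : ℝ => gaussianReal 0 a.toNNReal) = fun a =>
      ((gaussianReal 0 1).map (Prod.mk a)).map
        fun p : ℝ × ℝ => √(p.1.toNNReal : ℝ) * p.2 := by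
    funext a
    rw [Measure.map_map (by fun_prop) measurable_prodMk_left]
    have : (fun p : ℝ × ℝ => √(p.1.toNNReal : ℝ) * p.2) ∘ Prod.mk a =
        fun x => √(a.toNNReal : ℝ) * x := rfl
    rw [this, gaussianReal_map_const_mul]
    congr 1
    · simp
    · ext; simp
  rw [heq]
  exact (Measure.measurable_map _ (by fun_prop)).comp Measurable.map_prodMk_left

theorem lintegral_sq_gaussianReal (v : ℝ≥0) :
    ∫⁻ x, ENNReal.ofReal (x ^ 2) ∂(gaussianReal 0 v) = v := by
  have hm : MemLp id 2 (gaussianReal 0 v) := memLp_id_gaussianReal 2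
  have hi : Integrable (fun x : ℝ => x ^ 2) (gaussianReal 0 v) := hm.integrable_sq
  rw [← ofReal_integral_eq_lintegral_ofReal hi (Eventually.of_forall fun _ => sq_nonneg _)]
  have h := variance_id_gaussianReal (μ := 0) (v := v)
  rw [variance_of_integral_eq_zero aemeasurable_id (by simp)] at h
  simp only [id] at h
  rw [h, ENNReal.ofReal_coe_nnreal]

/-- The Chernoff bound is applied with the sub-Gaussian parameter `b` instead of the variance, so it
is uniform over `v ≤ b` and includes the degenerate case `v = 0`. -/
theorem gaussianReal_sq_gt_le {v : ℝ≥0} {b s : ℝ} (hb : 0 < b) (hv : (v : ℝ) ≤ b) (hs : 0 ≤ s) :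
    gaussianReal 0 v {x | s < x ^ 2} ≤ ENNReal.ofReal (2 * Real.exp (-s / (2 * b))) := by
  have hsub : HasSubgaussianMGF id b.toNNReal (gaussianReal 0 v) := by
    refine ⟨fun t => by simpa using integrable_exp_mul_gaussianReal t, fun t => ?_⟩
    rw [mgf_id_gaussianReal, Real.coe_toNNReal _ hb.le]
    refine Real.exp_le_exp.2 ?_
    nlinarith [sq_nonneg t]
  have h1 := hsub.measure_ge_le (Real.sqrt_nonneg s)
  have h2 := hsub.neg.measure_ge_le (Real.sqrt_nonneg s)
  rw [Real.sq_sqrt hs, Real.coe_toNNReal _ hb.le] at h1 h2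
  have hcov : {x : ℝ | s < x ^ 2} ⊆ {x | √s ≤ id x} ∪ {x | √s ≤ (-id) x} := by
    intro x hx
    have : √s ≤ |x| := Real.sqrt_le_left (abs_nonneg x) |>.2 (by rw [sq_abs]; exact le_of_lt hx)
    rcases le_abs.1 this with h | h
    · exact Or.inl h
    · exact Or.inr h
  refine (measure_mono hcov).trans ((measure_union_le _ _).trans ?_)
  rw [two_mul, ENNReal.ofReal_add (Real.exp_pos _).le (Real.exp_pos _).le]
  refine add_le_add ?_ ?_
  · rw [← ofReal_measureReal]; exact ENNReal.ofReal_le_ofReal h1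
  · rw [← ofReal_measureReal]; exact ENNReal.ofReal_le_ofReal h2

/-- Lower bound for the Gaussian mass of an interval. -/
theorem gaussianReal_Icc_ge {a x δ : ℝ} (ha : 0 < a) (hδ : 0 < δ) :
    ENNReal.ofReal (δ / (2 * √a) * Real.exp (-(x ^ 2 + δ ^ 2) / a)) ≤
      gaussianReal 0 a.toNNReal (Set.Icc (x - δ) (x + δ)) := by
  have hv : a.toNNReal ≠ 0 := by simpa using ha
  rw [gaussianReal_apply _ hv]
  have hlow (y : ℝ) (hy : y ∈ Set.Icc (x - δ) (x + δ)) :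
      ENNReal.ofReal (1 / (4 * √a) * Real.exp (-(x ^ 2 + δ ^ 2) / a)) ≤
        gaussianPDF 0 a.toNNReal y := by
    refine ENNReal.ofReal_le_ofReal ?_
    rw [gaussianPDFReal, Real.coe_toNNReal _ ha.le, ← one_div]
    refine mul_le_mul ?_ ?_ (Real.exp_pos _).le (by positivity)
    -- The factor `4` is a crude bound for `√(2π)`. The interval has length `2δ`, which leads to `δ
    -- / (2√a)`.
    · refine one_div_le_one_div_of_le (by positivity) ?_
      have : (4 : ℝ) * √a = √(16 * a) := by
        rw [Real.sqrt_mul (by norm_num)]; congr 1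
        rw [show (16 : ℝ) = 4 ^ 2 by norm_num, Real.sqrt_sq (by norm_num)]
      rw [this]
      refine Real.sqrt_le_sqrt ?_
      nlinarith [Real.pi_lt_four]
    · refine Real.exp_le_exp.2 ?_
      rw [neg_div, neg_div, neg_le_neg_iff, div_le_div_iff₀ (by positivity) ha]
      have h1 : (y - 0) ^ 2 ≤ 2 * (x ^ 2 + δ ^ 2) := by
        have h2 : (y - x) ^ 2 ≤ δ ^ 2 := by
          rw [sq_le_sq, abs_of_pos hδ, abs_le]; constructor <;> linarith [hy.1, hy.2]
        nlinarith [sq_nonneg (y - 2 * x)]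
      nlinarith
  refine le_trans (le_of_eq ?_) (setLIntegral_mono' measurableSet_Icc hlow)
  rw [setLIntegral_const, Real.volume_Icc, ← ENNReal.ofReal_mul (by positivity)]
  congr 1
  have := Real.sqrt_pos.2 ha
  field_simp; ring

/-! ### The block prior -/

/-- The law of a single scale. -/
noncomputable def scaleMeasure (g : ℕ → ℝ → ℝ) (k : ℕ) : Measure ℝ :=
  (volume.restrict (Set.Ioi 0)).withDensity fun t => ENNReal.ofReal (g k t)

section Prior

variable {g : ℕ → ℝ → ℝ}

theorem IsMixing.isProbabilityMeasure (hg : IsMixing g) (k : ℕ) :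
    IsProbabilityMeasure (scaleMeasure g k) :=
  ⟨by rw [scaleMeasure, withDensity_apply _ .univ, Measure.restrict_univ, hg.lintegral_eq_one]⟩

theorem scaleMeasure_apply {k : ℕ} {S : Set ℝ} (hS : MeasurableSet S) :
    scaleMeasure g k S = ∫⁻ t in S ∩ Set.Ioi 0, ENNReal.ofReal (g k t) := by
  rw [scaleMeasure, withDensity_apply _ hS, Measure.restrict_restrict hS]

theorem IsMixing.lintegral_scaleMeasure (hg : IsMixing g) (k : ℕ) :
    ∫⁻ a, ENNReal.ofReal a ∂(scaleMeasure g k) =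
      ∫⁻ t in Set.Ioi 0, ENNReal.ofReal (t * g k t) := by
  rw [scaleMeasure, lintegral_withDensity_eq_lintegral_mul _
    (hg.measurable k).ennreal_ofReal ENNReal.measurable_ofReal]
  refine setLIntegral_congr_fun measurableSet_Ioi fun t ht => ?_
  simp only [Pi.mul_apply]
  rw [ENNReal.ofReal_mul (le_of_lt ht), mul_comm]

instance (A : ℕ → ℝ) : IsProbabilityMeasure (gaussianGivenScales A) := by
  unfold gaussianGivenScales; infer_instance

theorem blockPrior_apply {E : Set (ℕ+ → ℝ)} (hE : MeasurableSet E) :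
    blockPrior g E = ∫⁻ A, gaussianGivenScales A E ∂(scaleLaw g) :=
  Measure.bind_apply hE measurable_gaussianGivenScales.aemeasurable

theorem IsMixing.isProbabilityMeasure_scaleLaw (hg : IsMixing g) :
    IsProbabilityMeasure (scaleLaw g) := by
  have := hg.isProbabilityMeasure
  change IsProbabilityMeasure (Measure.infinitePi fun k => scaleMeasure g k)
  infer_instance

theorem IsMixing.isProbabilityMeasure_blockPrior (hg : IsMixing g) :
    IsProbabilityMeasure (blockPrior g) := by
  have := hg.isProbabilityMeasure_scaleLaw
  refine ⟨?_⟩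
  rw [blockPrior_apply .univ]; simp

theorem measurable_update_one : Measurable fun θ : ℕ+ → ℝ => Function.update θ 1 0 := by
  refine measurable_pi_iff.2 fun j => ?_
  by_cases hj : j = 1
  · subst hj; simp
  · simp only [Function.update_of_ne hj]; fun_prop

theorem IsMixing.isProbabilityMeasure_centredBlockPrior (hg : IsMixing g) :
    IsProbabilityMeasure (centredBlockPrior g) := by
  have := hg.isProbabilityMeasure_blockPrior
  exact Measure.isProbabilityMeasure_map measurable_update_one.aemeasurable

theorem gaussianGivenScales_eval (A : ℕ → ℝ) (j : ℕ+) {S : Set ℝ} (hS : MeasurableSet S) :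
    gaussianGivenScales A {θ | θ j ∈ S} = gaussianReal 0 (A (blockIndex j)).toNNReal S := by
  have h := Measure.infinitePi_map_eval
    (fun j : ℕ+ => gaussianReal 0 (A (blockIndex j)).toNNReal) j
  rw [← h, Measure.map_apply (measurable_pi_apply j) hS]
  rfl

theorem IsMixing.lintegral_scaleLaw_eval (hg : IsMixing g) (k : ℕ) {f : ℝ → ℝ≥0∞}
    (hf : Measurable f) :
    ∫⁻ A, f (A k) ∂(scaleLaw g) = ∫⁻ a, f a ∂(scaleMeasure g k) := by
  have := hg.isProbabilityMeasure
  have h := Measure.infinitePi_map_eval (fun k : ℕ => scaleMeasure g k) k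
  rw [← h, lintegral_map hf (measurable_pi_apply k)]
  rfl

theorem IsMixing.blockPrior_eval (hg : IsMixing g) (j : ℕ+) {S : Set ℝ} (hS : MeasurableSet S) :
    blockPrior g {θ | θ j ∈ S} =
      ∫⁻ a, gaussianReal 0 a.toNNReal S ∂(scaleMeasure g (blockIndex j)) := by
  have hm : MeasurableSet {θ : ℕ+ → ℝ | θ j ∈ S} := measurable_pi_apply j hS
  rw [blockPrior_apply hm]
  simp_rw [gaussianGivenScales_eval _ j hS]
  exact hg.lintegral_scaleLaw_eval _
    ((Measure.measurable_coe hS).comp measurable_gaussianReal_toNNReal)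

theorem lintegral_gaussianGivenScales_eval (A : ℕ → ℝ) (j : ℕ+) {f : ℝ → ℝ≥0∞}
    (hf : Measurable f) :
    ∫⁻ θ, f (θ j) ∂(gaussianGivenScales A) =
      ∫⁻ x, f x ∂(gaussianReal 0 (A (blockIndex j)).toNNReal) := by
  have h := Measure.infinitePi_map_eval
    (fun j : ℕ+ => gaussianReal 0 (A (blockIndex j)).toNNReal) j
  rw [← h, lintegral_map hf (measurable_pi_apply j)]
  rfl

end Prior

end BlockPrior

namespace BlockPrior

variable {g : ℕ → ℝ → ℝ}

/-! ### Mass of the sieves -/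

theorem measurable_tail (K : ℕ) {w : ℕ+ → ℝ → ℝ≥0∞} (hw : ∀ j, Measurable (w j)) :
    Measurable fun θ : ℕ+ → ℝ => ∑' j : {j // j ∉ headIndices K}, w j (θ j) :=
  Measurable.tsum fun j => (hw j).comp (measurable_pi_apply _)

theorem update_one_of_not_mem {K : ℕ} (θ : ℕ+ → ℝ) (j : {j // j ∉ headIndices K}) :
    Function.update θ 1 0 j = θ j := by
  refine Function.update_of_ne ?_ _ _
  intro h
  have := j.2
  rw [not_mem_headIndices, h, blockIndex_one] at this
  omega

/-- The index set on which the coordinates beyond block `K` have squared norm at most `r`. -/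
def tailBall (K : ℕ) (r : ℝ) : Set (ℕ+ → ℝ) :=
  {θ | ∑' j : {j // j ∉ headIndices K}, ENNReal.ofReal (θ j ^ 2) ≤ ENNReal.ofReal r}

theorem measurableSet_tailBall (K : ℕ) (r : ℝ) : MeasurableSet (tailBall K r) :=
  measurableSet_le (measurable_tail K (w := fun _ x => ENNReal.ofReal (x ^ 2)) fun _ => by fun_prop)
    measurable_const

/-- Either the scale exceeds `e^{-k²}`, which has probability at most `exp(-c₃ e^k)`, or the
variance is at most `e^{-k²}`. The threshold is chosen so that in the second case the Gaussian tail
is `2 exp(-c₃ e^k)`. -/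
theorem IsMixing.blockPrior_sq_gt_le (hg : IsMixing g) {c₃ : ℝ}
    (hc₃ : ∀ k : ℕ, ∫⁻ t in Set.Ioi (Real.exp (-(k : ℝ) ^ 2)), ENNReal.ofReal (g k t) ≤
      ENNReal.ofReal (Real.exp (-c₃ * Real.exp k))) (h0 : 0 < c₃) (j : ℕ+) :
    blockPrior g {θ | 2 * c₃ * Real.exp (blockIndex j - (blockIndex j : ℝ) ^ 2) < θ j ^ 2} ≤
      ENNReal.ofReal (3 * Real.exp (-c₃ * Real.exp (blockIndex j))) := by
  set k := blockIndex j
  have := hg.isProbabilityMeasure k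
  set s : ℝ := 2 * c₃ * Real.exp (k - (k : ℝ) ^ 2) with hs
  have hs0 : 0 ≤ s := by positivity
  set b := Real.exp (-(k : ℝ) ^ 2) with hb
  have hS : MeasurableSet {x : ℝ | s < x ^ 2} := measurableSet_lt (by fun_prop) (by fun_prop)
  refine (hg.blockPrior_eval j hS).le.trans ?_
  have hpt (a : ℝ) : gaussianReal 0 a.toNNReal {x | s < x ^ 2} ≤
      (Set.Ioi b).indicator 1 a + ENNReal.ofReal (2 * Real.exp (-c₃ * Real.exp k)) := by
    by_cases ha : a ∈ Set.Ioi b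
    · rw [Set.indicator_of_mem ha]
      exact prob_le_one.trans le_self_add
    · rw [Set.indicator_of_notMem ha, zero_add]
      have hab : a ≤ b := not_lt.1 ha
      refine (gaussianReal_sq_gt_le (Real.exp_pos _)
        (by rw [Real.coe_toNNReal']; exact max_le hab (Real.exp_pos _).le) hs0).trans (le_of_eq ?_)
      congr 3
      rw [hs, sub_eq_add_neg, Real.exp_add]
      field_simp
  refine (lintegral_mono hpt).trans ?_
  rw [lintegral_add_right _ measurable_const, lintegral_indicator_one measurableSet_Ioi,
    lintegral_const, measure_univ, mul_one, scaleMeasure_apply measurableSet_Ioi]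
  have e : Set.Ioi b ∩ Set.Ioi 0 = Set.Ioi b :=
    Set.inter_eq_left.2 (Set.Ioi_subset_Ioi (Real.exp_pos _).le)
  rw [e]
  refine (add_le_add (hc₃ k) le_rfl).trans ?_
  rw [← ENNReal.ofReal_add (by positivity) (by positivity)]
  exact ENNReal.ofReal_le_ofReal (by linarith)

/-- The sieve `tailBall (K + m) (e^{-2αK})` carries all but an exponentially small part of the
prior mass. -/
theorem IsMixing.exists_compl_tailBall_le (hg : IsMixing g) {α : ℝ} (hα : 0 ≤ α) (C : ℝ) :
    ∃ m : ℕ, ∀ᶠ K : ℕ in atTop,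
      centredBlockPrior g (tailBall (K + m) (Real.exp (-2 * α * K)))ᶜ ≤
        ENNReal.ofReal (Real.exp (-C * Real.exp K)) := by
  obtain ⟨c₃, h0, hc₃⟩ := hg.tail_bound
  obtain ⟨m, hm⟩ := exists_nat_ge (2 * (C + 1) / c₃)
  refine ⟨m, ?_⟩
  -- Beyond block `K + m`, half of the exponent `c₃ e^k` already exceeds `C e^K`; the other half
  -- keeps the union bound over the coordinates summable.
  have hm' : C + 1 ≤ c₃ / 2 * Real.exp m := by
    have h1 : (m : ℝ) ≤ Real.exp m := by linarith [Real.add_one_le_exp (m : ℝ)]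
    rw [div_le_iff₀ h0] at hm
    nlinarith
  set s : ℕ+ → ℝ := fun j => 2 * c₃ * Real.exp (blockIndex j - (blockIndex j : ℝ) ^ 2) with hs
  have hsum1 : Summable fun j : ℕ+ => 2 * c₃ *
      Real.exp ((1 + 2 * α) * blockIndex j - 1 * (blockIndex j : ℝ) ^ 2) :=
    (summable_exp_blockIndex (1 + 2 * α) one_pos).mul_left _
  have ht1 := (tendsto_tsum_tail hsum1 fun j => by positivity).comp
    (tendsto_add_atTop_nat m)
  have hsum2 := (summable_exp_exp_blockIndex (half_pos h0)).mul_left 3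
  have ht2 := (tendsto_tsum_tail hsum2 fun j => by positivity).comp
    (tendsto_add_atTop_nat m)
  filter_upwards [ht1.eventually_le_const (u := 1) (by norm_num),
    ht2.eventually_le_const (u := 1) (by norm_num)] with K hK1 hK2
  simp only [Function.comp] at hK1 hK2
  have hmeas := measurableSet_tailBall (K + m) (Real.exp (-2 * α * K))
  have hpre : (fun θ : ℕ+ → ℝ => Function.update θ 1 0) ⁻¹'
      (tailBall (K + m) (Real.exp (-2 * α * K)))ᶜ =
        (tailBall (K + m) (Real.exp (-2 * α * K)))ᶜ := by
    ext θ
    simp only [tailBall, Set.mem_preimage, Set.mem_compl_iff, Set.mem_ofPred_eq,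
      update_one_of_not_mem]
  rw [centredBlockPrior, Measure.map_apply measurable_update_one hmeas.compl, hpre]
  have htail (j : {j // j ∉ headIndices (K + m)}) : ((K : ℝ) + m) ≤ blockIndex (j : ℕ+) := by
    have := not_mem_headIndices.1 j.2
    exact_mod_cast this.le
  have hcov : (tailBall (K + m) (Real.exp (-2 * α * K)))ᶜ ⊆
      ⋃ j : {j // j ∉ headIndices (K + m)}, {θ : ℕ+ → ℝ | s j < θ j ^ 2} := by
    intro θ hθ
    by_contra hcon
    simp only [Set.mem_iUnion, Set.mem_ofPred_eq, not_exists, not_lt] at hcon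
    apply hθ
    -- Since `k ≥ K`, the factor `e^{-2αK}` can be taken out of the threshold at the price of
    -- `e^{2αk}`, which the decay `e^{-k²}` absorbs. The remaining tail sum is eventually at most
    -- one.
    calc ∑' j : {j // j ∉ headIndices (K + m)}, ENNReal.ofReal (θ j ^ 2)
        ≤ ∑' j : {j // j ∉ headIndices (K + m)}, ENNReal.ofReal (Real.exp (-2 * α * K)) *
          ENNReal.ofReal (2 * c₃ * Real.exp ((1 + 2 * α) * blockIndex (j : ℕ+) -
            1 * (blockIndex (j : ℕ+) : ℝ) ^ 2)) := by
          refine ENNReal.tsum_le_tsum fun j => ?_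
          rw [← ENNReal.ofReal_mul (Real.exp_pos _).le]
          refine ENNReal.ofReal_le_ofReal ((hcon j).trans ?_)
          rw [hs, mul_left_comm, ← Real.exp_add]
          refine mul_le_mul_of_nonneg_left (Real.exp_le_exp.2 ?_) (by positivity)
          have := htail j
          have : (0 : ℝ) ≤ m := by positivity
          nlinarith
      _ = ENNReal.ofReal (Real.exp (-2 * α * K)) * ∑' j : {j // j ∉ headIndices (K + m)},
          ENNReal.ofReal (2 * c₃ * Real.exp ((1 + 2 * α) * blockIndex (j : ℕ+) -
            1 * (blockIndex (j : ℕ+) : ℝ) ^ 2)) := ENNReal.tsum_mul_left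
      _ ≤ ENNReal.ofReal (Real.exp (-2 * α * K)) := mul_le_of_le_one_right' hK1
  refine (measure_mono hcov).trans ((measure_iUnion_le _).trans ?_)
  calc ∑' j : {j // j ∉ headIndices (K + m)}, blockPrior g {θ | s j < θ j ^ 2}
      ≤ ∑' j : {j // j ∉ headIndices (K + m)}, ENNReal.ofReal (Real.exp (-C * Real.exp K)) *
          ENNReal.ofReal (3 * Real.exp (-(c₃ / 2) * Real.exp (blockIndex (j : ℕ+)))) := by
        refine ENNReal.tsum_le_tsum fun j => ?_
        rw [← ENNReal.ofReal_mul (Real.exp_pos _).le]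
        refine (hg.blockPrior_sq_gt_le hc₃ h0 j).trans (ENNReal.ofReal_le_ofReal ?_)
        rw [mul_left_comm, ← Real.exp_add]
        refine mul_le_mul_of_nonneg_left (Real.exp_le_exp.2 ?_) (by norm_num)
        have h1 : Real.exp K * Real.exp m ≤ Real.exp (blockIndex (j : ℕ+)) := by
          rw [← Real.exp_add]; exact Real.exp_le_exp.2 (htail j)
        have h2 := Real.exp_pos (K : ℝ)
        have h3 := mul_le_mul_of_nonneg_left hm' h2.le
        nlinarith [mul_le_mul_of_nonneg_left h1 (half_pos h0).le]
    _ = ENNReal.ofReal (Real.exp (-C * Real.exp K)) * ∑' j : {j // j ∉ headIndices (K + m)},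
          ENNReal.ofReal (3 * Real.exp (-(c₃ / 2) * Real.exp (blockIndex (j : ℕ+)))) :=
        ENNReal.tsum_mul_left
    _ ≤ ENNReal.ofReal (Real.exp (-C * Real.exp K)) := mul_le_of_le_one_right' hK2

/-! ### Mass of small balls -/

/-- Every scale is comparable with `e^{-(2α+1)k}` with probability at least `e^{-C e^k}`. -/
theorem IsMixing.exists_scale_sets (hg : IsMixing g) {α : ℝ} (hα : 0 < α) :
    ∃ C > 0, ∃ I : ℕ → Set ℝ, (∀ k, MeasurableSet (I k)) ∧
      (∀ k : ℕ, ENNReal.ofReal (Real.exp (-C * Real.exp k)) ≤ scaleMeasure g k (I k)) ∧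
      ∀ k : ℕ, ∀ a ∈ I k, Real.exp (-C) * Real.exp (-(2 * α + 1) * k) ≤ a ∧
        a ≤ Real.exp C * Real.exp (-(2 * α + 1) * k) := by
  obtain ⟨c₁, hc₁, hlow⟩ := hg.lower_bound
  -- For small `k` the target scale may lie outside the range of the lower bound on `g k`. The
  -- intervals `J n` exhaust the half-line, so one of them has mass at least `e^{-1}`; this gives a
  -- constant depending on `k`, which is harmless for finitely many `k`.
  have hsmall (k : ℕ) : ∃ C > 0, ∃ I : Set ℝ, MeasurableSet I ∧
      ENNReal.ofReal (Real.exp (-C * Real.exp k)) ≤ scaleMeasure g k I ∧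
      ∀ a ∈ I, Real.exp (-C) * Real.exp (-(2 * α + 1) * k) ≤ a ∧
        a ≤ Real.exp C * Real.exp (-(2 * α + 1) * k) := by
    have := hg.isProbabilityMeasure k
    set a₀ := Real.exp (-(2 * α + 1) * k) with ha₀
    set J : ℕ → Set ℝ := fun n => Set.Icc (Real.exp (-(n : ℝ)) * a₀) (Real.exp n * a₀) with hJ
    have hmono : Monotone J := fun n p hnp => by
      have : (n : ℝ) ≤ p := by exact_mod_cast hnp
      exact Set.Icc_subset_Icc
        (mul_le_mul_of_nonneg_right (Real.exp_le_exp.2 (by linarith)) (Real.exp_pos _).le)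
        (mul_le_mul_of_nonneg_right (Real.exp_le_exp.2 (by linarith)) (Real.exp_pos _).le)
    have hU : Set.Ioi (0 : ℝ) ⊆ ⋃ n, J n := by
      intro a ha
      obtain ⟨n, hn⟩ := exists_nat_ge |Real.log (a / a₀)|
      have hpos : 0 < a / a₀ := div_pos ha (Real.exp_pos _)
      have h1 := abs_le.1 hn
      refine Set.mem_iUnion.2 ⟨n, ?_, ?_⟩
      · rw [← le_div_iff₀ (Real.exp_pos _)]; exact (Real.le_log_iff_exp_le hpos).1 h1.1
      · rw [← div_le_iff₀ (Real.exp_pos _)]; exact (Real.log_le_iff_le_exp hpos).1 h1.2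
    have hone : scaleMeasure g k (⋃ n, J n) = 1 := by
      refine le_antisymm prob_le_one ?_
      rw [scaleMeasure_apply (MeasurableSet.iUnion fun n => measurableSet_Icc),
        Set.inter_eq_right.2 hU, hg.lintegral_eq_one]
    have htend := tendsto_measure_iUnion_atTop (μ := scaleMeasure g k) hmono
    rw [hone] at htend
    obtain ⟨n, hn⟩ := (htend.eventually_const_le
      (show ENNReal.ofReal (Real.exp (-1)) < 1 by
        rw [← ENNReal.ofReal_one]
        exact (ENNReal.ofReal_lt_ofReal_iff one_pos).2 (by rw [← Real.exp_zero]; exact Real.exp_lt_exp.2 (by norm_num)))).exists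
    have hn0 : (0 : ℝ) ≤ n := by positivity
    refine ⟨n + 1, by positivity, J n, measurableSet_Icc, le_trans ?_ hn, fun a ha => ?_⟩
    · refine ENNReal.ofReal_le_ofReal (Real.exp_le_exp.2 ?_)
      have : (1 : ℝ) ≤ Real.exp k := Real.one_le_exp (by positivity)
      nlinarith
    · exact ⟨le_trans (mul_le_mul_of_nonneg_right (Real.exp_le_exp.2 (by linarith))
        (Real.exp_pos _).le) ha.1, ha.2.trans (mul_le_mul_of_nonneg_right
        (Real.exp_le_exp.2 (by linarith)) (Real.exp_pos _).le)⟩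
  choose Cs hCs Is hIm hIl hIb using hsmall
  -- For `k ≥ 2α + 2` one has `(2α+1)k + 1 ≤ k²`, so the interval from `e^{-(2α+1)k-1}` to
  -- `e^{-(2α+1)k}` lies where `g k` is bounded below.
  obtain ⟨k₀, hk₀⟩ := exists_nat_ge (2 * α + 2)
  set C := ∑ k ∈ Finset.range k₀, Cs k + (c₁ + 2 * α + 3) with hC
  have hCk (k : ℕ) (hk : k < k₀) : Cs k ≤ C := by
    have := Finset.single_le_sum (f := Cs) (fun i _ => (hCs i).le) (Finset.mem_range.2 hk)
    linarith
  have hC1 : c₁ + 2 * α + 3 ≤ C := by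
    have := Finset.sum_nonneg (s := Finset.range k₀) (f := Cs) fun i _ => (hCs i).le
    linarith
  have hC0 : 0 < C := by linarith
  refine ⟨C, hC0, fun k => if k < k₀ then Is k else
    Set.Icc (Real.exp (-(2 * α + 1) * k - 1)) (Real.exp (-(2 * α + 1) * k)), ?_, ?_, ?_⟩
  · intro k; dsimp only; split_ifs
    exacts [hIm k, measurableSet_Icc]
  · intro k
    dsimp only
    split_ifs with hk
    · refine le_trans (ENNReal.ofReal_le_ofReal (Real.exp_le_exp.2 ?_)) (hIl k)
      have := hCk k hk
      nlinarith [Real.exp_pos (k : ℝ)]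
    · have hkr : 2 * α + 2 ≤ (k : ℝ) := hk₀.trans (by exact_mod_cast not_lt.1 hk)
      have hpos : Set.Icc (Real.exp (-(2 * α + 1) * k - 1)) (Real.exp (-(2 * α + 1) * k)) ⊆
          Set.Ioi 0 := fun a ha => lt_of_lt_of_le (Real.exp_pos _) ha.1
      rw [scaleMeasure_apply measurableSet_Icc, Set.inter_eq_left.2 hpos]
      have h1 : ∀ t ∈ Set.Icc (Real.exp (-(2 * α + 1) * k - 1)) (Real.exp (-(2 * α + 1) * k)),
          ENNReal.ofReal (Real.exp (-c₁ * Real.exp k)) ≤ ENNReal.ofReal (g k t) := by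
        intro t ht
        refine ENNReal.ofReal_le_ofReal (hlow k t ⟨le_trans (Real.exp_le_exp.2 ?_) ht.1,
          ht.2.trans (Real.exp_le_exp.2 ?_)⟩)
        · nlinarith
        · nlinarith
      refine le_trans ?_ (setLIntegral_mono' measurableSet_Icc h1)
      rw [setLIntegral_const, Real.volume_Icc, ← ENNReal.ofReal_mul (by positivity)]
      refine ENNReal.ofReal_le_ofReal ?_
      have h2 : Real.exp (-(2 * α + 1) * k - 1) ≤
          Real.exp (-(2 * α + 1) * k) - Real.exp (-(2 * α + 1) * k - 1) := by
        have e : Real.exp (-(2 * α + 1) * k) = Real.exp (-(2 * α + 1) * k - 1) * Real.exp 1 := by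
          rw [← Real.exp_add]; ring_nf
        have : (2 : ℝ) ≤ Real.exp 1 := by linarith [Real.add_one_le_exp (1 : ℝ)]
        rw [e]
        nlinarith [Real.exp_pos (-(2 * α + 1) * k - 1)]
      refine le_trans ?_ (mul_le_mul_of_nonneg_left h2 (Real.exp_pos _).le)
      rw [← Real.exp_add]
      refine Real.exp_le_exp.2 ?_
      have h3 : (k : ℝ) + 1 ≤ Real.exp k := Real.add_one_le_exp _
      have h4 := mul_le_mul_of_nonneg_right hC1 (Real.exp_pos (k : ℝ)).le
      nlinarith
  · intro k a ha
    dsimp only at ha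
    split_ifs at ha with hk
    · have h1 := hCk k hk
      exact ⟨le_trans (mul_le_mul_of_nonneg_right (Real.exp_le_exp.2 (by linarith))
        (Real.exp_pos _).le) (hIb k a ha).1, (hIb k a ha).2.trans (mul_le_mul_of_nonneg_right
        (Real.exp_le_exp.2 (by linarith)) (Real.exp_pos _).le)⟩
    · constructor
      · refine le_trans ?_ ha.1
        rw [← Real.exp_add]
        exact Real.exp_le_exp.2 (by linarith)
      · refine ha.2.trans (le_mul_of_one_le_left (Real.exp_pos _).le ?_)
        exact Real.one_le_exp hC0.le

/-- Sequences within `e^{-(α+1/2)K}` of `θ₀` on the blocks up to `K`, with a small remainder. -/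
def priorNhd (α η : ℝ) (θ₀ : ℕ+ → ℝ) (K : ℕ) : Set (ℕ+ → ℝ) :=
  (headIndices K : Set ℕ+).pi (fun j => Set.Icc (θ₀ j - Real.exp (-(α + 1 / 2) * K))
    (θ₀ j + Real.exp (-(α + 1 / 2) * K))) ∩
  {θ | ∑' j : {j // j ∉ headIndices K}, ENNReal.ofReal
    (Real.exp (2 * α * K) * ((j : ℕ+) : ℝ) ^ 2 * θ j ^ 2) ≤ ENNReal.ofReal η}

/-- This is the Gaussian cost of shifting to `θ` when the variances are of order `e^{-(2α+1)k}`. One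
factor `e^k` is bounded by `e^K`, and the rest is the Sobolev norm because `e^k < 2j` in block `k`.
-/
theorem sum_exp_mul_sq_le {α Q : ℝ} (hα : 0 ≤ α) {θ : ℕ+ → ℝ} (h : IsSobolevSeq α Q θ) (K : ℕ) :
    ∑ j ∈ headIndices K, Real.exp ((2 * α + 1) * blockIndex j) * θ j ^ 2 ≤
      (2 : ℝ) ^ (2 * α) * Q ^ 2 * Real.exp K := by
  have hle : ∀ j ∈ headIndices K, Real.exp ((2 * α + 1) * blockIndex j) * θ j ^ 2 ≤
      (2 : ℝ) ^ (2 * α) * Real.exp K * (((j : ℕ) : ℝ) ^ (2 * α) * θ j ^ 2) := by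
    intro j hj
    have hj' : (blockIndex j : ℝ) ≤ K := by exact_mod_cast mem_headIndices.1 hj
    have h1 : Real.exp (2 * α * blockIndex j) ≤ (2 : ℝ) ^ (2 * α) * ((j : ℕ) : ℝ) ^ (2 * α) := by
      rw [← Real.mul_rpow (by norm_num) (by positivity), mul_comm (2 * α), Real.exp_mul]
      exact Real.rpow_le_rpow (Real.exp_pos _).le (exp_blockIndex_lt j).le (by positivity)
    have h2 : Real.exp ((2 * α + 1) * blockIndex j) ≤
        (2 : ℝ) ^ (2 * α) * ((j : ℕ) : ℝ) ^ (2 * α) * Real.exp K := by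
      rw [add_mul, one_mul, Real.exp_add]
      exact mul_le_mul h1 (Real.exp_le_exp.2 hj') (Real.exp_pos _).le (by positivity)
    have := mul_le_mul_of_nonneg_right h2 (sq_nonneg (θ j))
    linarith
  refine (Finset.sum_le_sum hle).trans ?_
  rw [← Finset.mul_sum]
  have := (h.summable.sum_le_tsum (headIndices K) fun j _ => by positivity).trans h.tsum_le
  have h2 : 0 ≤ (2 : ℝ) ^ (2 * α) * Real.exp K := by positivity
  nlinarith [mul_le_mul_of_nonneg_left this h2]

/-- The ratio of the interval's half-length to the standard deviation is of order
`e^{-(α+1/2)(K-k)}`. The half-length squared is at most `e^C a` since `k ≤ K`, so it adds only a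
constant to the exponent, and the centre contributes `x² / a`. -/
theorem gaussianReal_block_ge {α C : ℝ} (hα : 0 < α) (hC : 0 < C) {k K : ℕ} (hk : k ≤ K) {a : ℝ}
    (ha1 : Real.exp (-C) * Real.exp (-(2 * α + 1) * k) ≤ a)
    (ha2 : a ≤ Real.exp C * Real.exp (-(2 * α + 1) * k)) (x : ℝ) :
    ENNReal.ofReal (Real.exp (-((C + 1 + Real.exp C) + (α + 1 / 2) * ((K : ℝ) - k) +
      Real.exp C * (Real.exp ((2 * α + 1) * k) * x ^ 2)))) ≤
    gaussianReal 0 a.toNNReal (Set.Icc (x - Real.exp (-(α + 1 / 2) * K))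
      (x + Real.exp (-(α + 1 / 2) * K))) := by
  have ha : 0 < a := lt_of_lt_of_le (by positivity) ha1
  have hkK : (k : ℝ) ≤ K := by exact_mod_cast hk
  refine le_trans (ENNReal.ofReal_le_ofReal ?_) (gaussianReal_Icc_ge ha (Real.exp_pos _))
  have hsq : √a ≤ Real.exp (C / 2 - (α + 1 / 2) * k) := by
    rw [Real.sqrt_le_left (Real.exp_pos _).le]
    refine ha2.trans (le_of_eq ?_)
    rw [← Real.exp_add, ← Real.exp_nat_mul]; congr 1; push_cast; ring
  have h2 : (2 : ℝ) ≤ Real.exp 1 := by linarith [Real.add_one_le_exp (1 : ℝ)]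
  have h1 : Real.exp (-(C + 1) - (α + 1 / 2) * ((K : ℝ) - k)) ≤
      Real.exp (-(α + 1 / 2) * K) / (2 * √a) := by
    rw [le_div_iff₀ (mul_pos two_pos (Real.sqrt_pos.2 ha))]
    calc _ ≤ Real.exp (-(C + 1) - (α + 1 / 2) * ((K : ℝ) - k)) *
          (Real.exp 1 * Real.exp (C / 2 - (α + 1 / 2) * k)) := by gcongr
      _ = Real.exp (-C / 2 - (α + 1 / 2) * K) := by
          rw [← Real.exp_add, ← Real.exp_add]; congr 1; ring
      _ ≤ _ := Real.exp_le_exp.2 (by linarith)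
  have h3 : -(Real.exp C * (Real.exp ((2 * α + 1) * k) * x ^ 2) + Real.exp C) ≤
      -(x ^ 2 + Real.exp (-(α + 1 / 2) * K) ^ 2) / a := by
    rw [neg_div, neg_le_neg_iff, div_le_iff₀ ha]
    have e1 : Real.exp C * Real.exp ((2 * α + 1) * k) *
        (Real.exp (-C) * Real.exp (-(2 * α + 1) * k)) = 1 := by
      rw [← Real.exp_add, ← Real.exp_add, ← Real.exp_add, ← Real.exp_zero]; congr 1; ring
    have h4 : 1 ≤ Real.exp C * Real.exp ((2 * α + 1) * k) * a := by
      refine e1.symm.le.trans (mul_le_mul_of_nonneg_left ha1 (by positivity))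
    have h5 : Real.exp (-(α + 1 / 2) * K) ^ 2 ≤ Real.exp C * a := by
      calc Real.exp (-(α + 1 / 2) * K) ^ 2 ≤ Real.exp (-(2 * α + 1) * k) := by
            rw [← Real.exp_nat_mul]; refine Real.exp_le_exp.2 ?_; push_cast; nlinarith
        _ = Real.exp C * (Real.exp (-C) * Real.exp (-(2 * α + 1) * k)) := by
            rw [← mul_assoc, ← Real.exp_add]; simp
        _ ≤ _ := mul_le_mul_of_nonneg_left ha1 (by positivity)
    nlinarith [mul_le_mul_of_nonneg_right h4 (sq_nonneg x)]
  calc _ = Real.exp (-(C + 1) - (α + 1 / 2) * ((K : ℝ) - k)) *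
        Real.exp (-(Real.exp C * (Real.exp ((2 * α + 1) * k) * x ^ 2) + Real.exp C)) := by
        rw [← Real.exp_add]; congr 1; ring
    _ ≤ _ := mul_le_mul h1 (Real.exp_le_exp.2 h3) (Real.exp_pos _).le (by positivity)

theorem measurableSet_priorNhd_right (α η : ℝ) (K : ℕ) :
    MeasurableSet[⨆ i ∈ (headIndices K : Set ℕ+)ᶜ, MeasurableSpace.comap
      (fun x : ℕ+ → ℝ => x i) inferInstance]
      {θ : ℕ+ → ℝ | ∑' j : {j // j ∉ headIndices K}, ENNReal.ofReal
        (Real.exp (2 * α * K) * ((j : ℕ+) : ℝ) ^ 2 * θ j ^ 2) ≤ ENNReal.ofReal η} := by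
  refine (measurable_tsum_of_mem (J := {j // j ∉ headIndices K})
    (S := (headIndices K : Set ℕ+)ᶜ) (fun j => (j : ℕ+)) (fun j => j.2)
    (w := fun j x => ENNReal.ofReal (Real.exp (2 * α * K) * ((j : ℕ+) : ℝ) ^ 2 * x ^ 2))
    fun j => by fun_prop) measurableSet_Iic

theorem measurableSet_priorNhd (α η : ℝ) (θ₀ : ℕ+ → ℝ) (K : ℕ) :
    MeasurableSet (priorNhd α η θ₀ K) := by
  refine (MeasurableSet.pi (headIndices K).countable_toSet fun j _ => measurableSet_Icc).inter ?_
  refine measurableSet_le (measurable_tail K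
    (w := fun j x => ENNReal.ofReal (Real.exp (2 * α * K) * (j : ℝ) ^ 2 * x ^ 2))
    fun j => by fun_prop) measurable_const

/-- Conditionally on scales of the right size, the prior neighbourhood has large mass. -/
theorem gaussianGivenScales_priorNhd_ge {α C Q η : ℝ} (hα : 0 < α) (hC : 0 < C) (hη : 0 < η)
    {θ₀ : ℕ+ → ℝ} (h₀ : IsSobolevSeq α Q θ₀) {K : ℕ} {A : ℕ → ℝ}
    (hA : ∀ k ≤ K, Real.exp (-C) * Real.exp (-(2 * α + 1) * k) ≤ A k ∧
        A k ≤ Real.exp C * Real.exp (-(2 * α + 1) * k))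
    (hT : ∑' j : {j // j ∉ headIndices K}, ENNReal.ofReal
      (Real.exp (2 * α * K) * ((j : ℕ+) : ℝ) ^ 2) * ENNReal.ofReal (A (blockIndex (j : ℕ+))) ≤
        ENNReal.ofReal (η / 2)) :
    ENNReal.ofReal (Real.exp (-((C + 1 + Real.exp C + (α + 1 / 2)) * Real.exp 1 +
      Real.exp C * ((2 : ℝ) ^ (2 * α) * Q ^ 2)) * Real.exp K)) * 2⁻¹ ≤
      gaussianGivenScales A (priorNhd α η θ₀ K) := by
  rw [priorNhd, gaussianGivenScales, infinitePi_pi_inter _ _ (fun _ => measurableSet_Icc)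
    (measurableSet_priorNhd_right α η K)]
  refine mul_le_mul' ?_ ?_
  · have h1 : ∀ j ∈ headIndices K, ENNReal.ofReal (Real.exp (-((C + 1 + Real.exp C) +
        (α + 1 / 2) * ((K : ℝ) - blockIndex j) +
          Real.exp C * (Real.exp ((2 * α + 1) * blockIndex j) * θ₀ j ^ 2)))) ≤
        gaussianReal 0 (A (blockIndex j)).toNNReal
          (Set.Icc (θ₀ j - Real.exp (-(α + 1 / 2) * K)) (θ₀ j + Real.exp (-(α + 1 / 2) * K))) :=
      fun j hj => gaussianReal_block_ge hα hC (mem_headIndices.1 hj)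
        (hA _ (mem_headIndices.1 hj)).1 (hA _ (mem_headIndices.1 hj)).2 _
    -- Multiplied over the head, the three terms of the exponent are of order `e^K` by
    -- `card_headIndices_le`, `sum_headIndices_sub_le` and `sum_exp_mul_sq_le`.
    refine le_trans ?_ (Finset.prod_le_prod' h1)
    rw [← ENNReal.ofReal_prod_of_nonneg fun _ _ => (Real.exp_pos _).le, ← Real.exp_sum]
    refine ENNReal.ofReal_le_ofReal (Real.exp_le_exp.2 ?_)
    rw [Finset.sum_neg_distrib, Finset.sum_add_distrib, Finset.sum_add_distrib, Finset.sum_const,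
      ← Finset.mul_sum, ← Finset.mul_sum, nsmul_eq_mul, neg_mul, neg_le_neg_iff]
    have h2 := card_headIndices_le K
    have h3 := sum_headIndices_sub_le K
    have h4 := sum_exp_mul_sq_le hα.le h₀ K
    rw [Real.exp_add] at h2 h3
    have h5 : 0 < C + 1 + Real.exp C := by positivity
    nlinarith [mul_le_mul_of_nonneg_right h2 h5.le,
      mul_le_mul_of_nonneg_left h3 (by positivity : 0 ≤ α + 1 / 2),
      mul_le_mul_of_nonneg_left h4 (Real.exp_pos C).le]
  · set W : (ℕ+ → ℝ) → ℝ≥0∞ := fun θ => ∑' j : {j // j ∉ headIndices K}, ENNReal.ofReal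
        (Real.exp (2 * α * K) * ((j : ℕ+) : ℝ) ^ 2 * θ j ^ 2) with hW
    have hWm : Measurable W := measurable_tail K
      (w := fun j x => ENNReal.ofReal (Real.exp (2 * α * K) * (j : ℝ) ^ 2 * x ^ 2))
      fun j => by fun_prop
    have hWi : ∫⁻ θ, W θ ∂(gaussianGivenScales A) ≤ ENNReal.ofReal (η / 2) := by
      rw [hW, lintegral_tsum fun j => Measurable.aemeasurable (by fun_prop)]
      refine le_trans (ENNReal.tsum_le_tsum fun j => ?_) hT
      rw [lintegral_gaussianGivenScales_eval A (j : ℕ+) (f := fun x =>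
        ENNReal.ofReal (Real.exp (2 * α * K) * ((j : ℕ+) : ℝ) ^ 2 * x ^ 2)) (by fun_prop)]
      simp_rw [ENNReal.ofReal_mul (by positivity : 0 ≤ Real.exp (2 * α * K) * ((j : ℕ+) : ℝ) ^ 2)]
      rw [lintegral_const_mul _ (by fun_prop), lintegral_sq_gaussianReal]
      exact le_of_eq rfl
    -- Markov's inequality: given the scales, the weighted tail has mean at most `η / 2`.
    have hmk : gaussianGivenScales A {θ | ENNReal.ofReal η ≤ W θ} ≤ 2⁻¹ := by
      refine (meas_ge_le_lintegral_div hWm.aemeasurable (by simpa using hη)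
        ENNReal.ofReal_ne_top).trans ?_
      refine ENNReal.div_le_of_le_mul (hWi.trans (le_of_eq ?_))
      rw [div_eq_inv_mul, ENNReal.ofReal_mul (by norm_num), ENNReal.ofReal_inv_of_pos (by norm_num)]
      simp
    have hc : {θ | W θ ≤ ENNReal.ofReal η}ᶜ ⊆ {θ | ENNReal.ofReal η ≤ W θ} := fun θ hθ => by
      simp only [Set.mem_compl_iff, Set.mem_ofPred_eq, not_le] at hθ
      exact hθ.le
    have hmeas : MeasurableSet {θ | W θ ≤ ENNReal.ofReal η} :=
      measurableSet_le hWm measurable_const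
    change 2⁻¹ ≤ gaussianGivenScales A {θ | W θ ≤ ENNReal.ofReal η}
    have h1 := prob_add_prob_compl (μ := gaussianGivenScales A) hmeas
    have h2 := (measure_mono hc).trans hmk
    by_contra! hlt
    have : (1 : ℝ≥0∞) < 2⁻¹ + 2⁻¹ := by
      rw [← h1]; exact ENNReal.add_lt_add_of_lt_of_le (by finiteness) hlt h2
    rw [ENNReal.inv_two_add_inv_two] at this
    exact lt_irrefl _ this

theorem IsMixing.exists_priorNhd_ge (hg : IsMixing g) {α : ℝ} (hα : 0 < α) (Q : ℝ) {η : ℝ}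
    (hη : 0 < η) : ∃ C > 0, ∀ᶠ K : ℕ in atTop, ∀ θ₀, IsSobolevSeq α Q θ₀ → θ₀ 1 = 0 →
      ENNReal.ofReal (Real.exp (-C * Real.exp K)) ≤ centredBlockPrior g (priorNhd α η θ₀ K) := by
  obtain ⟨C, hC, I, hIm, hIl, hIb⟩ := hg.exists_scale_sets hα
  obtain ⟨c₂, hc₂, hmean⟩ := hg.mean_bound
  set C₁ := (C + 1 + Real.exp C + (α + 1 / 2)) * Real.exp 1 +
      Real.exp C * ((2 : ℝ) ^ (2 * α) * Q ^ 2) with hC₁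
  have hC₁0 : 0 ≤ C₁ := by positivity
  refine ⟨C₁ + 2 + 2 * C * Real.exp 1, by positivity, ?_⟩
  have hsum : Summable fun j : ℕ+ => 4 * Real.exp 2 *
      Real.exp ((2 * α + 2) * blockIndex j - c₂ * (blockIndex j : ℝ) ^ 2) :=
    (summable_exp_blockIndex _ hc₂).mul_left _
  have ht := tendsto_tsum_tail hsum fun j => by positivity
  filter_upwards [ht.eventually_le_const (u := ENNReal.ofReal (η / 4))
    (by simpa using hη)] with K hK θ₀ h₀ h01
  -- Resetting the first coordinate to `0 = θ₀ 1` moves it to the centre of its interval and leaves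
  -- the tail untouched.
  have hsub : priorNhd α η θ₀ K ⊆
      (fun θ : ℕ+ → ℝ => Function.update θ 1 0) ⁻¹' priorNhd α η θ₀ K := by
    rintro θ ⟨h1, h2⟩
    refine ⟨fun j hj => ?_, ?_⟩
    · by_cases hj1 : j = 1
      · subst hj1
        simp only [Function.update_self, h01]
        constructor <;> linarith [Real.exp_pos (-(α + 1 / 2) * K)]
      · simp only [Function.update_of_ne hj1]
        exact h1 j hj
    · simpa only [Set.mem_ofPred_eq, update_one_of_not_mem] using h2
  rw [centredBlockPrior, Measure.map_apply measurable_update_one (measurableSet_priorNhd ..)]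
  refine le_trans ?_ (measure_mono hsub)
  rw [blockPrior_apply (measurableSet_priorNhd ..)]
  have hp := hg.isProbabilityMeasure
  have hps := hg.isProbabilityMeasure_scaleLaw
  set w : (ℕ → ℝ) → ℝ≥0∞ := fun A => ∑' j : {j // j ∉ headIndices K}, ENNReal.ofReal
      (Real.exp (2 * α * K) * ((j : ℕ+) : ℝ) ^ 2) * ENNReal.ofReal (A (blockIndex (j : ℕ+))) with hw
  have hwm' : Measurable[⨆ i ∈ (Finset.range (K + 1) : Set ℕ)ᶜ, MeasurableSpace.comap
      (fun x : ℕ → ℝ => x i) inferInstance] w :=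
    measurable_tsum_of_mem (J := {j // j ∉ headIndices K})
      (S := (Finset.range (K + 1) : Set ℕ)ᶜ) (fun j => blockIndex (j : ℕ+))
      (fun j => by
        have := not_mem_headIndices.1 j.2
        simp only [Set.mem_compl_iff, Finset.mem_coe, Finset.mem_range]; omega)
      (w := fun j x => ENNReal.ofReal (Real.exp (2 * α * K) * ((j : ℕ+) : ℝ) ^ 2) *
        ENNReal.ofReal x) fun j => by fun_prop
  have hwm : Measurable w := Measurable.tsum fun j => by fun_prop
  set T := {A : ℕ → ℝ | w A ≤ ENNReal.ofReal (η / 2)} with hT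
  -- The mean bound `4 e^{-c₂ k²}` beats the weights `e^{2αK} j²`. The mean `η / 4` lets Markov's
  -- inequality give probability at least one half to the event `T`, on which the conditional tail
  -- mean is at most `η / 2`.
  have hwi : ∫⁻ A, w A ∂(scaleLaw g) ≤ ENNReal.ofReal (η / 4) := by
    rw [hw, lintegral_tsum fun j => Measurable.aemeasurable (by fun_prop)]
    refine le_trans (ENNReal.tsum_le_tsum fun j => ?_) hK
    rw [hg.lintegral_scaleLaw_eval (blockIndex (j : ℕ+)) (f := fun x => ENNReal.ofReal
      (Real.exp (2 * α * K) * ((j : ℕ+) : ℝ) ^ 2) * ENNReal.ofReal x) (by fun_prop),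
      lintegral_const_mul _ (by fun_prop), hg.lintegral_scaleMeasure]
    refine (mul_le_mul_right (hmean _) _).trans ?_
    rw [← ENNReal.ofReal_mul (by positivity)]
    refine ENNReal.ofReal_le_ofReal ?_
    have hj := lt_exp_blockIndex_add_one (j : ℕ+)
    have hjK : (K : ℝ) ≤ blockIndex (j : ℕ+) := by
      exact_mod_cast (not_mem_headIndices.1 j.2).le
    have h1 : Real.exp (2 * α * K) * ((j : ℕ+) : ℝ) ^ 2 ≤
        Real.exp (2 * α * blockIndex (j : ℕ+)) * Real.exp (blockIndex (j : ℕ+) + 1) ^ 2 := by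
      gcongr
    refine (mul_le_mul_of_nonneg_right h1 (by positivity)).trans (le_of_eq ?_)
    have e : Real.exp (2 * α * blockIndex (j : ℕ+)) * Real.exp (blockIndex (j : ℕ+) + 1) ^ 2 *
        Real.exp (-c₂ * (blockIndex (j : ℕ+) : ℝ) ^ 2) = Real.exp 2 *
        Real.exp ((2 * α + 2) * blockIndex (j : ℕ+) - c₂ * (blockIndex (j : ℕ+) : ℝ) ^ 2) := by
      rw [← Real.exp_nat_mul, ← Real.exp_add, ← Real.exp_add, ← Real.exp_add]
      congr 1; push_cast; ring
    linear_combination 4 * e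
  have hTp : 2⁻¹ ≤ scaleLaw g T := by
    have hmk : scaleLaw g {A | ENNReal.ofReal (η / 2) ≤ w A} ≤ 2⁻¹ := by
      refine (meas_ge_le_lintegral_div hwm.aemeasurable (by simpa using hη)
        ENNReal.ofReal_ne_top).trans ?_
      refine ENNReal.div_le_of_le_mul (hwi.trans (le_of_eq ?_))
      rw [show η / 4 = 2⁻¹ * (η / 2) by ring, ENNReal.ofReal_mul (by norm_num),
        ENNReal.ofReal_inv_of_pos (by norm_num)]
      simp
    have hc : Tᶜ ⊆ {A | ENNReal.ofReal (η / 2) ≤ w A} := fun A hA => by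
      simp only [hT, Set.mem_compl_iff, Set.mem_ofPred_eq, not_le] at hA
      exact hA.le
    have h1 := prob_add_prob_compl (μ := scaleLaw g)
      (measurableSet_le hwm measurable_const : MeasurableSet T)
    have h2 := (measure_mono hc).trans hmk
    by_contra! hlt
    have : (1 : ℝ≥0∞) < 2⁻¹ + 2⁻¹ := by
      rw [← h1]; exact ENNReal.add_lt_add_of_lt_of_le (by finiteness) hlt h2
    rw [ENNReal.inv_two_add_inv_two] at this
    exact lt_irrefl _ this
  set H := (Finset.range (K + 1) : Set ℕ).pi I with hH
  -- `H` concerns the scales of the blocks `0, …, K` and `T` only the later ones.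
  have hHT : scaleLaw g (H ∩ T) = (∏ k ∈ Finset.range (K + 1), scaleMeasure g k (I k)) *
      scaleLaw g T :=
    infinitePi_pi_inter (fun k => scaleMeasure g k) _ hIm (hwm' measurableSet_Iic)
  have hHTm : MeasurableSet (H ∩ T) :=
    (MeasurableSet.pi (Finset.range (K + 1)).countable_toSet fun k _ => hIm k).inter
      (measurableSet_le hwm measurable_const)
  have hHp : ENNReal.ofReal (Real.exp (-(2 * C * Real.exp 1) * Real.exp K)) ≤
      ∏ k ∈ Finset.range (K + 1), scaleMeasure g k (I k) := by
    refine le_trans ?_ (Finset.prod_le_prod' fun k _ => hIl k)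
    rw [← ENNReal.ofReal_prod_of_nonneg fun _ _ => (Real.exp_pos _).le, ← Real.exp_sum]
    refine ENNReal.ofReal_le_ofReal (Real.exp_le_exp.2 ?_)
    rw [← Finset.mul_sum, Finset.sum_range_succ]
    have h1 := sum_exp_le K
    have h2 : ∑ k ∈ Finset.range K, Real.exp k ≤ ∑ k ∈ Finset.range K, Real.exp ((k : ℝ) + 1) :=
      Finset.sum_le_sum fun k _ => Real.exp_le_exp.2 (by linarith)
    have h3 : Real.exp K ≤ Real.exp (K + 1) := Real.exp_le_exp.2 (by linarith)
    have e : Real.exp ((K : ℝ) + 1) = Real.exp 1 * Real.exp K := by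
      rw [← Real.exp_add]; ring_nf
    rw [e] at h1 h3
    nlinarith [mul_le_mul_of_nonneg_left (add_le_add (h2.trans h1) h3) hC.le]
  -- The two factors one half from Markov's inequality are absorbed into the exponent; they account
  -- for the summand `2` in the constant.
  have hhalf : ENNReal.ofReal (Real.exp (-1 * Real.exp K)) ≤ 2⁻¹ := by
    rw [show (2⁻¹ : ℝ≥0∞) = ENNReal.ofReal 2⁻¹ by
      rw [ENNReal.ofReal_inv_of_pos (by norm_num)]; simp]
    refine ENNReal.ofReal_le_ofReal ?_
    rw [neg_one_mul, Real.exp_neg]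
    refine inv_anti₀ (by norm_num) ?_
    have h1 : (1 : ℝ) ≤ Real.exp K := Real.one_le_exp (by positivity)
    linarith [Real.add_one_le_exp (Real.exp (K : ℝ))]
  calc ENNReal.ofReal (Real.exp (-(C₁ + 2 + 2 * C * Real.exp 1) * Real.exp K))
      = (ENNReal.ofReal (Real.exp (-C₁ * Real.exp K)) *
          ENNReal.ofReal (Real.exp (-1 * Real.exp K))) *
        (ENNReal.ofReal (Real.exp (-(2 * C * Real.exp 1) * Real.exp K)) *
          ENNReal.ofReal (Real.exp (-1 * Real.exp K))) := by
        rw [← ENNReal.ofReal_mul (Real.exp_pos _).le, ← ENNReal.ofReal_mul (Real.exp_pos _).le,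
          ← ENNReal.ofReal_mul (by positivity), ← Real.exp_add, ← Real.exp_add, ← Real.exp_add]
        congr 2; ring
    _ ≤ (ENNReal.ofReal (Real.exp (-C₁ * Real.exp K)) * 2⁻¹) *
        ((∏ k ∈ Finset.range (K + 1), scaleMeasure g k (I k)) * scaleLaw g T) := by
        gcongr
        exact hhalf.trans hTp
    _ = ∫⁻ _ in H ∩ T, ENNReal.ofReal (Real.exp (-C₁ * Real.exp K)) * 2⁻¹ ∂(scaleLaw g) := by
        rw [setLIntegral_const, hHT]
    _ ≤ ∫⁻ A in H ∩ T, gaussianGivenScales A (priorNhd α η θ₀ K) ∂(scaleLaw g) := by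
        refine setLIntegral_mono' hHTm fun A hA => ?_
        refine gaussianGivenScales_priorNhd_ge hα hC hη h₀ (fun k hk => ?_) hA.2
        exact hIb k _ (hA.1 k (by simpa using Nat.lt_succ_of_le hk))
    _ ≤ _ := setLIntegral_le_lintegral _ _

end BlockPrior

namespace BlockPrior

/-! ### Separated sets in finite dimension -/

section Packing

variable {E : Type*} [NormedAddCommGroup E] [NormedSpace ℝ E] [FiniteDimensional ℝ E]

/-- Volume comparison: the balls of radius `σ / 2` around the points are disjoint and lie in the
ball of radius `ρ + σ / 2`. -/
theorem card_le_of_separated {ρ σ : ℝ} (hρ : 0 ≤ ρ) (hσ : 0 < σ) (s : Finset E)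
    (hs : ∀ c ∈ s, ‖c‖ ≤ ρ) (h : ∀ c ∈ s, ∀ d ∈ s, c ≠ d → σ ≤ ‖c - d‖) :
    (s.card : ℝ) ≤ (1 + 2 * ρ / σ) ^ Module.finrank ℝ E := by
  borelize E
  let μ : Measure E := Measure.addHaar
  have hσ2 : 0 < σ / 2 := half_pos hσ
  have hR : 0 < ρ + σ / 2 := by linarith
  set A := ⋃ c ∈ s, Metric.ball (c : E) (σ / 2) with hA
  have D : Set.Pairwise (s : Set E) (Function.onFun Disjoint fun c => Metric.ball c (σ / 2)) := by
    rintro c hc d hd hcd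
    apply Metric.ball_disjoint_ball
    rw [dist_eq_norm]
    linarith [h c hc d hd hcd]
  have hsub : A ⊆ Metric.ball (0 : E) (ρ + σ / 2) := by
    refine Set.iUnion₂_subset fun x hx => Metric.ball_subset_ball' ?_
    rw [dist_zero_right]
    linarith [hs x hx]
  have I : (s.card : ℝ≥0∞) * ENNReal.ofReal ((σ / 2) ^ Module.finrank ℝ E) * μ (Metric.ball 0 1) ≤
      ENNReal.ofReal ((ρ + σ / 2) ^ Module.finrank ℝ E) * μ (Metric.ball 0 1) :=
    calc
      _ = μ A := by
        rw [hA, measure_biUnion_finset D fun c _ => measurableSet_ball]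
        simp only [μ.addHaar_ball_of_pos _ hσ2]
        simp only [Finset.sum_const, nsmul_eq_mul, mul_assoc]
      _ ≤ μ (Metric.ball (0 : E) (ρ + σ / 2)) := measure_mono hsub
      _ = _ := by simp only [μ.addHaar_ball_of_pos _ hR]
  have J := (ENNReal.mul_le_mul_iff_left (Metric.measure_ball_pos _ _ zero_lt_one).ne'
    measure_ball_lt_top.ne).1 I
  have K := ENNReal.toReal_le_of_le_ofReal (pow_nonneg hR.le _) J
  rw [ENNReal.toReal_mul, ENNReal.toReal_natCast, ENNReal.toReal_ofReal (by positivity)] at K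
  have e : 1 + 2 * ρ / σ = (ρ + σ / 2) / (σ / 2) := by field_simp; ring
  rwa [e, div_pow, le_div_iff₀ (by positivity)]

/-- A separated set of maximal cardinality is a net. Working with points of `S` and not of `E` keeps
the net inside `S`, so net points of a shell are admissible, satisfy the sieve bound and have the
distance to the truth that the shell prescribes. -/
theorem exists_finset_cover {X : Type*} (p : X → E) (S : Set X) {ρ σ : ℝ} (hρ : 0 ≤ ρ)
    (hσ : 0 < σ) (hS : ∀ x ∈ S, ‖p x‖ ≤ ρ) :
    ∃ t : Finset X, (∀ x ∈ t, x ∈ S) ∧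
      (t.card : ℝ) ≤ (1 + 2 * ρ / σ) ^ Module.finrank ℝ E ∧
      ∀ x ∈ S, ∃ y ∈ t, ‖p x - p y‖ < σ := by
  classical
  set V : Set (Finset X) := {t | (∀ x ∈ t, x ∈ S) ∧ ∀ x ∈ t, ∀ y ∈ t, x ≠ y → σ ≤ ‖p x - p y‖}
  have hbound (t : Finset X) (ht : t ∈ V) :
      (t.card : ℝ) ≤ (1 + 2 * ρ / σ) ^ Module.finrank ℝ E := by
    have hinj : Set.InjOn p t := by
      intro x hx y hy hxy
      by_contra hne
      have := ht.2 x hx y hy hne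
      rw [hxy, sub_self, norm_zero] at this
      linarith
    rw [← Finset.card_image_of_injOn hinj]
    refine card_le_of_separated hρ hσ _ ?_ ?_
    · simp only [Finset.mem_image, forall_exists_index, and_imp]
      rintro _ x hx rfl
      exact hS x (ht.1 x hx)
    · simp only [Finset.mem_image, forall_exists_index, and_imp]
      rintro _ x hx rfl _ y hy rfl hne
      exact ht.2 x hx y hy fun h => hne (by rw [h])
  obtain ⟨N, hN⟩ := exists_nat_ge ((1 + 2 * ρ / σ) ^ Module.finrank ℝ E)
  have hfin : (Finset.card '' V).Finite := (Set.finite_Iic N).subset <| by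
    rintro _ ⟨t, ht, rfl⟩
    exact_mod_cast (hbound t ht).trans hN
  obtain ⟨t, ht, hmax⟩ := Set.exists_max_image (Finset.card '' V) id hfin
    ⟨0, ∅, ⟨by simp, by simp⟩, rfl⟩
  obtain ⟨t, htV, rfl⟩ := ht
  refine ⟨t, htV.1, hbound t htV, fun x hx => ?_⟩
  by_contra! hcon
  have hxt : x ∉ t := fun h => by
    have := hcon x h
    rw [sub_self, norm_zero] at this
    linarith
  have hV : insert x t ∈ V := by
    refine ⟨fun y hy => ?_, fun y hy z hz hne => ?_⟩
    · rcases Finset.mem_insert.1 hy with rfl | hy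
      · exact hx
      · exact htV.1 y hy
    · rcases Finset.mem_insert.1 hy with hy | hy <;> rcases Finset.mem_insert.1 hz with hz | hz
      · exact absurd (hy.trans hz.symm) hne
      · rw [hy]; exact hcon z hz
      · rw [hz, norm_sub_rev]; exact hcon y hy
      · exact htV.2 y hy z hz hne
  have := hmax _ ⟨_, hV, rfl⟩
  rw [Finset.card_insert_of_notMem hxt] at this
  simp at this

end Packing

/-! ### A bound for posterior probabilities -/

theorem one_le_add_inv (z : ℝ≥0∞) : 1 ≤ z + z⁻¹ := by
  rcases le_total 1 z with h | h
  · exact h.trans le_self_add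
  · exact (ENNReal.one_le_inv.2 h).trans le_add_self

/-- Expected posterior mass of a set that is covered, up to a set `F` of small prior mass, by cells
`U i` that are separated from the truth by the weights `T i`. -/
theorem lintegral_posterior_le {Ω Θ I : Type*} [MeasurableSpace Ω] [MeasurableSpace Θ]
    [Countable I] {P : Measure Ω} [SFinite P] {Pr : Measure Θ} [IsProbabilityMeasure Pr]
    {L : Ω → Θ → ℝ≥0∞} (hL : Measurable (Function.uncurry L)) (hL1 : ∀ᵐ θ ∂Pr, ∫⁻ x, L x θ ∂P ≤ 1)
    {N F S : Set Θ} (hN : MeasurableSet N) (hF : MeasurableSet F)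
    {U : I → Set Θ} (hU : ∀ i, MeasurableSet (U i)) (hS : S ⊆ F ∪ ⋃ i, U i)
    {l q c : ℝ≥0∞} (hl : ∀ θ ∈ N, ∫⁻ x, (L x θ)⁻¹ ∂P ≤ l) (hq : q ≤ Pr N) (hq0 : q ≠ 0)
    (hc0 : c ≠ 0) (hc : c ≠ ∞)
    {T : I → Ω → ℝ≥0∞} (hTm : ∀ i, Measurable (T i))
    {a : I → ℝ≥0∞} (hT : ∀ i, ∫⁻ x, T i x ∂P ≤ a i)
    (hLT : ∀ i, ∀ θ ∈ U i, ∫⁻ x, (T i x)⁻¹ * L x θ ∂P ≤ a i) :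
    ∫⁻ x, (∫⁻ θ in S, L x θ ∂Pr) / (∫⁻ θ, L x θ ∂Pr) ∂P ≤
      2 * c⁻¹ * q⁻¹ * l + (2 * c * q⁻¹) * Pr F + (1 + 2 * c * q⁻¹) * ∑' i, a i := by
  have hq1 : q ≠ ∞ := ne_top_of_le_ne_top ENNReal.one_ne_top (hq.trans prob_le_one)
  set b : ℝ≥0∞ := 2 * c * q⁻¹ with hb
  have hLx (x : Ω) : Measurable (L x) := hL.comp measurable_prodMk_left
  have hLs (A : Set Θ) : Measurable fun x => ∫⁻ θ in A, L x θ ∂Pr :=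
    Measurable.lintegral_prod_right' (f := Function.uncurry L) hL
  have hLi : Measurable fun x => ∫⁻ θ in N, (L x θ)⁻¹ ∂Pr :=
    Measurable.lintegral_prod_right' (f := fun z : Ω × Θ => (L z.1 z.2)⁻¹) hL.inv
  have hpt (x : Ω) : (∫⁻ θ in S, L x θ ∂Pr) / (∫⁻ θ, L x θ ∂Pr) ≤
      2 * c⁻¹ * q⁻¹ * ∫⁻ θ in N, (L x θ)⁻¹ ∂Pr + (b * ∫⁻ θ in F, L x θ ∂Pr +
        ∑' i, (T i x + b * ((T i x)⁻¹ * ∫⁻ θ in U i, L x θ ∂Pr))) := by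
    set Z := ∫⁻ θ, L x θ ∂Pr with hZ
    have hle1 (A : Set Θ) : (∫⁻ θ in A, L x θ ∂Pr) / Z ≤ 1 :=
      ENNReal.div_le_of_le_mul (by rw [one_mul]; exact setLIntegral_le_lintegral _ _)
    -- If the denominator is small, the posterior probability is at most one and the inverse
    -- likelihood on `N` must be large; otherwise `Z⁻¹` is at most the constant `b`. The set `S`
    -- need not be measurable, since only monotonicity and subadditivity of the integral over sets
    -- are used for it.
    rcases lt_or_ge (c * Z) (q / 2) with hbad | hgood
    · refine le_trans (hle1 S) (le_trans ?_ le_self_add)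
      -- Integrate `1 ≤ cL + (cL)⁻¹` over `N`. This replaces Jensen's inequality for the logarithm
      -- in the usual evidence bound.
      have h1 : q ≤ c * Z + c⁻¹ * ∫⁻ θ in N, (L x θ)⁻¹ ∂Pr := by
        calc q ≤ ∫⁻ θ in N, 1 ∂Pr := by simpa using hq
          _ ≤ ∫⁻ θ in N, (c * L x θ + c⁻¹ * (L x θ)⁻¹) ∂Pr := by
              refine lintegral_mono fun θ => ?_
              rw [← ENNReal.mul_inv (Or.inl hc0) (Or.inl hc)]
              exact one_le_add_inv _
          _ = c * ∫⁻ θ in N, L x θ ∂Pr + c⁻¹ * ∫⁻ θ in N, (L x θ)⁻¹ ∂Pr := by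
              rw [lintegral_add_left ((hLx x).const_mul c), lintegral_const_mul _ (hLx x),
                lintegral_const_mul c⁻¹ (f := fun θ => (L x θ)⁻¹) (hLx x).inv]
          _ ≤ _ := by gcongr; exact setLIntegral_le_lintegral _ _
      have h2 : q / 2 ≤ c⁻¹ * ∫⁻ θ in N, (L x θ)⁻¹ ∂Pr := by
        by_contra! hcon
        have := ENNReal.add_lt_add hbad hcon
        rw [ENNReal.add_halves] at this
        exact absurd h1 (not_le.2 this)
      calc (1 : ℝ≥0∞) = 2 * q⁻¹ * (q / 2) := by
            rw [mul_assoc, ← mul_div_assoc, ENNReal.inv_mul_cancel hq0 hq1, one_div,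
              ENNReal.mul_inv_cancel two_ne_zero ENNReal.ofNat_ne_top]
        _ ≤ 2 * q⁻¹ * (c⁻¹ * ∫⁻ θ in N, (L x θ)⁻¹ ∂Pr) := by gcongr
        _ = _ := by ring
    · refine le_trans ?_ le_add_self
      have hZb : Z⁻¹ ≤ b := by
        have h1 : q / (2 * c) ≤ Z := by
          refine ENNReal.div_le_of_le_mul ?_
          have := mul_le_mul_right hgood 2
          rw [ENNReal.mul_div_cancel two_ne_zero ENNReal.ofNat_ne_top] at this
          calc q ≤ 2 * (c * Z) := this
            _ = _ := by ring
        have h2 := ENNReal.inv_le_inv.2 h1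
        rwa [ENNReal.inv_div (Or.inl (by finiteness)) (Or.inl (by simp [hc0])),
          div_eq_mul_inv] at h2
      have hdiv (y : ℝ≥0∞) : y / Z ≤ b * y := by
        rw [div_eq_mul_inv, mul_comm]; gcongr
      calc (∫⁻ θ in S, L x θ ∂Pr) / Z
          ≤ (∫⁻ θ in F, L x θ ∂Pr + ∑' i, ∫⁻ θ in U i, L x θ ∂Pr) / Z := by
            gcongr
            refine (lintegral_mono_set hS).trans ((lintegral_union_le _ _ _).trans ?_)
            gcongr
            exact lintegral_iUnion_le _ _
        _ = (∫⁻ θ in F, L x θ ∂Pr) / Z + ∑' i, (∫⁻ θ in U i, L x θ ∂Pr) / Z := by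
            simp only [div_eq_mul_inv]
            rw [add_mul, ENNReal.tsum_mul_right]
        _ ≤ _ := by
            gcongr with i
            · exact hdiv _
            -- Each cell contributes at most one, hence at most `T` when `T ≥ 1`. When `T ≤ 1`, the
            -- bound on the cell may be multiplied by `T⁻¹ ≥ 1`.
            · rcases le_total 1 (T i x) with h | h
              · exact (hle1 _).trans (h.trans le_self_add)
              · refine ((hdiv _).trans ?_).trans le_add_self
                gcongr
                exact le_mul_of_one_le_left' (ENNReal.one_le_inv.2 h)
  refine (lintegral_mono hpt).trans ?_
  have hsw {A : Set Θ} {h : Ω → Θ → ℝ≥0∞} (hh : Measurable (Function.uncurry h)) :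
      ∫⁻ x, ∫⁻ θ in A, h x θ ∂Pr ∂P = ∫⁻ θ in A, ∫⁻ x, h x θ ∂P ∂Pr :=
    lintegral_lintegral_swap hh.aemeasurable
  have i1 : ∫⁻ x, ∫⁻ θ in N, (L x θ)⁻¹ ∂Pr ∂P ≤ l := by
    rw [hsw (h := fun x θ => (L x θ)⁻¹) hL.inv]
    calc _ ≤ ∫⁻ θ in N, l ∂Pr := setLIntegral_mono' hN hl
      _ ≤ l := by rw [setLIntegral_const]; exact mul_le_of_le_one_right' prob_le_one
  have i2 : ∫⁻ x, ∫⁻ θ in F, L x θ ∂Pr ∂P ≤ Pr F := by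
    rw [hsw hL]
    calc _ ≤ ∫⁻ θ in F, 1 ∂Pr :=
          setLIntegral_mono_ae' hF (hL1.mono fun θ h _ => h)
      _ = Pr F := by simp
  have i3 (i : I) : ∫⁻ x, (T i x)⁻¹ * ∫⁻ θ in U i, L x θ ∂Pr ∂P ≤ a i := by
    have hm : Measurable (Function.uncurry fun x θ => (T i x)⁻¹ * L x θ) :=
      ((hTm i).inv.comp measurable_fst).mul hL
    calc _ = ∫⁻ x, ∫⁻ θ in U i, (T i x)⁻¹ * L x θ ∂Pr ∂P := by
          congr 1; ext x; rw [lintegral_const_mul _ (hLx x)]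
      _ = ∫⁻ θ in U i, ∫⁻ x, (T i x)⁻¹ * L x θ ∂P ∂Pr := hsw hm
      _ ≤ ∫⁻ θ in U i, a i ∂Pr := setLIntegral_mono' (hU i) (hLT i)
      _ ≤ a i := by rw [setLIntegral_const]; exact mul_le_of_le_one_right' prob_le_one
  have m3 (i : I) : Measurable fun x => (T i x)⁻¹ * ∫⁻ θ in U i, L x θ ∂Pr :=
    (hTm i).inv.mul (hLs _)
  have m4 (i : I) : AEMeasurable (fun x => T i x + b * ((T i x)⁻¹ *
      ∫⁻ θ in U i, L x θ ∂Pr)) P := ((hTm i).add ((m3 i).const_mul b)).aemeasurable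
  rw [lintegral_add_left (hLi.const_mul _), lintegral_const_mul _ hLi,
    lintegral_add_left ((hLs F).const_mul _), lintegral_const_mul _ (hLs F),
    lintegral_tsum m4, add_assoc]
  gcongr
  rw [← ENNReal.tsum_mul_left]
  refine ENNReal.tsum_le_tsum fun i => ?_
  rw [lintegral_add_left (hTm i), lintegral_const_mul _ (m3 i), add_mul, one_mul]
  gcongr
  · exact hT i
  · exact i3 i

/-! ### Likelihood ratios -/

theorem IsBddBy.isProbabilityMeasure_expMeasure {R : ℝ} {f : ℝ → ℝ} (hf : IsBddBy R f) :
    IsProbabilityMeasure (expMeasure f) := by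
  refine ⟨?_⟩
  rw [expMeasure, withDensity_apply _ .univ, Measure.restrict_univ,
    ← ofReal_integral_eq_lintegral_ofReal hf.expDensity.integrable
      (Eventually.of_forall fun t => (hf.expDensity_pos t).le), hf.integral_expDensity,
    ENNReal.ofReal_one]

/-- Independence turns every expectation used below, of a likelihood ratio, its inverse or a
square-root ratio, into the `n`-th power of a one-dimensional integral. -/
theorem lintegral_sampleLaw_prod {R S : ℝ} {f u : ℝ → ℝ} (hf : IsBddBy R f) (hu : IsBddBy S u)
    (h0 : ∀ t, 0 ≤ u t) (n : ℕ) :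
    ∫⁻ x, ENNReal.ofReal (∏ i, u (x i)) ∂(sampleLaw f n) =
      ENNReal.ofReal ((∫ t, expDensity f t * u t ∂unitVolume) ^ n) := by
  have := hf.isProbabilityMeasure_expMeasure
  have hm : Measurable fun t => ENNReal.ofReal (u t) := hu.measurable.ennreal_ofReal
  have hind : iIndepFun (fun (i : Fin n) (x : Fin n → ℝ) => ENNReal.ofReal (u (x i)))
      (sampleLaw f n) :=
    iIndepFun_pi (X := fun _ t => ENNReal.ofReal (u t)) fun _ => hm.aemeasurable
  have h1 := lintegral_prod_eq_prod_lintegral_of_indepFun Finset.univ _ hind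
    fun i => hm.comp (measurable_pi_apply i)
  have h2 (i : Fin n) : ∫⁻ x, ENNReal.ofReal (u (x i)) ∂(sampleLaw f n) =
      ENNReal.ofReal (∫ t, expDensity f t * u t ∂unitVolume) := by
    have hmp := measurePreserving_eval (fun _ : Fin n => expMeasure f) i
    rw [sampleLaw, hmp.lintegral_comp hm, expMeasure,
      lintegral_withDensity_eq_lintegral_mul _ hf.expDensity.measurable.ennreal_ofReal hm,
      ofReal_integral_eq_lintegral_ofReal (hf.expDensity.mul hu).integrable
        (Eventually.of_forall fun t => mul_nonneg (hf.expDensity_pos t).le (h0 t))]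
    refine lintegral_congr fun t => ?_
    rw [Pi.mul_apply, ENNReal.ofReal_mul (hf.expDensity_pos t).le]
  simp_rw [h2] at h1
  simp_rw [ENNReal.ofReal_prod_of_nonneg fun i _ => h0 _]
  rw [h1, Finset.prod_const, Finset.card_univ, Fintype.card_fin, ENNReal.ofReal_pow]
  exact integral_nonneg fun t => mul_nonneg (hf.expDensity_pos t).le (h0 t)

theorem measurable_fourierSeries_uncurry :
    Measurable fun z : (ℕ+ → ℝ) × ℝ => fourierSeries z.1 z.2 := by
  refine Measurable.tsum fun j => Measurable.mul (by fun_prop) ?_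
  exact (continuous_trigBasis j).measurable.comp measurable_snd

theorem measurable_expDensity_uncurry :
    Measurable fun z : (ℕ+ → ℝ) × ℝ => expDensity (fourierSeries z.1) z.2 := by
  have h := measurable_fourierSeries_uncurry.exp
  refine h.div ?_
  exact (h.stronglyMeasurable.integral_prod_right' (ν := unitVolume)).measurable.comp measurable_fst

theorem measurable_likelihoodRatio {f₀ : ℝ → ℝ} (hf₀ : Measurable (expDensity f₀)) (n : ℕ) :
    Measurable (Function.uncurry fun (x : Fin n → ℝ) θ => likelihoodRatio f₀ x θ) := by
  refine Measurable.ennreal_ofReal (Finset.measurable_prod _ fun i _ => Measurable.div ?_ ?_)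
  · exact measurable_expDensity_uncurry.comp
      (measurable_snd.prodMk ((measurable_pi_apply i).comp measurable_fst))
  · exact hf₀.comp ((measurable_pi_apply i).comp measurable_fst)

section Ratios

variable {R : ℝ} {f₀ : ℝ → ℝ}

theorem lintegral_likelihoodRatio (h₀ : IsBddBy R f₀) {θ : ℕ+ → ℝ} (hθ : IsBddBy R (fourierSeries θ))
    (n : ℕ) :
    ∫⁻ x, likelihoodRatio f₀ x θ ∂(sampleLaw f₀ n) = 1 := by
  have hb : IsBddBy (Real.exp (2 * R) * Real.exp (2 * R)) fun t => expDensity (fourierSeries θ) t / expDensity f₀ t := by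
    simp_rw [div_eq_mul_inv]; exact hθ.expDensity.mul (inv_expDensity_isBddBy h₀)
  have := lintegral_sampleLaw_prod h₀ hb
    (fun t => div_nonneg (hθ.expDensity_pos t).le (h₀.expDensity_pos t).le) n
  simp only [likelihoodRatio]
  rw [this]
  simp_rw [mul_div_cancel₀ _ (h₀.expDensity_pos _).ne']
  rw [hθ.integral_expDensity, one_pow, ENNReal.ofReal_one]

theorem lintegral_inv_likelihoodRatio (h₀ : IsBddBy R f₀) {θ : ℕ+ → ℝ} (hθ : IsBddBy R (fourierSeries θ))
    (n : ℕ) :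
    ∫⁻ x, (likelihoodRatio f₀ x θ)⁻¹ ∂(sampleLaw f₀ n) = ENNReal.ofReal
      ((∫ t, expDensity f₀ t ^ 2 / expDensity (fourierSeries θ) t ∂unitVolume) ^ n) := by
  have hb : IsBddBy (Real.exp (2 * R) * Real.exp (2 * R)) fun t => expDensity f₀ t / expDensity (fourierSeries θ) t := by
    simp_rw [div_eq_mul_inv]; exact h₀.expDensity.mul (inv_expDensity_isBddBy hθ)
  have := lintegral_sampleLaw_prod h₀ hb
    (fun t => div_nonneg (h₀.expDensity_pos t).le (hθ.expDensity_pos t).le) n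
  have e (x : Fin n → ℝ) : (likelihoodRatio f₀ x θ)⁻¹ = ENNReal.ofReal
      (∏ i, expDensity f₀ (x i) / expDensity (fourierSeries θ) (x i)) := by
    rw [likelihoodRatio, ← ENNReal.ofReal_inv_of_pos (Finset.prod_pos fun i _ =>
      div_pos (hθ.expDensity_pos _) (h₀.expDensity_pos _)), ← Finset.prod_inv_distrib]
    simp_rw [inv_div]
  simp_rw [e]
  rw [this]
  simp_rw [mul_div_assoc', pow_two]

/-- The square root of the likelihood ratio of `f₁` and `f₀`. -/
noncomputable def sqrtRatio (f₀ f₁ : ℝ → ℝ) {n : ℕ} (x : Fin n → ℝ) : ℝ≥0∞ :=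
  ENNReal.ofReal (∏ i, √(expDensity f₁ (x i)) / √(expDensity f₀ (x i)))

theorem measurable_sqrtRatio {f₁ : ℝ → ℝ} (h₀ : Measurable (expDensity f₀))
    (h₁ : Measurable (expDensity f₁)) (n : ℕ) :
    Measurable (sqrtRatio f₀ f₁ : (Fin n → ℝ) → ℝ≥0∞) :=
  Measurable.ennreal_ofReal (Finset.measurable_prod _ fun i _ =>
    ((h₁.comp (measurable_pi_apply i)).sqrt.div (h₀.comp (measurable_pi_apply i)).sqrt))

theorem isBddBy_sqrt_div {f₁ : ℝ → ℝ} (h₀ : IsBddBy R f₀) (h₁ : IsBddBy R f₁) :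
    IsBddBy (Real.exp (2 * R) * (Real.exp (2 * R) * Real.exp (2 * R)))
      fun t => √(expDensity f₁ t) / √(expDensity f₀ t) := by
  have e : (fun t => √(expDensity f₁ t) / √(expDensity f₀ t)) = fun t =>
      √(expDensity f₁ t) * (√(expDensity f₀ t) * (expDensity f₀ t)⁻¹) := by
    ext t
    have hp := h₀.expDensity_pos t
    have hs := Real.sqrt_pos.2 hp
    have := Real.sq_sqrt hp.le
    rw [div_eq_mul_inv]; congr 1
    field_simp
    exact this.symm
  rw [e]
  exact h₁.sqrtDensity.mul (h₀.sqrtDensity.mul (inv_expDensity_isBddBy h₀))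

theorem lintegral_sqrtRatio {f₁ : ℝ → ℝ} (h₀ : IsBddBy R f₀) (h₁ : IsBddBy R f₁) (n : ℕ) :
    ∫⁻ x, sqrtRatio f₀ f₁ x ∂(sampleLaw f₀ n) =
      ENNReal.ofReal ((∫ t, √(expDensity f₀ t) * √(expDensity f₁ t) ∂unitVolume) ^ n) := by
  have := lintegral_sampleLaw_prod h₀ (isBddBy_sqrt_div h₀ h₁)
    (fun t => div_nonneg (Real.sqrt_nonneg _) (Real.sqrt_nonneg _)) n
  simp only [sqrtRatio]
  rw [this]
  congr 3; ext t
  have hs := Real.sqrt_pos.2 (h₀.expDensity_pos t)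
  have h2 := Real.sq_sqrt (h₀.expDensity_pos t).le
  rw [← h2, Real.sqrt_sq hs.le]
  field_simp

theorem lintegral_inv_sqrtRatio_mul {f₁ : ℝ → ℝ} (h₀ : IsBddBy R f₀) (h₁ : IsBddBy R f₁)
    {θ : ℕ+ → ℝ} (hθ : IsBddBy R (fourierSeries θ)) (n : ℕ) :
    ∫⁻ x, (sqrtRatio f₀ f₁ x)⁻¹ * likelihoodRatio f₀ x θ ∂(sampleLaw f₀ n) =
      ENNReal.ofReal ((∫ t, expDensity (fourierSeries θ) t *
        (√(expDensity f₀ t) / √(expDensity f₁ t)) ∂unitVolume) ^ n) := by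
  have hb := (isBddBy_sqrt_div h₁ h₀).mul (hθ.expDensity.mul (inv_expDensity_isBddBy h₀))
  have := lintegral_sampleLaw_prod h₀ hb (fun t => mul_nonneg
    (div_nonneg (Real.sqrt_nonneg _) (Real.sqrt_nonneg _))
    (mul_nonneg (hθ.expDensity_pos t).le (inv_nonneg.2 (h₀.expDensity_pos t).le))) n
  have e (x : Fin n → ℝ) : (sqrtRatio f₀ f₁ x)⁻¹ * likelihoodRatio f₀ x θ = ENNReal.ofReal
      (∏ i, √(expDensity f₀ (x i)) / √(expDensity f₁ (x i)) *
        (expDensity (fourierSeries θ) (x i) * (expDensity f₀ (x i))⁻¹)) := by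
    have hpos (i : Fin n) : 0 < √(expDensity f₁ (x i)) / √(expDensity f₀ (x i)) :=
      div_pos (Real.sqrt_pos.2 (h₁.expDensity_pos _)) (Real.sqrt_pos.2 (h₀.expDensity_pos _))
    rw [likelihoodRatio, sqrtRatio, ← ENNReal.ofReal_inv_of_pos (Finset.prod_pos fun i _ => hpos i),
      ← ENNReal.ofReal_mul (inv_nonneg.2 (Finset.prod_nonneg fun i _ => (hpos i).le)),
      ← Finset.prod_inv_distrib, ← Finset.prod_mul_distrib]
    simp_rw [inv_div, div_eq_mul_inv]
  simp_rw [e]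
  rw [this]
  congr 3; ext t
  have hp := h₀.expDensity_pos t
  field_simp

end Ratios

end BlockPrior

namespace BlockPrior

variable {g : ℕ → ℝ → ℝ}

/-! ### The constraint set -/

/-- Sequences in the constraint set with vanishing first coordinate. -/
def admissible (B : ℝ) : Set (ℕ+ → ℝ) := constraintSet B ∩ {θ | θ 1 = 0}

theorem measurableSet_constraintSet (B : ℝ) : MeasurableSet (constraintSet B) :=
  measurableSet_lt (Measurable.tsum fun j => by fun_prop) measurable_const

theorem measurableSet_admissible (B : ℝ) : MeasurableSet (admissible B) :=
  (measurableSet_constraintSet B).inter (measurableSet_eq_fun (by fun_prop) measurable_const)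

theorem summable_of_mem_constraintSet {B : ℝ} {θ : ℕ+ → ℝ} (h : θ ∈ constraintSet B) :
    Summable fun j => |θ j| := by
  have := ENNReal.summable_toReal (ne_top_of_lt h)
  simpa only [ENNReal.toReal_ofReal (abs_nonneg _)] using this

theorem tsum_le_of_mem_constraintSet {B : ℝ} {θ : ℕ+ → ℝ} (h : θ ∈ constraintSet B) :
    ∑' j, |θ j| ≤ B := by
  have h1 : ENNReal.ofReal (∑' j, |θ j|) < ENNReal.ofReal B := by
    rw [ENNReal.ofReal_tsum_of_nonneg (fun _ => abs_nonneg _) (summable_of_mem_constraintSet h)]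
    exact h
  exact (ENNReal.ofReal_lt_ofReal_iff'.1 h1).1.le

theorem isBddBy_of_mem_constraintSet {B : ℝ} {θ : ℕ+ → ℝ} (h : θ ∈ constraintSet B) :
    IsBddBy (√2 * B) (fourierSeries θ) :=
  isBddBy_fourierSeries (summable_of_mem_constraintSet h) (tsum_le_of_mem_constraintSet h)

/-! ### Distances between coefficient sequences -/

theorem ofReal_sqDist_eq {θ η : ℕ+ → ℝ} (hθ : Summable fun j => |θ j|)
    (hη : Summable fun j => |η j|) (K : ℕ) :
    ENNReal.ofReal (sqDist (fourierSeries θ) (fourierSeries η)) =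
      ∑ j ∈ headIndices K, ENNReal.ofReal ((θ j - η j) ^ 2) +
        ∑' j : {j // j ∉ headIndices K}, ENNReal.ofReal ((θ j - η j) ^ 2) := by
  have h := sqDist_fourierSeries hθ hη
  rw [← h.tsum_eq, ENNReal.ofReal_tsum_of_nonneg (fun _ => sq_nonneg _) h.summable]
  exact (ENNReal.sum_add_tsum_compl (headIndices K) _).symm

theorem tsum_tail_sub_sq_le {θ η : ℕ+ → ℝ} {K : ℕ} {a b : ℝ} (ha : 0 ≤ a) (hb : 0 ≤ b)
    (hθ : θ ∈ tailBall K a) (hη : η ∈ tailBall K b) :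
    ∑' j : {j // j ∉ headIndices K}, ENNReal.ofReal ((θ j - η j) ^ 2) ≤
      ENNReal.ofReal (2 * a + 2 * b) := by
  calc ∑' j : {j // j ∉ headIndices K}, ENNReal.ofReal ((θ j - η j) ^ 2)
      ≤ ∑' j : {j // j ∉ headIndices K},
        (2 * ENNReal.ofReal (θ j ^ 2) + 2 * ENNReal.ofReal (η j ^ 2)) := by
        refine ENNReal.tsum_le_tsum fun j => ?_
        rw [← ENNReal.ofReal_ofNat 2, ← ENNReal.ofReal_mul (by norm_num),
          ← ENNReal.ofReal_mul (by norm_num), ← ENNReal.ofReal_add (by positivity) (by positivity)]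
        exact ENNReal.ofReal_le_ofReal (by nlinarith [sq_nonneg (θ j + η j)])
    _ = 2 * ∑' j : {j // j ∉ headIndices K}, ENNReal.ofReal (θ j ^ 2) +
        2 * ∑' j : {j // j ∉ headIndices K}, ENNReal.ofReal (η j ^ 2) := by
        rw [ENNReal.tsum_add, ENNReal.tsum_mul_left, ENNReal.tsum_mul_left]
    _ ≤ 2 * ENNReal.ofReal a + 2 * ENNReal.ofReal b := by
        gcongr
        exacts [hθ, hη]
    _ = _ := by
        rw [ENNReal.ofReal_add (by positivity) (by positivity), ENNReal.ofReal_mul (by norm_num),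
          ENNReal.ofReal_mul (by norm_num), ENNReal.ofReal_ofNat]

theorem exp_le_of_not_mem {K : ℕ} (j : {j // j ∉ headIndices K}) :
    Real.exp K ≤ ((j : ℕ+) : ℝ) := by
  have h1 := exp_blockIndex_lt (j : ℕ+)
  have h2 : ((K : ℝ) + 1) ≤ blockIndex (j : ℕ+) := by exact_mod_cast not_mem_headIndices.1 j.2
  have h3 := (Real.exp_le_exp.2 h2).trans h1.le
  rw [Real.exp_add] at h3
  have h4 : (2 : ℝ) ≤ Real.exp 1 := by linarith [Real.add_one_le_exp (1 : ℝ)]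
  nlinarith [Real.exp_pos (K : ℝ)]

theorem IsSobolevSeq.mem_tailBall {α Q : ℝ} (hα : 0 ≤ α) {θ : ℕ+ → ℝ} (h : IsSobolevSeq α Q θ)
    (K : ℕ) : θ ∈ tailBall K (Q ^ 2 * Real.exp (-2 * α * K)) := by
  have hle (j : {j // j ∉ headIndices K}) : ENNReal.ofReal (θ j ^ 2) ≤
      ENNReal.ofReal (Real.exp (-2 * α * K)) *
        ENNReal.ofReal (((j : ℕ+) : ℝ) ^ (2 * α) * θ j ^ 2) := by
    rw [← ENNReal.ofReal_mul (Real.exp_pos _).le]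
    refine ENNReal.ofReal_le_ofReal ?_
    have h1 : Real.exp (2 * α * K) ≤ ((j : ℕ+) : ℝ) ^ (2 * α) := by
      rw [mul_comm, Real.exp_mul]
      exact Real.rpow_le_rpow (Real.exp_pos _).le (exp_le_of_not_mem j) (by positivity)
    have h2 : Real.exp (-2 * α * K) * Real.exp (2 * α * K) = 1 := by
      rw [← Real.exp_add, ← Real.exp_zero]; congr 1; ring
    have h3 := mul_le_mul_of_nonneg_left h1 (Real.exp_pos (-2 * α * K)).le
    rw [h2] at h3
    nlinarith [mul_le_mul_of_nonneg_right h3 (sq_nonneg (θ j))]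
  change ∑' j : {j // j ∉ headIndices K}, ENNReal.ofReal (θ j ^ 2) ≤ _
  refine (ENNReal.tsum_le_tsum hle).trans ?_
  rw [ENNReal.tsum_mul_left, mul_comm (Q ^ 2), ENNReal.ofReal_mul (Real.exp_pos _).le]
  gcongr
  calc _ ≤ ∑' j : ℕ+, ENNReal.ofReal (((j : ℕ) : ℝ) ^ (2 * α) * θ j ^ 2) :=
        ENNReal.tsum_comp_le_tsum_of_injective Subtype.val_injective _
    _ ≤ _ := by
        rw [← ENNReal.ofReal_tsum_of_nonneg (fun j => by positivity) h.summable]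
        exact ENNReal.ofReal_le_ofReal h.tsum_le

theorem priorNhd_subset_tailBall (α η : ℝ) (θ₀ : ℕ+ → ℝ) (K : ℕ) :
    priorNhd α η θ₀ K ⊆ tailBall K (η * Real.exp (-2 * α * K)) := by
  rintro θ ⟨-, h⟩
  have hle (j : {j // j ∉ headIndices K}) : ENNReal.ofReal (θ j ^ 2) ≤
      ENNReal.ofReal (Real.exp (-2 * α * K)) *
        ENNReal.ofReal (Real.exp (2 * α * K) * ((j : ℕ+) : ℝ) ^ 2 * θ j ^ 2) := by
    rw [← ENNReal.ofReal_mul (Real.exp_pos _).le]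
    refine ENNReal.ofReal_le_ofReal ?_
    have h2 : Real.exp (-2 * α * K) * Real.exp (2 * α * K) = 1 := by
      rw [← Real.exp_add, ← Real.exp_zero]; congr 1; ring
    rw [← mul_assoc, ← mul_assoc, h2, one_mul]
    have h1 : (1 : ℝ) ≤ ((j : ℕ+) : ℝ) := by exact_mod_cast (j : ℕ+).pos
    nlinarith [sq_nonneg (θ j), mul_le_mul_of_nonneg_right (one_le_pow₀ h1 (n := 2))
      (sq_nonneg (θ j))]
  change ∑' j : {j // j ∉ headIndices K}, ENNReal.ofReal (θ j ^ 2) ≤ _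
  refine (ENNReal.tsum_le_tsum hle).trans ?_
  rw [ENNReal.tsum_mul_left, mul_comm η, ENNReal.ofReal_mul (Real.exp_pos _).le]
  gcongr
  exact h

/-- The head has at most `e^{K+1}` coordinates, each with squared error at most `e^{-(2α+1)K}`; both
tails have squared norm of order `e^{-2αK}`. -/
theorem sqDist_le_of_mem_priorNhd {α η Q : ℝ} (hα : 0 ≤ α) (hη : 0 ≤ η) {θ θ₀ : ℕ+ → ℝ}
    (h₀ : IsSobolevSeq α Q θ₀) (hs₀ : Summable fun j => |θ₀ j|) (hs : Summable fun j => |θ j|)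
    {K : ℕ} (h : θ ∈ priorNhd α η θ₀ K) :
    sqDist (fourierSeries θ) (fourierSeries θ₀) ≤
      (Real.exp 1 + (2 * η + 2 * Q ^ 2)) * Real.exp (-2 * α * K) := by
  have hhead : ∑ j ∈ headIndices K, ENNReal.ofReal ((θ j - θ₀ j) ^ 2) ≤
      ENNReal.ofReal (Real.exp 1 * Real.exp (-2 * α * K)) := by
    rw [← ENNReal.ofReal_sum_of_nonneg fun _ _ => sq_nonneg _]
    refine ENNReal.ofReal_le_ofReal ?_
    have hle : ∀ j ∈ headIndices K, (θ j - θ₀ j) ^ 2 ≤ Real.exp (-(2 * α + 1) * K) := by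
      intro j hj
      have hj' := h.1 j hj
      have e : Real.exp (-(2 * α + 1) * K) = Real.exp (-(α + 1 / 2) * K) ^ 2 := by
        rw [← Real.exp_nat_mul]; congr 1; push_cast; ring
      rw [e, sq_le_sq, abs_of_pos (Real.exp_pos _), abs_le]
      constructor <;> linarith [hj'.1, hj'.2]
    refine (Finset.sum_le_card_nsmul _ _ _ hle).trans ?_
    rw [nsmul_eq_mul]
    refine (mul_le_mul_of_nonneg_right (card_headIndices_le K) (Real.exp_pos _).le).trans
      (le_of_eq ?_)
    rw [← Real.exp_add, ← Real.exp_add]; congr 1; ring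
  have htail := tsum_tail_sub_sq_le (mul_nonneg hη (Real.exp_pos _).le)
    (mul_nonneg (sq_nonneg Q) (Real.exp_pos _).le) (priorNhd_subset_tailBall _ _ _ _ h)
    (h₀.mem_tailBall hα K)
  have := add_le_add hhead htail
  rw [← ofReal_sqDist_eq hs hs₀, ← ENNReal.ofReal_add (by positivity) (by positivity)] at this
  have := (ENNReal.ofReal_le_ofReal_iff (by positivity)).1 this
  linarith

/-- The `ℓ¹` budget is `B/3` for the truth, `B/6` for the head error, which tends to zero because `α
> 1/2`, and `B/3 + B/12` for the tail, by `|θ j| ≤ j² θ j ² + j^{-2}`. The last inequality is the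
reason for the weight `j²` in `priorNhd`. The total `11B/12` is below `B`. -/
theorem eventually_priorNhd_subset {α B : ℝ} (hα : 1 / 2 < α) (hB : 0 < B) :
    ∀ᶠ K : ℕ in atTop, ∀ θ₀ : ℕ+ → ℝ, (Summable fun j => |θ₀ j|) → ∑' j, |θ₀ j| ≤ B / 3 →
      priorNhd α (B / 3) θ₀ K ⊆ constraintSet B := by
  have ht := tendsto_tsum_tail (summable_rpow_pnat (s := 2) (by norm_num)) fun j => by positivity
  have he : Tendsto (fun K : ℕ => Real.exp 1 * Real.exp (-(α - 1 / 2) * K)) atTop (𝓝 0) := by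
    rw [← mul_zero (Real.exp 1)]
    refine (Real.tendsto_exp_atBot.comp ?_).const_mul _
    exact tendsto_natCast_atTop_atTop.const_mul_atTop_of_neg (by linarith)
  filter_upwards [ht.eventually_le_const (u := ENNReal.ofReal (B / 12)) (by simpa using hB),
    he.eventually_le_const (u := B / 6) (by positivity)] with K hK1 hK2 θ₀ hs₀ hle₀ θ hθ
  have hhead : ∑ j ∈ headIndices K, ENNReal.ofReal |θ j| ≤ ENNReal.ofReal (B / 3 + B / 6) := by
    rw [← ENNReal.ofReal_sum_of_nonneg fun _ _ => abs_nonneg _]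
    refine ENNReal.ofReal_le_ofReal ?_
    have hle : ∀ j ∈ headIndices K, |θ j| ≤ |θ₀ j| + Real.exp (-(α + 1 / 2) * K) := by
      intro j hj
      have hj' := hθ.1 j hj
      have : |θ j - θ₀ j| ≤ Real.exp (-(α + 1 / 2) * K) := by
        rw [abs_le]; constructor <;> linarith [hj'.1, hj'.2]
      linarith [abs_sub_abs_le_abs_sub (θ j) (θ₀ j)]
    refine (Finset.sum_le_sum hle).trans ?_
    rw [Finset.sum_add_distrib, Finset.sum_const, nsmul_eq_mul]
    refine add_le_add ((hs₀.sum_le_tsum _ fun _ _ => abs_nonneg _).trans hle₀) (le_trans ?_ hK2)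
    refine (mul_le_mul_of_nonneg_right (card_headIndices_le K) (Real.exp_pos _).le).trans
      (le_of_eq ?_)
    rw [← Real.exp_add, ← Real.exp_add]; congr 1; ring
  have htail : ∑' j : {j // j ∉ headIndices K}, ENNReal.ofReal |θ j| ≤
      ENNReal.ofReal (B / 3) + ENNReal.ofReal (B / 12) := by
    refine le_trans ?_ (add_le_add hθ.2 hK1)
    rw [← ENNReal.tsum_add]
    refine ENNReal.tsum_le_tsum fun j => ?_
    rw [← ENNReal.ofReal_add (by positivity) (by positivity)]
    refine ENNReal.ofReal_le_ofReal ?_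
    have h1 : (0 : ℝ) < ((j : ℕ+) : ℝ) := by exact_mod_cast (j : ℕ+).pos
    have h2 : (1 : ℝ) ≤ Real.exp (2 * α * K) :=
      Real.one_le_exp (mul_nonneg (by linarith) (by positivity))
    rw [Real.rpow_neg h1.le, Real.rpow_two]
    have h3 : |θ j| = (((j : ℕ+) : ℝ) * |θ j|) * ((j : ℕ+) : ℝ)⁻¹ := by field_simp
    have h4 : (((j : ℕ+) : ℝ) * |θ j|) * ((j : ℕ+) : ℝ)⁻¹ ≤
        (((j : ℕ+) : ℝ) * |θ j|) ^ 2 + (((j : ℕ+) : ℝ)⁻¹) ^ 2 := by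
      nlinarith [sq_nonneg ((((j : ℕ+) : ℝ) * |θ j|) - ((j : ℕ+) : ℝ)⁻¹),
        sq_nonneg ((((j : ℕ+) : ℝ) * |θ j|) + ((j : ℕ+) : ℝ)⁻¹)]
    rw [mul_pow, sq_abs, inv_pow] at h4
    have h5 : 0 ≤ ((j : ℕ+) : ℝ) ^ 2 * θ j ^ 2 := by positivity
    nlinarith
  change ∑' j, ENNReal.ofReal |θ j| < ENNReal.ofReal B
  calc ∑' j, ENNReal.ofReal |θ j| = ∑ j ∈ headIndices K, ENNReal.ofReal |θ j| +
        ∑' j : {j // j ∉ headIndices K}, ENNReal.ofReal |θ j| :=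
        (ENNReal.sum_add_tsum_compl (headIndices K) _).symm
    _ ≤ ENNReal.ofReal (B / 3 + B / 6) + (ENNReal.ofReal (B / 3) + ENNReal.ofReal (B / 12)) :=
        add_le_add hhead htail
    _ = ENNReal.ofReal (B / 3 + B / 6 + (B / 3 + B / 12)) := by
        rw [← ENNReal.ofReal_add (by positivity) (by positivity),
          ← ENNReal.ofReal_add (by positivity) (by positivity)]
    _ < ENNReal.ofReal B := (ENNReal.ofReal_lt_ofReal_iff hB).2 (by linarith)

/-! ### The modified block prior -/

theorem isSobolevSeq_zero (α Q : ℝ) : IsSobolevSeq α Q 0 :=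
  ⟨by simp, by simpa using sq_nonneg Q⟩

/-- A prior neighbourhood of the zero sequence has positive mass and lies in the constraint set; any
smoothness above `1/2` would do. -/
theorem IsMixing.centredBlockPrior_constraintSet_ne_zero (hg : IsMixing g) {B : ℝ} (hB : 0 < B) :
    centredBlockPrior g (constraintSet B) ≠ 0 := by
  obtain ⟨C, -, hC⟩ := hg.exists_priorNhd_ge one_pos 1 (η := B / 3) (by positivity)
  obtain ⟨K, h1, h2⟩ := (hC.and (eventually_priorNhd_subset (α := 1) (by norm_num) hB)).exists
  have h3 := (h1 0 (isSobolevSeq_zero 1 1) rfl).trans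
    (measure_mono (h2 0 (by simp) (by simpa using by positivity)))
  exact (lt_of_lt_of_le (ENNReal.ofReal_pos.2 (Real.exp_pos _)) h3).ne'

theorem ae_centredBlockPrior : ∀ᵐ θ ∂(centredBlockPrior g), θ 1 = 0 := by
  rw [centredBlockPrior, ae_map_iff measurable_update_one.aemeasurable
    (measurableSet_eq_fun (by fun_prop) measurable_const)]
  simp

theorem ae_modifiedBlockPrior (B : ℝ) : ∀ᵐ θ ∂(modifiedBlockPrior g B), θ ∈ admissible B := by
  have h1 : ∀ᵐ θ ∂(modifiedBlockPrior g B), θ ∈ constraintSet B :=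
    ae_cond_of_forall_mem (measurableSet_constraintSet B) fun _ h => h
  have h2 : ∀ᵐ θ ∂(modifiedBlockPrior g B), θ 1 = 0 :=
    cond_absolutelyContinuous.ae_le ae_centredBlockPrior
  filter_upwards [h1, h2] with θ h3 h4 using ⟨h3, h4⟩

/-- Conditioning divides by a probability, so it can only increase the mass of subsets of the
constraint set; the first coordinate vanishes almost surely. -/
theorem IsMixing.le_modifiedBlockPrior (hg : IsMixing g) {B : ℝ} {N : Set (ℕ+ → ℝ)}
    (hN : N ⊆ constraintSet B) :
    centredBlockPrior g N ≤ modifiedBlockPrior g B (N ∩ {θ | θ 1 = 0}) := by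
  have := hg.isProbabilityMeasure_centredBlockPrior
  have h0 : centredBlockPrior g {θ | θ 1 = 0}ᶜ = 0 := ae_centredBlockPrior
  rw [modifiedBlockPrior, cond_apply (measurableSet_constraintSet B),
    Set.inter_eq_right.2 (Set.inter_subset_left.trans hN), measure_inter_conull' (by
      refine measure_mono_null ?_ h0
      exact fun θ hθ => hθ.2)]
  exact le_mul_of_one_le_left' (ENNReal.one_le_inv.2 prob_le_one)

theorem modifiedBlockPrior_le (B : ℝ) (F : Set (ℕ+ → ℝ)) :
    modifiedBlockPrior g B F ≤
      (centredBlockPrior g (constraintSet B))⁻¹ * centredBlockPrior g F := by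
  rw [modifiedBlockPrior, cond_apply (measurableSet_constraintSet B)]
  gcongr
  exact Set.inter_subset_right

/-! ### Covering of shells -/

/-- Only the head coordinates need a net, at resolution `√(δ/2) r` in a ball of radius `2r`. On the
sieve the tails differ in squared norm by at most `4 e^{-2αK}`, which `hK` bounds by the other half
of the allowed `δ r²`. The cardinality does not depend on `r`. -/
theorem exists_shell_cover {α B δ r : ℝ} (hδ : 0 < δ) (hr : 0 < r) {θ₀ : ℕ+ → ℝ}
    (hs₀ : Summable fun j => |θ₀ j|) {K L : ℕ}
    (hK : 4 * Real.exp (-2 * α * K) ≤ δ / 2 * r ^ 2) :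
    ∃ t : Finset (ℕ+ → ℝ), (∀ θ ∈ t, θ ∈ admissible B ∧
        r ^ 2 ≤ sqDist (fourierSeries θ) (fourierSeries θ₀)) ∧
      (t.card : ℝ) ≤ (1 + 4 / √(δ / 2)) ^ (headIndices L).card ∧
      ∀ θ ∈ admissible B, θ ∈ tailBall L (Real.exp (-2 * α * K)) →
        r ^ 2 ≤ sqDist (fourierSeries θ) (fourierSeries θ₀) →
        sqDist (fourierSeries θ) (fourierSeries θ₀) ≤ 4 * r ^ 2 →
        ∃ η ∈ t, sqDist (fourierSeries θ) (fourierSeries η) ≤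
          δ * sqDist (fourierSeries η) (fourierSeries θ₀) := by
  set S : Set (ℕ+ → ℝ) := {θ | (θ ∈ admissible B ∧ θ ∈ tailBall L (Real.exp (-2 * α * K))) ∧
    r ^ 2 ≤ sqDist (fourierSeries θ) (fourierSeries θ₀) ∧
      sqDist (fourierSeries θ) (fourierSeries θ₀) ≤ 4 * r ^ 2} with hS
  set p : (ℕ+ → ℝ) → EuclideanSpace ℝ (headIndices L) :=
    fun θ => WithLp.toLp 2 fun j => θ j - θ₀ j with hp
  have hs : 0 < √(δ / 2) := Real.sqrt_pos.2 (half_pos hδ)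
  have hnorm (v : EuclideanSpace ℝ (headIndices L)) (u : ℕ+ → ℝ) (hv : ∀ j, v j = u j) :
      ENNReal.ofReal (‖v‖ ^ 2) = ∑ j ∈ headIndices L, ENNReal.ofReal (u j ^ 2) := by
    rw [EuclideanSpace.norm_sq_eq, ← ENNReal.ofReal_sum_of_nonneg fun _ _ => sq_nonneg _]
    rw [← Finset.sum_coe_sort (headIndices L) fun j => u j ^ 2]
    congr 1
    refine Finset.sum_congr rfl fun j _ => ?_
    rw [hv, Real.norm_eq_abs, sq_abs]
  have hbound : ∀ θ ∈ S, ‖p θ‖ ≤ 2 * r := by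
    intro θ hθ
    have h1 := ofReal_sqDist_eq (summable_of_mem_constraintSet hθ.1.1.1) hs₀ L
    have h2 : ENNReal.ofReal (‖p θ‖ ^ 2) ≤ ENNReal.ofReal ((2 * r) ^ 2) := by
      rw [hnorm (p θ) (fun j => θ j - θ₀ j) fun j => rfl]
      refine le_self_add.trans (h1.symm.le.trans (ENNReal.ofReal_le_ofReal ?_))
      linarith [hθ.2.2]
    have h3 := (ENNReal.ofReal_le_ofReal_iff (by positivity)).1 h2
    exact abs_le_of_sq_le_sq' h3 (by positivity) |>.2
  obtain ⟨t, htS, hcard, hcov⟩ := exists_finset_cover p S (by positivity : 0 ≤ 2 * r)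
    (mul_pos hs hr) hbound
  refine ⟨t, fun θ hθ => ⟨(htS θ hθ).1.1, (htS θ hθ).2.1⟩, hcard.trans (le_of_eq ?_),
    fun θ h1 h2 h3 h4 => ?_⟩
  · rw [finrank_euclideanSpace, Fintype.card_coe]
    congr 2; field_simp; ring
  · obtain ⟨η, hη, hlt⟩ := hcov θ ⟨⟨h1, h2⟩, h3, h4⟩
    refine ⟨η, hη, ?_⟩
    have hηS := htS η hη
    have e := ofReal_sqDist_eq (summable_of_mem_constraintSet h1.1)
      (summable_of_mem_constraintSet hηS.1.1.1) L
    have hhead : ∑ j ∈ headIndices L, ENNReal.ofReal ((θ j - η j) ^ 2) ≤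
        ENNReal.ofReal (δ / 2 * r ^ 2) := by
      rw [← hnorm (p θ - p η) (fun j => θ j - η j) fun j => by simp [hp]]
      refine ENNReal.ofReal_le_ofReal ?_
      refine (pow_le_pow_left₀ (norm_nonneg _) hlt.le 2).trans (le_of_eq ?_)
      rw [mul_pow, Real.sq_sqrt (by positivity)]
    have htail := tsum_tail_sub_sq_le (Real.exp_pos _).le (Real.exp_pos _).le h2 hηS.1.2
    have := add_le_add hhead htail
    rw [← e, ← ENNReal.ofReal_add (by positivity) (by positivity)] at this
    have := (ENNReal.ofReal_le_ofReal_iff (by positivity)).1 this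
    have h5 := mul_le_mul_of_nonneg_left hηS.2.1 hδ.le
    linarith

theorem measurable_sqDist_fourierSeries {f : ℝ → ℝ} (hf : Measurable f) :
    Measurable fun θ : ℕ+ → ℝ => sqDist (fourierSeries θ) f := by
  have h : Measurable fun z : (ℕ+ → ℝ) × ℝ => (fourierSeries z.1 z.2 - f z.2) ^ 2 :=
    (measurable_fourierSeries_uncurry.sub (hf.comp measurable_snd)).pow_const 2
  exact (h.stronglyMeasurable.integral_prod_right' (ν := unitVolume)).measurable

end BlockPrior

namespace BlockPrior

variable {g : ℕ → ℝ → ℝ}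

/-! ### Contraction of the posterior -/

/-- The number `y` may be negative: the bound serves the powers of affinities as well as those of `1
+ χ²`. -/
theorem pow_le_exp_neg {x y : ℝ} (h0 : 0 ≤ x) (h : x ≤ 1 - y) (n : ℕ) :
    x ^ n ≤ Real.exp (-(n * y)) := by
  refine (pow_le_pow_left₀ h0 (h.trans (Real.one_sub_le_exp_neg y)) n).trans (le_of_eq ?_)
  rw [← Real.exp_nat_mul]; congr 1; ring

theorem one_add_le_four_pow (m : ℕ) : (1 : ℝ) + m ≤ 4 ^ m := by
  have := one_add_mul_le_pow (a := (3 : ℝ)) (by norm_num) m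
  norm_num at this
  have : (0 : ℝ) ≤ m := by positivity
  linarith

/-- The total error of the tests over a family of nets on dyadic shells. -/
theorem tsum_net_le {X : Type*} {d b κ E : ℝ} (hd : 0 ≤ d) (hb : 0 ≤ b) (hE : 1 ≤ E)
    (hκ : d + b + 1 ≤ κ) (t : ℕ → Finset X) (ht : ∀ m, ((t m).card : ℝ) ≤ Real.exp (b * E)) :
    (1 + 2 * ENNReal.ofReal (Real.exp (d * E))) * ∑' i : (Σ m : ℕ, {η // η ∈ t m}),
        ENNReal.ofReal (Real.exp (-(κ * 4 ^ i.1 * E))) ≤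
      3 * (∑' m : ℕ, ENNReal.ofReal (Real.exp (-1)) ^ m) * ENNReal.ofReal (Real.exp (-E)) := by
  have hprod (x y : ℝ) : ENNReal.ofReal (Real.exp x) * ENNReal.ofReal (Real.exp y) =
      ENNReal.ofReal (Real.exp (x + y)) := by
    rw [← ENNReal.ofReal_mul (Real.exp_pos _).le, ← Real.exp_add]
  have h1 : (1 : ℝ≥0∞) ≤ ENNReal.ofReal (Real.exp (d * E)) := by
    rw [← ENNReal.ofReal_one]
    exact ENNReal.ofReal_le_ofReal (Real.one_le_exp (by positivity))
  have h2 : 1 + 2 * ENNReal.ofReal (Real.exp (d * E)) ≤ 3 * ENNReal.ofReal (Real.exp (d * E)) :=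
    calc _ ≤ ENNReal.ofReal (Real.exp (d * E)) + 2 * ENNReal.ofReal (Real.exp (d * E)) :=
          add_le_add_left h1 _
      _ = _ := by ring
  rw [ENNReal.tsum_sigma fun m (_ : {η // η ∈ t m}) =>
    ENNReal.ofReal (Real.exp (-(κ * 4 ^ m * E)))]
  refine (mul_le_mul_left h2 _).trans ?_
  rw [mul_assoc, mul_assoc, ← ENNReal.tsum_mul_left, ← ENNReal.tsum_mul_right]
  refine mul_le_mul_right (ENNReal.tsum_le_tsum fun m => ?_) _
  rw [tsum_fintype, Finset.sum_const, nsmul_eq_mul, Finset.card_univ, Fintype.card_coe,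
    ← ENNReal.ofReal_natCast]
  refine (mul_le_mul_right (mul_le_mul_left (ENNReal.ofReal_le_ofReal (ht m)) _) _).trans ?_
  rw [hprod, hprod, ← ENNReal.ofReal_pow (Real.exp_pos _).le, ← Real.exp_nat_mul, hprod]
  refine ENNReal.ofReal_le_ofReal (Real.exp_le_exp.2 ?_)
  have hm0 : (0 : ℝ) ≤ m := by positivity
  -- The exponent grows like `4^m` while the nets have bounded size. The linear lower bound `1 + m`
  -- suffices for a geometric series in `m`, with a spare factor `e^{-E}`.
  have h3 : (d + b + 1) * (1 + m) ≤ κ * 4 ^ m :=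
    mul_le_mul hκ (one_add_le_four_pow m) (by positivity) (by linarith)
  have h4 : d + b + 1 + m ≤ κ * 4 ^ m := by nlinarith
  nlinarith [mul_le_mul_of_nonneg_right h4 (by linarith : 0 ≤ E)]

/-- `M`, `C` and the range of `K` are fixed before `n`, `θ₀` and `S`; this order of quantifiers
gives uniformity over the Sobolev ball. -/
theorem IsMixing.exists_contraction (hg : IsMixing g) {α Q B : ℝ} (hα : 1 / 2 < α) (hB : 0 < B)
    (hsob : ∀ θ, IsSobolevSeq α Q θ → (Summable fun j => |θ j|) ∧ ∑' j, |θ j| ≤ B / 3) :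
    ∃ M > 0, ∃ C : ℝ≥0∞, C ≠ ∞ ∧ ∀ᶠ K : ℕ in atTop, ∀ n : ℕ,
      Real.exp ((2 * α + 1) * K) ≤ n → (n : ℝ) ≤ Real.exp ((2 * α + 1) * (K + 1)) →
      ∀ θ₀, IsSobolevSeq α Q θ₀ → θ₀ 1 = 0 → ∀ S : Set (ℕ+ → ℝ),
        (∀ θ ∈ S, M * Real.exp (-α * (K + 1)) ≤
          hellinger (fourierSeries θ) (fourierSeries θ₀)) →
        ∫⁻ x, posterior (modifiedBlockPrior g B) (fourierSeries θ₀) x S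
          ∂(sampleLaw (fourierSeries θ₀) n) ≤ C * ENNReal.ofReal (Real.exp (-Real.exp K)) := by
  have hα0 : 0 < α := by linarith
  set R := √2 * B with hR
  obtain ⟨Cχ, hCχ, hχ⟩ := exists_integral_sq_div_le R
  obtain ⟨CH, hCH, hH⟩ := exists_hellinger_sq_le R
  obtain ⟨ca, hca, δ, hδ, haff⟩ := exists_affinity_bounds R
  obtain ⟨Cp, hCp, hprior⟩ := hg.exists_priorNhd_ge hα0 Q (η := B / 3) (by positivity)
  set Cρ := Real.exp 1 + (2 * (B / 3) + 2 * Q ^ 2) with hCρ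
  have hCρ0 : 0 < Cρ := by positivity
  -- `exp(lam e^K)` bounds the expected inverse likelihood ratio on the prior neighbourhood. The
  -- factor `e^{2α+1}` is the slack of `n` between consecutive values of `K`.
  set lam := Cχ * Cρ * Real.exp (2 * α + 1) with hlam
  have hlam0 : 0 < lam := by positivity
  -- With `q = e^{-Cp E}` and `c = e^{(lam + Cp + 1)E}`, the evidence term is `2 e^{-E}` and the
  -- inverse denominator is at most `2 e^{Cd E}`. The sieve is therefore taken with exponent `Cd +
  -- 1`.
  set Cd := lam + 2 * Cp + 1 with hCd
  have hCd0 : 0 < Cd := by positivity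
  obtain ⟨m₀, hsieve⟩ := hg.exists_compl_tailBall_le hα0.le (Cd + 1)
  set A := 1 + 4 / √(δ / 2) with hA
  have hA1 : 1 ≤ A := le_add_of_nonneg_right (by positivity)
  -- Each net has at most `e^{CN E}` points.
  set CN := Real.log A * Real.exp (m₀ + 1) with hCN
  have hCN0 : 0 ≤ CN := mul_nonneg (Real.log_nonneg hA1) (Real.exp_pos _).le
  -- The first summand lets the separation exponent beat the inverse denominator and the net size;
  -- the second makes the shells wide enough for `exists_shell_cover`.
  set ϱ := (Cd + CN + 1) / ca + 8 / δ with hϱ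
  have hϱ0 : 0 < ϱ := by positivity
  have hϱ1 : Cd + CN + 1 ≤ ca * ϱ := by
    have : 0 < 8 / δ := by positivity
    have h : (Cd + CN + 1) / ca ≤ ϱ := by linarith
    rwa [div_le_iff₀' hca] at h
  have hϱ2 : 4 ≤ δ / 2 * ϱ := by
    have : 0 < (Cd + CN + 1) / ca := by positivity
    have h : 8 / δ ≤ ϱ := by linarith
    rw [div_le_iff₀ hδ] at h
    linarith
  set D₀ := centredBlockPrior g (constraintSet B) with hD₀
  have hD₀0 : D₀ ≠ 0 := hg.centredBlockPrior_constraintSet_ne_zero hB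
  have := hg.isProbabilityMeasure_centredBlockPrior
  have : IsProbabilityMeasure (modifiedBlockPrior g B) := cond_isProbabilityMeasure hD₀0
  set G : ℝ≥0∞ := ∑' m : ℕ, ENNReal.ofReal (Real.exp (-1)) ^ m with hG
  have hGtop : G ≠ ∞ := by
    have hlt : ENNReal.ofReal (Real.exp (-1)) < 1 := by
      rw [← ENNReal.ofReal_one]
      refine (ENNReal.ofReal_lt_ofReal_iff one_pos).2 ?_
      rw [← Real.exp_zero]
      exact Real.exp_lt_exp.2 (by norm_num)
    rw [hG, ENNReal.tsum_geometric]
    exact ENNReal.inv_ne_top.2 (tsub_pos_of_lt hlt).ne'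
  -- The factor `e^{2α}` compensates for `K + 1` in place of `K`, and `CH` converts Hellinger into
  -- `L²` distance, so that points of `S` in the sieve have squared `L²` distance at least `ϱ
  -- e^{-2αK}`. The three summands of the second constant are the evidence, sieve and net errors.
  refine ⟨√(ϱ * CH * Real.exp (2 * α)), Real.sqrt_pos.2 (by positivity), 2 + 2 * D₀⁻¹ + 3 * G,
    by finiteness, ?_⟩
  filter_upwards [hprior, hsieve, eventually_priorNhd_subset hα hB] with K hK1 hK2 hK3
    n hn1 hn2 θ₀ h₀ h01 S hSH
  obtain ⟨hs₀, hle₀⟩ := hsob θ₀ h₀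
  have hE1 : 1 ≤ Real.exp K := Real.one_le_exp (by positivity)
  set E := Real.exp K with hE
  have hbd₀ : IsBddBy R (fourierSeries θ₀) := isBddBy_fourierSeries hs₀ (by linarith)
  have hbd : ∀ θ ∈ admissible B, IsBddBy R (fourierSeries θ) := fun θ hθ =>
    isBddBy_of_mem_constraintSet hθ.1
  have hzero : ∀ θ ∈ admissible B, ∫ t, (fourierSeries θ t - fourierSeries θ₀ t) ∂unitVolume = 0 :=
    fun θ hθ => integral_fourierSeries_sub (summable_of_mem_constraintSet hθ.1) hs₀
      (hθ.2.trans h01.symm)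
  set r : ℕ → ℝ := fun m => 2 ^ m * (√ϱ * Real.exp (-α * K)) with hr
  have hr0 (m : ℕ) : 0 < r m := mul_pos (by positivity)
    (mul_pos (Real.sqrt_pos.2 hϱ0) (Real.exp_pos _))
  have hrsq (m : ℕ) : r m ^ 2 = 4 ^ m * (ϱ * Real.exp (-2 * α * K)) := by
    have e : Real.exp (-2 * α * K) = Real.exp (-α * K) ^ 2 := by
      rw [← Real.exp_nat_mul]; congr 1; push_cast; ring
    rw [hr, mul_pow, mul_pow, Real.sq_sqrt hϱ0.le, e, ← pow_mul, mul_comm m, pow_mul]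
    norm_num
  have hnE : E ≤ n * Real.exp (-2 * α * K) := by
    refine le_trans (le_of_eq ?_) (mul_le_mul_of_nonneg_right hn1 (Real.exp_pos _).le)
    rw [← Real.exp_add, hE]; congr 1; ring
  have hnE2 : n * Real.exp (-2 * α * K) ≤ Real.exp (2 * α + 1) * E := by
    refine (mul_le_mul_of_nonneg_right hn2 (Real.exp_pos _).le).trans (le_of_eq ?_)
    rw [← Real.exp_add, hE, ← Real.exp_add]; congr 1; ring
  have hcov (m : ℕ) := exists_shell_cover (α := α) (B := B) hδ (hr0 m) hs₀ (K := K) (L := K + m₀)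
    (by
      rw [hrsq]
      have h1 : (1 : ℝ) ≤ 4 ^ m := one_le_pow₀ (by norm_num)
      have h2 := mul_le_mul_of_nonneg_right hϱ2 (Real.exp_pos (-2 * α * K)).le
      refine h2.trans ?_
      have h3 : 0 ≤ δ / 2 * ϱ * Real.exp (-2 * α * K) := by positivity
      nlinarith [mul_le_mul_of_nonneg_right h1 h3])
  choose t ht1 ht2 ht3 using hcov
  set a : ℕ → ℝ := fun m => Real.exp (-(ca * ϱ * 4 ^ m * E)) with ha
  have hnr (m : ℕ) (y : ℝ) (hy : r m ^ 2 ≤ y) : Real.exp (-(n * (ca * y))) ≤ a m := by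
    refine Real.exp_le_exp.2 (neg_le_neg ?_)
    rw [hrsq] at hy
    have hn0 : (0 : ℝ) ≤ n := by positivity
    calc ca * ϱ * 4 ^ m * E ≤ ca * ϱ * 4 ^ m * (n * Real.exp (-2 * α * K)) := by gcongr
      _ = n * (ca * (4 ^ m * (ϱ * Real.exp (-2 * α * K)))) := by ring
      _ ≤ _ := by gcongr
  have := hbd₀.isProbabilityMeasure_expMeasure
  have : IsProbabilityMeasure (sampleLaw (fourierSeries θ₀) n) := by
    unfold sampleLaw; infer_instance
  have key := lintegral_posterior_le (P := sampleLaw (fourierSeries θ₀) n)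
    (Pr := modifiedBlockPrior g B) (I := Σ m : ℕ, {η // η ∈ t m})
    (measurable_likelihoodRatio hbd₀.expDensity.measurable n)
    ((ae_modifiedBlockPrior B).mono fun θ hθ =>
      (lintegral_likelihoodRatio hbd₀ (hbd θ hθ) n).le)
    (N := priorNhd α (B / 3) θ₀ K ∩ {θ | θ 1 = 0})
    (F := (tailBall (K + m₀) (Real.exp (-2 * α * K)) ∩ admissible B)ᶜ) (S := S)
    ((measurableSet_priorNhd ..).inter (measurableSet_eq_fun (by fun_prop) measurable_const))
    ((measurableSet_tailBall ..).inter (measurableSet_admissible B)).compl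
    (U := fun i => {θ | θ ∈ admissible B ∧ sqDist (fourierSeries θ) (fourierSeries i.2) ≤
      δ * sqDist (fourierSeries i.2) (fourierSeries θ₀)})
    (fun i => (measurableSet_admissible B).inter (measurableSet_le
      (measurable_sqDist_fourierSeries (hbd _ (ht1 i.1 i.2 i.2.2).1).measurable) measurable_const))
    ?_
    (l := ENNReal.ofReal (Real.exp (lam * E))) (q := ENNReal.ofReal (Real.exp (-Cp * E)))
    (c := ENNReal.ofReal (Real.exp ((lam + Cp + 1) * E))) ?_
    ((hK1 θ₀ h₀ h01).trans (hg.le_modifiedBlockPrior (hK3 θ₀ hs₀ hle₀)))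
    (ENNReal.ofReal_pos.2 (Real.exp_pos _)).ne' (ENNReal.ofReal_pos.2 (Real.exp_pos _)).ne'
    ENNReal.ofReal_ne_top
    (T := fun i => sqrtRatio (fourierSeries θ₀) (fourierSeries i.2))
    (fun i => measurable_sqrtRatio hbd₀.expDensity.measurable
      (hbd _ (ht1 i.1 i.2 i.2.2).1).expDensity.measurable n)
    (a := fun i => ENNReal.ofReal (a i.1)) ?_ ?_
  rotate_left
  · intro θ hθ
    by_cases hF : θ ∈ tailBall (K + m₀) (Real.exp (-2 * α * K)) ∩ admissible B
    swap
    · exact Or.inl hF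
    right
    have hHθ := hH _ _ (hbd θ hF.2) hbd₀
    have h1 : ϱ * Real.exp (-2 * α * K) ≤ sqDist (fourierSeries θ) (fourierSeries θ₀) := by
      have h2 := pow_le_pow_left₀ (mul_nonneg (Real.sqrt_nonneg _) (Real.exp_pos _).le)
        (hSH θ hθ) 2
      rw [mul_pow, Real.sq_sqrt (by positivity), ← Real.exp_nat_mul, mul_assoc,
        ← Real.exp_add] at h2
      have e : 2 * α + ((2 : ℕ) : ℝ) * (-α * (K + 1)) = -2 * α * K := by push_cast; ring
      rw [e] at h2
      have h3 := h2.trans hHθ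
      have h4 : CH * (ϱ * Real.exp (-2 * α * K)) ≤
          CH * sqDist (fourierSeries θ) (fourierSeries θ₀) := by linarith
      exact le_of_mul_le_mul_left h4 hCH
    have hpos : 0 < ϱ * Real.exp (-2 * α * K) := by positivity
    -- The squared distance lies between consecutive powers of four times `ϱ e^{-2αK}`, which
    -- selects the dyadic shell.
    obtain ⟨m, hm1, hm2⟩ := exists_nat_pow_near ((one_le_div hpos).2 h1)
      (by norm_num : (1 : ℝ) < 4)
    rw [le_div_iff₀ hpos, ← hrsq] at hm1
    rw [div_lt_iff₀ hpos, pow_succ, mul_comm _ (4 : ℝ), mul_assoc, ← hrsq] at hm2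
    obtain ⟨η, hη, hle⟩ := ht3 m θ hF.2 hF.1 hm1 hm2.le
    exact Set.mem_iUnion.2 ⟨⟨m, η, hη⟩, hF.2, hle⟩
  · rintro θ ⟨hθ, h1⟩
    have hadm : θ ∈ admissible B := ⟨hK3 θ₀ hs₀ hle₀ hθ, h1⟩
    refine (lintegral_inv_likelihoodRatio hbd₀ (hbd θ hadm) n).le.trans
      (ENNReal.ofReal_le_ofReal ?_)
    have hd := sqDist_le_of_mem_priorNhd hα0.le (by positivity) h₀ hs₀
      (summable_of_mem_constraintSet hadm.1) hθ
    have h2 := (hχ _ _ hbd₀ (hbd θ hadm)).trans (add_le_add_right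
      (mul_le_mul_of_nonneg_left ((sqDist_comm _ _).le.trans hd) hCχ.le) 1)
    rw [← hCρ] at h2
    have h3 : 0 ≤ ∫ t, expDensity (fourierSeries θ₀) t ^ 2 /
        expDensity (fourierSeries θ) t ∂unitVolume :=
      integral_nonneg fun t => div_nonneg (sq_nonneg _) ((hbd θ hadm).expDensity_pos t).le
    -- Here `y` is negative and the bound is `(1 + u)^n ≤ e^{nu}`.
    refine (pow_le_exp_neg (y := -(Cχ * (Cρ * Real.exp (-2 * α * K)))) h3 (by linarith) n).trans
      (Real.exp_le_exp.2 ?_)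
    calc -(n * -(Cχ * (Cρ * Real.exp (-2 * α * K))))
        = Cχ * Cρ * (n * Real.exp (-2 * α * K)) := by ring
      _ ≤ Cχ * Cρ * (Real.exp (2 * α + 1) * E) := by gcongr
      _ = lam * E := by rw [hlam]; ring
  · rintro ⟨m, η, hη⟩
    obtain ⟨h1, h2⟩ := ht1 m η hη
    refine (lintegral_sqrtRatio hbd₀ (hbd η h1) n).le.trans (ENNReal.ofReal_le_ofReal ?_)
    exact (pow_le_exp_neg (integral_nonneg fun t => mul_nonneg (Real.sqrt_nonneg _)
      (Real.sqrt_nonneg _)) (haff _ _ hbd₀ (hbd η h1) (hzero η h1)).1 n).trans (hnr m _ h2)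
  · rintro ⟨m, η, hη⟩ θ ⟨hθ, hclose⟩
    obtain ⟨h1, h2⟩ := ht1 m η hη
    refine (lintegral_inv_sqrtRatio_mul hbd₀ (hbd η h1) (hbd θ hθ) n).le.trans
      (ENNReal.ofReal_le_ofReal ?_)
    exact (pow_le_exp_neg (integral_nonneg fun t => mul_nonneg ((hbd θ hθ).expDensity_pos t).le
      (div_nonneg (Real.sqrt_nonneg _) (Real.sqrt_nonneg _)))
      ((haff _ _ hbd₀ (hbd η h1) (hzero η h1)).2 _ (hbd θ hθ) hclose) n).trans (hnr m _ h2)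
  refine le_trans key ?_
  simp only [← ENNReal.ofReal_inv_of_pos (Real.exp_pos _), ← Real.exp_neg]
  have hprod (x y : ℝ) : ENNReal.ofReal (Real.exp x) * ENNReal.ofReal (Real.exp y) =
      ENNReal.ofReal (Real.exp (x + y)) := by
    rw [← ENNReal.ofReal_mul (Real.exp_pos _).le, ← Real.exp_add]
  have hcq : 2 * ENNReal.ofReal (Real.exp ((lam + Cp + 1) * E)) *
      ENNReal.ofReal (Real.exp (-(-Cp * E))) = 2 * ENNReal.ofReal (Real.exp (Cd * E)) := by
    rw [mul_assoc, hprod, hCd]; congr 3; ring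
  rw [hcq, add_mul _ (3 * G), add_mul 2]
  refine add_le_add (add_le_add ?_ ?_) ?_
  · rw [mul_assoc, mul_assoc, hprod, hprod]
    gcongr
    exact le_of_eq (by ring)
  · have hF : modifiedBlockPrior g B
        (tailBall (K + m₀) (Real.exp (-2 * α * K)) ∩ admissible B)ᶜ ≤
        D₀⁻¹ * ENNReal.ofReal (Real.exp (-(Cd + 1) * E)) := by
      rw [Set.compl_inter]
      refine (measure_union_le _ _).trans ?_
      have h0 : modifiedBlockPrior g B (admissible B)ᶜ = 0 := ae_modifiedBlockPrior B
      rw [h0, add_zero]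
      refine (modifiedBlockPrior_le B _).trans ?_
      gcongr
    refine (mul_le_mul_right hF _).trans (le_of_eq ?_)
    rw [mul_mul_mul_comm, hprod]; congr 3; ring
  · refine tsum_net_le hCd0.le hCN0 hE1 hϱ1 t fun m => ?_
    refine (ht2 m).trans ?_
    have hA0 : 0 < A := by linarith
    rw [← Real.rpow_natCast, Real.rpow_def_of_pos hA0]
    refine Real.exp_le_exp.2 ?_
    have h1 := mul_le_mul_of_nonneg_left (card_headIndices_le (K + m₀)) (Real.log_nonneg hA1)
    refine h1.trans (le_of_eq ?_)
    rw [hCN, hE, mul_assoc, ← Real.exp_add]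
    congr 2; push_cast; ring

/-! ### Reduction to Fourier series -/

theorem expDensity_congr_ae {f h : ℝ → ℝ} (hfh : f =ᵐ[unitVolume] h) :
    expDensity f =ᵐ[unitVolume] expDensity h := by
  have e : ∫ s, Real.exp (f s) ∂unitVolume = ∫ s, Real.exp (h s) ∂unitVolume :=
    integral_congr_ae (hfh.mono fun t ht => by simp only [ht])
  filter_upwards [hfh] with t ht
  simp only [expDensity, ht, e]

theorem expMeasure_congr {f h : ℝ → ℝ} (hfh : expDensity f =ᵐ[unitVolume] expDensity h) :
    expMeasure f = expMeasure h :=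
  withDensity_congr_ae (hfh.mono fun t ht => by simp only [ht])

theorem hellinger_congr_right {f h₁ h₂ : ℝ → ℝ}
    (h : expDensity h₁ =ᵐ[unitVolume] expDensity h₂) : hellinger f h₁ = hellinger f h₂ := by
  unfold hellinger
  congr 1
  exact integral_congr_ae (h.mono fun t ht => by simp only [ht])

/-- The truth enters only through its sampling law and its density at the observations, and these
almost surely avoid a null set. -/
theorem lintegral_posterior_congr {f h : ℝ → ℝ} (hfh : expDensity f =ᵐ[unitVolume] expDensity h)
    [IsProbabilityMeasure (expMeasure h)] (Pr : Measure (ℕ+ → ℝ)) (n : ℕ) (S : Set (ℕ+ → ℝ)) :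
    ∫⁻ x, posterior Pr f x S ∂(sampleLaw f n) = ∫⁻ x, posterior Pr h x S ∂(sampleLaw h n) := by
  have e : sampleLaw f n = sampleLaw h n := by rw [sampleLaw, sampleLaw, expMeasure_congr hfh]
  rw [e]
  have hae : ∀ᵐ t ∂(expMeasure h), expDensity f t = expDensity h t :=
    (withDensity_absolutelyContinuous _ _).ae_le hfh
  have hx : ∀ᵐ x ∂(sampleLaw h n), ∀ i, expDensity f (x i) = expDensity h (x i) :=
    ae_all_iff.2 fun i => (measurePreserving_eval (fun _ : Fin n => expMeasure h) i)
      |>.quasiMeasurePreserving.ae hae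
  refine lintegral_congr_ae (hx.mono fun x hx => ?_)
  simp only [posterior, likelihoodRatio, hx]

/-- Every element of a Sobolev ball has the density of a centred absolutely convergent series. -/
theorem exists_fourierSeries_of_mem_sobolevBall {α αs Q : ℝ} (hαs : 1 / 2 < αs) (hα : αs ≤ α)
    (hQ : 0 ≤ Q) {f : ℝ → ℝ} (hf : f ∈ sobolevBall α Q) :
    ∃ θ, IsSobolevSeq α Q θ ∧ θ 1 = 0 ∧
      expDensity f =ᵐ[unitVolume] expDensity (fourierSeries θ) := by
  have h := isSobolevSeq_fourierCoefficient hf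
  have hs := (h.summable_abs_and_le hαs hα hQ).1
  refine ⟨Function.update (fourierCoefficient f) 1 0, h.update, by simp, ?_⟩
  rw [expDensity_fourierSeries_update hs]
  exact expDensity_congr_ae (ae_eq_fourierSeries hf.1 hs)

theorem tendsto_floor_log_div {b : ℝ} (hb : 0 < b) :
    Tendsto (fun n : ℕ => ⌊Real.log n / b⌋₊) atTop atTop :=
  tendsto_nat_floor_atTop.comp
    ((Real.tendsto_log_atTop.comp tendsto_natCast_atTop_atTop).atTop_div_const hb)

end BlockPrior

/-! ### The main theorem. -/

open BlockPrior in
theorem theorem3p1 (g : ℕ → ℝ → ℝ) (hg : IsMixing g) (αs : ℝ) (hαs : 1 / 2 < αs)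
    (B α Q : ℝ) (hα : αs ≤ α) (hQ : 0 < Q) (hB : 3 * gammaConst αs * Q ≤ B) :
    IsProbabilityMeasure (modifiedBlockPrior g B) ∧
    (∀ f₀ ∈ sobolevBall α Q, IsProbabilityMeasure (expMeasure f₀)) ∧
    ∃ M : ℝ, 0 < M ∧
      Tendsto (fun n : ℕ => ⨆ f₀ ∈ sobolevBall α Q,
          ∫⁻ x, posterior (modifiedBlockPrior g B) f₀ x
            {θ | M * (n : ℝ) ^ (-α / (2 * α + 1)) < hellinger (fourierSeries θ) f₀}
            ∂(sampleLaw f₀ n))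
        atTop (𝓝 0) := by
  have hγ := gammaConst_pos hαs
  have hB0 : 0 < B := lt_of_lt_of_le (by positivity) hB
  have hsob : ∀ θ, IsSobolevSeq α Q θ → (Summable fun j => |θ j|) ∧ ∑' j, |θ j| ≤ B / 3 :=
    fun θ hθ => by
      obtain ⟨h1, h2⟩ := hθ.summable_abs_and_le hαs hα hQ.le
      exact ⟨h1, by linarith⟩
  have hbd : ∀ θ, IsSobolevSeq α Q θ → IsBddBy (√2 * (B / 3)) (fourierSeries θ) :=
    fun θ hθ => isBddBy_fourierSeries (hsob θ hθ).1 (hsob θ hθ).2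
  have := hg.isProbabilityMeasure_centredBlockPrior
  refine ⟨cond_isProbabilityMeasure (hg.centredBlockPrior_constraintSet_ne_zero hB0),
    fun f₀ hf₀ => ?_, ?_⟩
  · obtain ⟨θ, h1, -, h2⟩ := exists_fourierSeries_of_mem_sobolevBall hαs hα hQ.le hf₀
    rw [expMeasure_congr h2]
    exact (hbd θ h1).isProbabilityMeasure_expMeasure
  obtain ⟨M, hM, C, hC, hcontr⟩ := hg.exists_contraction (hαs.trans_le hα) hB0 hsob
  refine ⟨M, hM, ?_⟩
  have hb : 0 < 2 * α + 1 := by linarith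
  -- The block level attached to `n` is `K = ⌊log n / (2α+1)⌋`, which gives both inequalities
  -- between `n` and powers of `e^{2α+1}` and makes `e^{-α(K+1)}` at most `n^{-α/(2α+1)}`.
  have hKt := tendsto_floor_log_div hb
  have hbound : Tendsto (fun n : ℕ => C * ENNReal.ofReal
      (Real.exp (-Real.exp (⌊Real.log n / (2 * α + 1)⌋₊ : ℕ)))) atTop (𝓝 0) := by
    have h1 : Tendsto (fun x : ℝ => Real.exp (-Real.exp x)) atTop (𝓝 0) :=
      Real.tendsto_exp_neg_atTop_nhds_zero.comp Real.tendsto_exp_atTop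
    have h2 := ENNReal.tendsto_ofReal (h1.comp (tendsto_natCast_atTop_atTop.comp hKt))
    rw [ENNReal.ofReal_zero] at h2
    simpa using ENNReal.Tendsto.const_mul h2 (Or.inr hC)
  refine tendsto_of_tendsto_of_tendsto_of_le_of_le' tendsto_const_nhds hbound
    (Eventually.of_forall fun _ => zero_le) ?_
  filter_upwards [hKt.eventually hcontr, eventually_ge_atTop 1] with n hn hn1
  have hn0 : (0 : ℝ) < n := by exact_mod_cast hn1
  have hlog0 : 0 ≤ Real.log n / (2 * α + 1) :=
    div_nonneg (Real.log_nonneg (by exact_mod_cast hn1)) hb.le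
  have hK1 := Nat.floor_le hlog0
  have hK2 := (Nat.lt_floor_add_one (Real.log n / (2 * α + 1))).le
  rw [le_div_iff₀ hb] at hK1
  rw [div_le_iff₀ hb] at hK2
  refine iSup₂_le fun f₀ hf₀ => ?_
  -- Replacing the truth by a centred series with almost everywhere the same density changes neither
  -- the expected posterior nor the Hellinger distances.
  obtain ⟨θ, h1, h01, h2⟩ := exists_fourierSeries_of_mem_sobolevBall hαs hα hQ.le hf₀
  have := (hbd θ h1).isProbabilityMeasure_expMeasure
  rw [lintegral_posterior_congr h2]
  simp only [hellinger_congr_right h2]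
  refine hn n ?_ ?_ θ h1 h01 _ fun η hη => le_trans ?_ (le_of_lt hη)
  · rw [← Real.le_log_iff_exp_le hn0]; linarith
  · rw [← Real.log_le_iff_le_exp hn0]; linarith
  · refine mul_le_mul_of_nonneg_left ?_ hM.le
    rw [Real.rpow_def_of_pos hn0]
    refine Real.exp_le_exp.2 ?_
    rw [mul_div_assoc', le_div_iff₀ hb]
    nlinarith
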